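/- Let $\sigma$ be a $\mathbb{C}$-algebra automorphism of $\mathbb{C}[h]$, let $P\in\mathbb{C}[h]$, and let $A=\mathbb{C}[h](\sigma,P)$ be the generalized Weyl algebra, i.e. the algebra generated by $x,y$ over $D=\mathbb{C}[h]$ with relations $xd=\sigma(d)x$, $yd=\sigma^{-1}(d)y$ $(d\in D)$, $yx=P$, $xy=\sigma(P)$. Put $A_0=D$, $A_n=Dy^n$ and $A_{-n}=Dx^{n}$ for $n>0$, and equip $A$ with the fine topology (generated by all seminorms). A locally convex algebra is a complete Hausdorff locally convex complex vector space with an algebra structure such that for every continuous seminorm $p$ there is a continuous seminorm $q$ with $p(ab)\le q(a)q(b)$; an extension of such algebras is linearly split if the quotient map has a continuous linear section; $\otimes_\pi$ is the completed projective tensor product. Let $\mathcal{K}$ be the space of matrices $(a_{ij})_{i,j\in\mathbb{N}}$ with $\sum_{i,j}(1+i+j)^n|a_{ij}|<\infty$ for all $n$, with elementary matrices $e_{ij}$, and let $\mathcal{T}=\mathcal{K}\oplus C^\infty(S^1)$ be the smooth Toeplitz algebra, where $(a,f)$ with $f=\sum_k f_kz^k$ is multiplied through its symbol $f$ and its matrix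 $(a_{ij}+f_{i-j})_{i,j\in\mathbb{N}}$; let $S=(0,z)$, $S^*=(0,z^{-1})$, and let $p:\mathcal{T}\otimes_\pi A\to C^\infty(S^1)\otimes_\pi A$ be induced by $(a,f)\mapsto f$. Let $\mathcal{T}_A$ be the closed subalgebra of $\mathcal{T}\otimes_\pi A$ generated by $1\otimes A_0$, $S\otimes A_1$ and $S^*\otimes A_{-1}$. Then the sum $\bigoplus_{i,j\ge 0}e_{ij}\otimes A_{i+1}A_{-(j+1)}$ inside $\mathcal{T}\otimes_\pi A$ is direct; let $\Lambda_A$ be its closure. If $P=0$ or $P$ is non constant, the algebraic direct sum is already closed, i.e. $\Lambda_A=\bigoplus_{i,j\ge 0}e_{ij}\otimes A_{i+1}A_{-(j+1)}$. For every $P$, $\Lambda_A$ is a two-sided ideal of $\mathcal{T}_A$, the rule $a\mapsto z^n\otimes a$ for $a\in A_n$ defines an algebra homomorphism $A\to C^\infty(S^1)\otimes_\pi A$ that is a homeomorphism of $A$ onto $p(\mathcal{T}_A)$, and, with $\iota$ the inclusion and $\bar p$ the restriction of $p$ to $\mathcal{T}_A$ (with values in $p(\mathcal{T}_A)\cong A$),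 $$0\to\Lambda_A\overset{\iota}\to\mathcal{T}_A\overset{\bar p}\to A\to 0$$ is a linearly split extension of locally convex algebras. -/

import Mathlib

noncomputable section

open scoped TensorProduct ENNReal Topology
open Filter

/-! ### Locally convex algebras -/

/-- A (not necessarily unital or complete) complex algebra whose topology is given by seminorms,
such that every continuous seminorm `p` admits a continuous seminorm `q` with
`p (a * b) ≤ q a * q b`. -/
class SeminormedMul (E : Type*) [NonUnitalRing E] [Module ℂ E] [TopologicalSpace E] : Prop
    extends PolynormableSpace ℂ E where
  exists_mul_le : ∀ p : Seminorm ℂ E, Continuous p →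
    ∃ q : Seminorm ℂ E, Continuous q ∧ ∀ a b : E, p (a * b) ≤ q a * q b

/-- Locally convex algebras: complete (Hausdorff) locally convex complex vector spaces with an
algebra structure for which every continuous seminorm `p` admits a continuous seminorm `q` with
`p (a * b) ≤ q a * q b`. -/
class IsLocallyConvexAlgebra (E : Type*) [NonUnitalRing E] [Module ℂ E] [IsScalarTower ℂ E E]
    [SMulCommClass ℂ E E] [UniformSpace E] : Prop extends SeminormedMul E where
  isUniformAddGroup : IsUniformAddGroup E
  complete : CompleteSpace E
  t2 : T2Space E

/-- `0 → I → E → B → 0` is a linearly split extension of locally convex algebras. -/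
structure IsLinearlySplitExtension {I E B : Type*}
    [NonUnitalRing I] [Module ℂ I] [IsScalarTower ℂ I I] [SMulCommClass ℂ I I] [UniformSpace I]
    [NonUnitalRing E] [Module ℂ E] [IsScalarTower ℂ E E] [SMulCommClass ℂ E E] [UniformSpace E]
    [NonUnitalRing B] [Module ℂ B] [IsScalarTower ℂ B B] [SMulCommClass ℂ B B] [UniformSpace B]
    (ι : I →ₙₐ[ℂ] E) (π : E →ₙₐ[ℂ] B) : Prop where
  left_lca : IsLocallyConvexAlgebra I
  middle_lca : IsLocallyConvexAlgebra E
  right_lca : IsLocallyConvexAlgebra B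
  isEmbedding_left : Topology.IsEmbedding ι
  continuous_right : Continuous π
  exact : ∀ x : E, π x = 0 ↔ x ∈ Set.range ι
  surjective_right : Function.Surjective π
  exists_section : ∃ s : B →L[ℂ] E, ∀ b : B, π (s b) = b

theorem continuous_of_bilinear_bound {E F G ι : Type*} [AddCommGroup E] [Module ℂ E]
    [TopologicalSpace E] [IsTopologicalAddGroup E] [AddCommGroup F] [Module ℂ F]
    [TopologicalSpace F] [IsTopologicalAddGroup F] [AddCommGroup G] [Module ℂ G]
    [TopologicalSpace G] {r : SeminormFamily ℂ G ι} (hr : WithSeminorms r)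
    (B : E →ₗ[ℂ] F →ₗ[ℂ] G)
    (h : ∀ i, ∃ p : Seminorm ℂ E, Continuous p ∧ ∃ q : Seminorm ℂ F, Continuous q ∧
      ∀ x y, r i (B x y) ≤ p x * q y) :
    Continuous fun z : E × F => B z.1 z.2 := by
  rw [continuous_iff_continuousAt]
  rintro ⟨x₀, y₀⟩
  rw [ContinuousAt, hr.tendsto_nhds]
  intro i ε hε
  obtain ⟨p, hp, q, hq, hb⟩ := h i
  have hc : Continuous fun z : E × F =>
      p (z.1 - x₀) * q (z.2 - y₀) + p x₀ * q (z.2 - y₀) + p (z.1 - x₀) * q y₀ := by fun_prop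
  have ht := hc.tendsto (x₀, y₀)
  simp only [sub_self, map_zero, mul_zero, zero_mul, add_zero] at ht
  filter_upwards [ht.eventually (gt_mem_nhds hε)] with z hz
  refine lt_of_le_of_lt ?_ hz
  have e : B z.1 z.2 - B x₀ y₀ =
      B (z.1 - x₀) (z.2 - y₀) + B x₀ (z.2 - y₀) + B (z.1 - x₀) y₀ := by
    simp only [map_sub, LinearMap.sub_apply]; abel
  rw [e]
  exact (map_add_le_add (r i) _ _).trans (add_le_add
    ((map_add_le_add (r i) _ _).trans (add_le_add (hb _ _) (hb _ _))) (hb _ _))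

theorem SeminormedMul.isTopologicalRing (E : Type*) [Ring E] [Algebra ℂ E] [TopologicalSpace E]
    [SeminormedMul E] : IsTopologicalRing E := by
  have hw := PolynormableSpace.withSeminorms ℂ E
  have := hw.topologicalAddGroup
  have hm : Continuous fun z : E × E => z.1 * z.2 := by
    refine continuous_of_bilinear_bound hw (LinearMap.mul ℂ E) fun i => ?_
    obtain ⟨q, hq, h⟩ := SeminormedMul.exists_mul_le i.1 i.2
    exact ⟨q, hq, q, hq, h⟩
  exact { continuous_add := continuous_add, continuous_mul := hm, continuous_neg := continuous_neg }

/-- If the seminorms `r i` define the topology, it is enough to bound each `r i (a * b)`. -/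
theorem SeminormedMul.of_withSeminorms {E ι : Type*} [NonUnitalRing E] [Module ℂ E]
    [TopologicalSpace E] [Nonempty ι] {r : SeminormFamily ℂ E ι} (hr : WithSeminorms r)
    (h : ∀ i, ∃ q : Seminorm ℂ E, Continuous q ∧ ∀ a b : E, r i (a * b) ≤ q a * q b) :
    SeminormedMul E := by
  have := hr.topologicalAddGroup
  have := hr.continuousSMul
  refine { toPolynormableSpace := hr.toPolynormableSpace, exists_mul_le := fun p hp => ?_ }
  obtain ⟨s, C, -, hC⟩ := Seminorm.bound_of_continuous hr p hp
  choose q hq hb using h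
  refine ⟨(C + 1) • ∑ i ∈ s, q i, ?_, fun a b => ?_⟩
  · have : (((C + 1) • ∑ i ∈ s, q i : Seminorm ℂ E) : E → ℝ) =
        fun x => ((C + 1 : NNReal) : ℝ) * ∑ i ∈ s, q i x := by
      ext x
      have h : ∀ t : Finset ι, (∑ i ∈ t, q i) x = ∑ i ∈ t, q i x := by
        intro t
        classical
        induction t using Finset.induction_on with
        | empty => simp
        | insert a t ha ih => simp [Finset.sum_insert ha, ih]
      rw [smul_apply, h]
      rfl
    rw [this]
    fun_prop
  · have hle : ∀ t : Finset ι, ∀ x, (∑ i ∈ t, q i) x = ∑ i ∈ t, q i x := by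
      intro t x
      classical
      induction t using Finset.induction_on with
      | empty => simp
      | insert a t ha ih => simp [Finset.sum_insert ha, ih]
    have h1 : s.sup r (a * b) ≤ (∑ i ∈ s, q i a) * (∑ i ∈ s, q i b) := by
      refine Seminorm.finset_sup_apply_le (by positivity) fun i hi => (hb i a b).trans ?_
      exact mul_le_mul (Finset.single_le_sum (f := fun i => q i a) (fun _ _ => apply_nonneg _ _) hi)
        (Finset.single_le_sum (f := fun i => q i b) (fun _ _ => apply_nonneg _ _) hi)
        (apply_nonneg _ _) (by positivity)
    refine (hC (a * b)).trans ?_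
    simp only [smul_apply, hle, NNReal.smul_def, smul_eq_mul]
    have h2 : (0 : ℝ) ≤ (∑ i ∈ s, q i a) * (∑ i ∈ s, q i b) := by positivity
    have h3 : (0 : ℝ) ≤ C := C.2
    push_cast
    calc (C : ℝ) * s.sup r (a * b) ≤ C * ((∑ i ∈ s, q i a) * (∑ i ∈ s, q i b)) := by gcongr
      _ ≤ ((C + 1) * (C + 1)) * ((∑ i ∈ s, q i a) * (∑ i ∈ s, q i b)) := by
        gcongr; nlinarith
      _ = _ := by ring

/-! ### The fine topology -/

/-- The family of all seminorms. -/
def allSeminorms (A : Type*) [AddCommGroup A] [Module ℂ A] :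
    SeminormFamily ℂ A (Seminorm ℂ A) := fun p => p

/-- The uniform structure of the fine topology, i.e. the topology generated by all seminorms. -/
@[reducible] def fineUniformSpace (A : Type*) [AddCommGroup A] [Module ℂ A] : UniformSpace A :=
  letI : TopologicalSpace A := (allSeminorms A).moduleFilterBasis.topology
  haveI : IsTopologicalAddGroup A :=
    (WithSeminorms.mk rfl : WithSeminorms (allSeminorms A)).topologicalAddGroup
  IsTopologicalAddGroup.rightUniformSpace A

theorem fine_withSeminorms (A : Type*) [AddCommGroup A] [Module ℂ A] :
    @WithSeminorms ℂ A _ _ _ _ (allSeminorms A) (fineUniformSpace A).toTopologicalSpace :=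
  @WithSeminorms.mk _ _ _ _ _ _ _ (fineUniformSpace A).toTopologicalSpace rfl

theorem fine_isUniformAddGroup (A : Type*) [AddCommGroup A] [Module ℂ A] :
    @IsUniformAddGroup A (fineUniformSpace A) _ := by
  let _ : TopologicalSpace A := (allSeminorms A).moduleFilterBasis.topology
  have : IsTopologicalAddGroup A :=
    (WithSeminorms.mk rfl : WithSeminorms (allSeminorms A)).topologicalAddGroup
  exact isUniformAddGroup_of_addCommGroup

/-- An algebra with a countable basis, with the fine topology. -/
theorem fine_seminormedMul {A J : Type*} [Ring A] [Algebra ℂ A] [Countable J]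
    (b : Module.Basis J ℂ A) :
    @SeminormedMul A _ _ (fineUniformSpace A).toTopologicalSpace := by
  let _ := fineUniformSpace A
  have hw := fine_withSeminorms A
  refine SeminormedMul.of_withSeminorms hw fun p => ?_
  obtain ⟨e, he⟩ := exists_injective_nat J
  -- a weight dominating `p (b i * b j)`
  let c : J → J → ℝ := fun i j => p (b i * b j)
  have hfin : ∀ n : ℕ, {i : J | e i ≤ n}.Finite := fun n =>
    (Set.finite_Iic n).preimage he.injOn
  let w : J → ℝ := fun i => 1 + ∑ k ∈ (hfin (e i)).toFinset, ∑ l ∈ (hfin (e i)).toFinset, c k l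
  have hc : ∀ i j, 0 ≤ c i j := fun i j => apply_nonneg _ _
  have hw1 : ∀ i, 1 ≤ w i := fun i => by
    have : 0 ≤ ∑ k ∈ (hfin (e i)).toFinset, ∑ l ∈ (hfin (e i)).toFinset, c k l :=
      Finset.sum_nonneg fun k _ => Finset.sum_nonneg fun l _ => hc k l
    simp only [w]; linarith
  have key : ∀ m i j, e i ≤ e m → e j ≤ e m → c i j ≤ w m := fun m i j hi hj => by
    have h1 : c i j ≤ ∑ l ∈ (hfin (e m)).toFinset, c i l :=
      Finset.single_le_sum (f := fun l => c i l) (fun l _ => hc i l) (by simpa using hj)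
    have h2 := Finset.single_le_sum (f := fun k => ∑ l ∈ (hfin (e m)).toFinset, c k l)
      (s := (hfin (e m)).toFinset) (a := i)
      (fun k _ => Finset.sum_nonneg fun l _ => hc k l) (by simpa using hi)
    simp only [w]; linarith
  have hcw : ∀ i j, c i j ≤ w i * w j := fun i j => by
    have hi := hw1 i
    have hj := hw1 j
    rcases le_total (e i) (e j) with h | h
    · nlinarith [key j i j h le_rfl]
    · nlinarith [key i i j le_rfl h]
  let q : Seminorm ℂ A := Seminorm.of (fun x => (b.repr x).sum fun i z => ‖z‖ * w i)
    (fun x y => by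
      classical
      have hsub : ∀ (u : J →₀ ℂ) (s : Finset J), u.support ⊆ s →
          (u.sum fun i z => ‖z‖ * w i) = ∑ i ∈ s, ‖u i‖ * w i := fun u s hs =>
        Finsupp.sum_of_support_subset u hs _ (by simp)
      rw [map_add, hsub _ ((b.repr x).support ∪ (b.repr y).support) Finsupp.support_add,
        hsub _ ((b.repr x).support ∪ (b.repr y).support) Finset.subset_union_left,
        hsub _ ((b.repr x).support ∪ (b.repr y).support) Finset.subset_union_right,
        ← Finset.sum_add_distrib]
      refine Finset.sum_le_sum fun i _ => ?_
      rw [← add_mul, Finsupp.add_apply]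
      exact mul_le_mul_of_nonneg_right (norm_add_le _ _) (by linarith [hw1 i]))
    (fun a x => by
      rw [map_smul]
      rcases eq_or_ne a 0 with rfl | ha
      · simp
      · rw [Finsupp.sum, Finsupp.support_smul_eq ha, Finsupp.sum, Finset.mul_sum]
        refine Finset.sum_congr rfl fun i _ => ?_
        simp [mul_assoc])
  have hq : ∀ x, q x = (b.repr x).sum fun i z => ‖z‖ * w i := fun x => rfl
  refine ⟨q, hw.continuous_seminorm q, fun x y => ?_⟩
  have hps : ∀ (s : Finset J) (f : J → A), p (∑ i ∈ s, f i) ≤ ∑ i ∈ s, p (f i) := fun s f => by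
    classical
    induction s using Finset.induction_on with
    | empty => simp
    | insert a t ha ih =>
      rw [Finset.sum_insert ha, Finset.sum_insert ha]
      exact (map_add_le_add p _ _).trans (by linarith)
  have hx : x * y = ∑ i ∈ (b.repr x).support, ∑ j ∈ (b.repr y).support,
      (b.repr x i * b.repr y j) • (b i * b j) := by
    conv_lhs => rw [← b.linearCombination_repr x, ← b.linearCombination_repr y]
    simp only [Finsupp.linearCombination_apply, Finsupp.sum, Finset.sum_mul_sum]
    simp only [smul_mul_smul_comm]
  change p (x * y) ≤ _
  rw [hx, hq, hq, Finsupp.sum, Finsupp.sum, Finset.sum_mul_sum]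
  refine (hps _ _).trans (Finset.sum_le_sum fun i _ => (hps _ _).trans
    (Finset.sum_le_sum fun j _ => ?_))
  rw [map_smul_eq_mul, norm_mul]
  calc _ ≤ ‖b.repr x i‖ * ‖b.repr y j‖ * (w i * w j) := by gcongr; exact hcw i j
    _ = _ := by ring

/-! ### Spaces of rapidly decreasing families -/

theorem summable_iff_enorm {ι : Type*} (w : ι → ℕ) (n : ℕ) (a : ι → ℂ) :
    (Summable fun i => (w i : ℝ) ^ n * ‖a i‖) ↔ ∑' i, (w i : ℝ≥0∞) ^ n * ‖a i‖ₑ ≠ ∞ := by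
  have h : ∀ i, ENNReal.ofReal ((w i : ℝ) ^ n * ‖a i‖) = (w i : ℝ≥0∞) ^ n * ‖a i‖ₑ := fun i => by
    rw [ENNReal.ofReal_mul (by positivity), ENNReal.ofReal_pow (by positivity),
      ENNReal.ofReal_natCast, ofReal_norm]
  constructor
  · intro hs
    simpa only [h] using hs.tsum_ofReal_ne_top
  · intro hs
    simp only [← h] at hs
    exact (ENNReal.summable_toReal hs).congr fun i => ENNReal.toReal_ofReal (by positivity)

theorem ofReal_tsum_eq {ι : Type*} (w : ι → ℕ) (n : ℕ) (a : ι → ℂ)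
    (ha : Summable fun i => (w i : ℝ) ^ n * ‖a i‖) :
    ENNReal.ofReal (∑' i, (w i : ℝ) ^ n * ‖a i‖) = ∑' i, (w i : ℝ≥0∞) ^ n * ‖a i‖ₑ := by
  rw [ENNReal.ofReal_tsum_of_nonneg (fun i => by positivity) ha]
  refine tsum_congr fun i => ?_
  rw [ENNReal.ofReal_mul (by positivity), ENNReal.ofReal_pow (by positivity),
    ENNReal.ofReal_natCast, ofReal_norm]

/-- The space of rapidly decreasing families: `∑ i, w i ^ n * ‖a i‖ < ∞` for all `n`. -/
structure Rapid {ι : Type*} (w : ι → ℕ) where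
  /-- the underlying family -/
  toFun : ι → ℂ
  summable' : ∀ n : ℕ, Summable fun i => (w i : ℝ) ^ n * ‖toFun i‖

namespace Rapid

variable {ι : Type*} {w : ι → ℕ}

instance : FunLike (Rapid w) ι ℂ where
  coe := Rapid.toFun
  coe_injective := fun a b h => by cases a; cases b; congr

@[ext] theorem ext {a b : Rapid w} (h : ∀ i, a i = b i) : a = b := DFunLike.ext _ _ h

theorem rapid (a : Rapid w) (n : ℕ) : Summable fun i => (w i : ℝ) ^ n * ‖a i‖ := a.summable' n

@[simp] theorem mk_apply (a : ι → ℂ) (h) (i : ι) : (⟨a, h⟩ : Rapid w) i = a i := rfl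

instance : Zero (Rapid w) := ⟨⟨fun _ => 0, fun n => by simp⟩⟩

instance : Add (Rapid w) := ⟨fun a b => ⟨fun i => a i + b i, fun n => by
  refine Summable.of_nonneg_of_le (fun i => by positivity) (fun i => ?_)
    ((a.rapid n).add (b.rapid n))
  rw [← mul_add]
  exact mul_le_mul_of_nonneg_left (norm_add_le _ _) (by positivity)⟩⟩

instance : Neg (Rapid w) := ⟨fun a => ⟨fun i => -a i, fun n => by simpa using a.rapid n⟩⟩

theorem smul_aux {R : Type*} [Monoid R] [DistribMulAction R ℂ] [IsScalarTower R ℂ ℂ] (c : R)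
    (a : Rapid w) (n : ℕ) : Summable fun i => (w i : ℝ) ^ n * ‖c • a i‖ := by
  refine ((a.rapid n).mul_left ‖c • (1 : ℂ)‖).congr fun i => ?_
  rw [← smul_one_mul c (a i), norm_mul]; ring

instance {R : Type*} [Monoid R] [DistribMulAction R ℂ] [IsScalarTower R ℂ ℂ] :
    SMul R (Rapid w) := ⟨fun c a => ⟨fun i => c • a i, smul_aux c a⟩⟩

instance : Sub (Rapid w) := ⟨fun a b => ⟨fun i => a i - b i, fun n => by
  refine ((a + -b).rapid n).congr fun i => ?_
  rw [sub_eq_add_neg]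
  rfl⟩⟩

instance : AddCommGroup (Rapid w) :=
  DFunLike.coe_injective.addCommGroup (fun a : Rapid w => (a : ι → ℂ)) rfl (fun _ _ => rfl)
    (fun _ => rfl) (fun _ _ => rfl) (fun _ _ => rfl) (fun _ _ => rfl)

instance : Module ℂ (Rapid w) :=
  Function.Injective.module ℂ ⟨⟨fun a : Rapid w => (a : ι → ℂ), rfl⟩, fun _ _ => rfl⟩
    DFunLike.coe_injective fun _ _ => rfl

@[simp] theorem zero_apply (i : ι) : (0 : Rapid w) i = 0 := rfl
@[simp] theorem add_apply (a b : Rapid w) (i : ι) : (a + b) i = a i + b i := rfl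
@[simp] theorem neg_apply (a : Rapid w) (i : ι) : (-a) i = -a i := rfl
@[simp] theorem sub_apply (a b : Rapid w) (i : ι) : (a - b) i = a i - b i := rfl
@[simp] theorem smul_apply (c : ℂ) (a : Rapid w) (i : ι) : (c • a) i = c * a i := rfl

/-- The seminorm `a ↦ ∑ i, w i ^ n * ‖a i‖`. -/
def seminorm (w : ι → ℕ) : SeminormFamily ℂ (Rapid w) ℕ := fun n =>
  Seminorm.of (fun a => ∑' i, (w i : ℝ) ^ n * ‖a i‖)
    (fun a b => by
      rw [← (a.rapid n).tsum_add (b.rapid n)]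
      refine Summable.tsum_le_tsum (fun i => ?_) ((a + b).rapid n) ((a.rapid n).add (b.rapid n))
      rw [← mul_add]
      exact mul_le_mul_of_nonneg_left (norm_add_le _ _) (by positivity))
    (fun c a => by
      rw [← tsum_mul_left]
      refine tsum_congr fun i => ?_
      rw [smul_apply, norm_mul]; ring)

theorem seminorm_apply (n : ℕ) (a : Rapid w) :
    seminorm w n a = ∑' i, (w i : ℝ) ^ n * ‖a i‖ := rfl

/-- The topology defined by these seminorms. -/
instance : TopologicalSpace (Rapid w) := (seminorm w).moduleFilterBasis.topology

theorem withSeminorms : WithSeminorms (seminorm w) := ⟨rfl⟩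

instance : IsTopologicalAddGroup (Rapid w) := withSeminorms.topologicalAddGroup
instance : ContinuousSMul ℂ (Rapid w) := withSeminorms.continuousSMul

/-- The extended-real valued version of the seminorms. -/
def esn (w : ι → ℕ) (n : ℕ) (a : ι → ℂ) : ℝ≥0∞ := ∑' i, (w i : ℝ≥0∞) ^ n * ‖a i‖ₑ

theorem mem_iff (a : ι → ℂ) : (∀ n : ℕ, Summable fun i => (w i : ℝ) ^ n * ‖a i‖) ↔
    ∀ n, esn w n a ≠ ∞ :=
  forall_congr' fun n => summable_iff_enorm w n a

theorem ofReal_seminorm (n : ℕ) (a : Rapid w) : ENNReal.ofReal (seminorm w n a) = esn w n a :=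
  ofReal_tsum_eq w n a (a.rapid n)

theorem esn_ne_top (n : ℕ) (a : Rapid w) : esn w n a ≠ ∞ := (mem_iff a).1 a.rapid n

theorem esn_mono (hw : ∀ i, 1 ≤ w i) {m n : ℕ} (h : m ≤ n) (a : ι → ℂ) :
    esn w m a ≤ esn w n a :=
  ENNReal.tsum_le_tsum fun i => by
    gcongr
    exact_mod_cast hw i

theorem esn_add_le (n : ℕ) (a b : ι → ℂ) :
    esn w n (fun i => a i + b i) ≤ esn w n a + esn w n b := by
  rw [esn, esn, esn, ← ENNReal.tsum_add]
  refine ENNReal.tsum_le_tsum fun i => ?_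
  rw [← mul_add]
  gcongr
  exact enorm_add_le _ _

theorem esn_neg (n : ℕ) (a : ι → ℂ) : esn w n (fun i => - a i) = esn w n a := by
  simp [esn]

/-- The standard unit vectors. -/
def single [DecidableEq ι] (w : ι → ℕ) (i : ι) : Rapid w :=
  ⟨fun j => if j = i then 1 else 0, fun n => summable_of_ne_finset_zero (s := {i}) fun j hj => by
    rw [if_neg (by simpa using hj)]; simp⟩

theorem single_apply [DecidableEq ι] (i j : ι) : single w i j = if j = i then 1 else 0 := rfl

theorem summable (a : Rapid w) : Summable fun i => ‖a i‖ := by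
  simpa using a.rapid 0

theorem norm_le (a : Rapid w) (i : ι) : ‖a i‖ ≤ ∑' i, ‖a i‖ := by
  have : Summable fun i => ‖a i‖ := by simpa using a.rapid 0
  exact this.le_tsum i fun _ _ => norm_nonneg _

end Rapid

/-! ### Products of infinite matrices -/

/-- Infinite matrices with absolutely summable rows and columns and bounded entries. -/
structure GoodMatrix {ι : Type*} (a : ι → ι → ℂ) : Prop where
  row : ∀ i, Summable fun j => ‖a i j‖
  col : ∀ j, Summable fun i => ‖a i j‖
  bdd : ∃ C, ∀ i j, ‖a i j‖ ≤ C

theorem GoodMatrix.summable_mul {ι : Type*} {a b : ι → ι → ℂ} (ha : GoodMatrix a)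
    (hb : GoodMatrix b) (i j : ι) : Summable fun m => a i m * b m j := by
  obtain ⟨C, hC⟩ := hb.bdd
  refine Summable.of_norm_bounded ((ha.row i).mul_right C) fun m => ?_
  rw [norm_mul]
  exact mul_le_mul_of_nonneg_left (hC m j) (norm_nonneg _)

theorem GoodMatrix.mul_assoc {ι : Type*} {a b c : ι → ι → ℂ} (ha : GoodMatrix a)
    (hb : GoodMatrix b) (hc : GoodMatrix c) (i j : ι) :
    ∑' m, (∑' l, a i l * b l m) * c m j = ∑' l, a i l * ∑' m, b l m * c m j := by
  obtain ⟨C, hC⟩ := hb.bdd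
  have hs : Summable fun z : ι × ι => a i z.1 * b z.1 z.2 * c z.2 j := by
    refine Summable.of_norm_bounded
      (((ha.row i).mul_of_nonneg (hc.col j) (fun _ => norm_nonneg _)
        (fun _ => norm_nonneg _)).mul_right C) fun z => ?_
    rw [norm_mul, norm_mul]
    calc _ ≤ ‖a i z.1‖ * C * ‖c z.2 j‖ := by gcongr; exact hC _ _
      _ = _ := by ring
  have h1 : ∀ m, (∑' l, a i l * b l m) * c m j = ∑' l, a i l * b l m * c m j := fun m =>
    tsum_mul_right.symm
  have h2 : ∀ l, a i l * ∑' m, b l m * c m j = ∑' m, a i l * b l m * c m j := fun l => by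
    rw [← tsum_mul_left]; simp only [_root_.mul_assoc]
  simp only [h1, h2]
  exact Summable.tsum_comm hs

theorem esum_mul_le {X M Y : Type*} (W : X → Y → ℕ) (U : X → M → ℕ) (V : M → Y → ℕ)
    (h : ∀ i m j, W i j ≤ U i m * V m j) (n : ℕ) (a : X → M → ℂ) (b : M → Y → ℂ) :
    ∑' z : X × Y, (W z.1 z.2 : ℝ≥0∞) ^ n * ‖∑' m, a z.1 m * b m z.2‖ₑ ≤
      ∑' m, (∑' i, (U i m : ℝ≥0∞) ^ n * ‖a i m‖ₑ) * (∑' j, (V m j : ℝ≥0∞) ^ n * ‖b m j‖ₑ) := by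
  have h1 : ∀ i j, (W i j : ℝ≥0∞) ^ n * ‖∑' m, a i m * b m j‖ₑ ≤
      ∑' m, ((U i m : ℝ≥0∞) ^ n * ‖a i m‖ₑ) * ((V m j : ℝ≥0∞) ^ n * ‖b m j‖ₑ) := fun i j => by
    refine (mul_le_mul_right (enorm_tsum_le_tsum_enorm) _).trans ?_
    rw [← ENNReal.tsum_mul_left]
    refine ENNReal.tsum_le_tsum fun m => ?_
    rw [enorm_mul]
    calc _ ≤ ((U i m : ℝ≥0∞) * (V m j : ℝ≥0∞)) ^ n * (‖a i m‖ₑ * ‖b m j‖ₑ) := by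
          gcongr; exact_mod_cast h i m j
      _ = _ := by rw [mul_pow]; ring
  rw [ENNReal.tsum_prod (f := fun i j => (W i j : ℝ≥0∞) ^ n * ‖∑' m, a i m * b m j‖ₑ)]
  calc _ ≤ ∑' i, ∑' j, ∑' m, ((U i m : ℝ≥0∞) ^ n * ‖a i m‖ₑ) * ((V m j : ℝ≥0∞) ^ n * ‖b m j‖ₑ) :=
        ENNReal.tsum_le_tsum fun i => ENNReal.tsum_le_tsum fun j => h1 i j
    _ = ∑' i, ∑' m, ∑' j, ((U i m : ℝ≥0∞) ^ n * ‖a i m‖ₑ) * ((V m j : ℝ≥0∞) ^ n * ‖b m j‖ₑ) :=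
        tsum_congr fun i => ENNReal.tsum_comm
    _ = ∑' m, ∑' i, ∑' j, ((U i m : ℝ≥0∞) ^ n * ‖a i m‖ₑ) * ((V m j : ℝ≥0∞) ^ n * ‖b m j‖ₑ) :=
        ENNReal.tsum_comm
    _ = _ := by simp only [ENNReal.tsum_mul_left, ENNReal.tsum_mul_right]

/-! ### Smooth functions on the circle -/

/-- The weight `1 + |k|` on `ℤ`. -/
def circleWeight (k : ℤ) : ℕ := 1 + k.natAbs

/-- `C^∞(S¹)`, described through Fourier series as the space of rapidly decreasing Laurent series
`∑ k, f k * z ^ k`; the product is the convolution of the coefficients. -/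
abbrev SmoothCircle : Type := Rapid circleWeight

namespace SmoothCircle

/-- The function `z ^ k`. -/
def zpow (k : ℤ) : SmoothCircle := Rapid.single circleWeight k

/-- The Laurent matrix of `f`. -/
def laurent (f : SmoothCircle) (i j : ℤ) : ℂ := f (i - j)

theorem good (f : SmoothCircle) : GoodMatrix (laurent f) where
  row := fun i => (Rapid.summable f).comp_injective
    (i := fun j : ℤ => i - j) (sub_right_injective)
  col := fun j => (Rapid.summable f).comp_injective
    (i := fun i : ℤ => i - j) (sub_left_injective)
  bdd := ⟨_, fun i j => Rapid.norm_le f (i - j)⟩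

theorem conv_esn_le (f g : SmoothCircle) (n : ℕ) :
    Rapid.esn circleWeight n (fun k => ∑' m, f (k - m) * g m) ≤
      Rapid.esn circleWeight n f * Rapid.esn circleWeight n g := by
  have h := esum_mul_le (X := ℤ) (M := ℤ) (Y := Unit) (fun i _ => circleWeight i)
    (fun i m => circleWeight (i - m)) (fun m _ => circleWeight m)
    (fun i m _ => by
      simp only [circleWeight]
      have : i.natAbs ≤ (i - m).natAbs + m.natAbs := by omega
      nlinarith [Nat.zero_le ((i - m).natAbs * m.natAbs)]) n
    (fun i m => f (i - m)) (fun m _ => g m)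
  rw [ENNReal.tsum_prod (f := fun (i : ℤ) (_ : Unit) =>
    (circleWeight i : ℝ≥0∞) ^ n * ‖∑' m, f (i - m) * g m‖ₑ)] at h
  simp only [tsum_fintype, Finset.univ_unique, Finset.sum_singleton] at h
  refine h.trans (le_of_eq ?_)
  have hs : ∀ m : ℤ, ∑' i, (circleWeight (i - m) : ℝ≥0∞) ^ n * ‖f (i - m)‖ₑ =
      Rapid.esn circleWeight n f := fun m =>
    (Equiv.subRight m).tsum_eq fun k => (circleWeight k : ℝ≥0∞) ^ n * ‖f k‖ₑ
  simp only [hs, ENNReal.tsum_mul_left]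
  rfl

instance : Mul SmoothCircle :=
  ⟨fun f g => ⟨fun k => ∑' m, f (k - m) * g m, (Rapid.mem_iff _).2 fun n =>
    ne_top_of_le_ne_top (ENNReal.mul_ne_top (Rapid.esn_ne_top n f) (Rapid.esn_ne_top n g))
      (conv_esn_le f g n)⟩⟩

theorem mul_apply (f g : SmoothCircle) (k : ℤ) : (f * g) k = ∑' m, f (k - m) * g m := rfl

instance : One SmoothCircle := ⟨zpow 0⟩

theorem laurent_mul (f g : SmoothCircle) (i j : ℤ) :
    laurent (f * g) i j = ∑' m, laurent f i m * laurent g m j := by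
  rw [laurent, mul_apply, ← (Equiv.subRight j).tsum_eq]
  refine tsum_congr fun m => ?_
  simp only [Equiv.subRight_apply, laurent]
  congr 2
  ring_nf

theorem laurent_one (i j : ℤ) : laurent 1 i j = if i = j then 1 else 0 := by
  have : (1 : SmoothCircle) = Rapid.single circleWeight 0 := rfl
  rw [laurent, this, Rapid.single_apply]
  simp [sub_eq_zero]

theorem laurent_ext {f g : SmoothCircle} (h : ∀ i j, laurent f i j = laurent g i j) : f = g :=
  Rapid.ext fun i => by simpa [laurent] using h i 0

theorem laurent_add (f g : SmoothCircle) (i j : ℤ) :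
    laurent (f + g) i j = laurent f i j + laurent g i j := rfl

theorem laurent_smul (c : ℂ) (f : SmoothCircle) (i j : ℤ) :
    laurent (c • f) i j = c * laurent f i j := rfl

instance : Ring SmoothCircle :=
  { (inferInstance : AddCommGroup SmoothCircle), (inferInstance : Mul SmoothCircle),
    (inferInstance : One SmoothCircle) with
    zero_mul := fun f => Rapid.ext fun k => by simp [mul_apply]
    mul_zero := fun f => Rapid.ext fun k => by simp [mul_apply]
    one_mul := fun f => laurent_ext fun i j => by
      rw [laurent_mul]
      simp only [laurent_one]
      rw [tsum_eq_single i fun m hm => by simp [Ne.symm hm]]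
      simp
    mul_one := fun f => laurent_ext fun i j => by
      rw [laurent_mul]
      simp only [laurent_one]
      rw [tsum_eq_single j fun m hm => by simp [hm]]
      simp
    mul_assoc := fun f g k => laurent_ext fun i j => by
      simp only [laurent_mul]
      exact (good f).mul_assoc (good g) (good k) i j
    left_distrib := fun f g k => laurent_ext fun i j => by
      simp only [laurent_mul, laurent_add, mul_add]
      exact ((good f).summable_mul (good g) i j).tsum_add ((good f).summable_mul (good k) i j)
    right_distrib := fun f g k => laurent_ext fun i j => by
      simp only [laurent_mul, laurent_add, add_mul]
      exact ((good f).summable_mul (good k) i j).tsum_add ((good g).summable_mul (good k) i j) }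

instance : Algebra ℂ SmoothCircle :=
  Algebra.ofModule
    (fun c f g => laurent_ext fun i j => by
      simp only [laurent_mul, laurent_smul, mul_assoc, tsum_mul_left])
    (fun c f g => laurent_ext fun i j => by
      simp only [laurent_mul, laurent_smul, mul_left_comm _ c, tsum_mul_left])

instance : SeminormedMul SmoothCircle :=
  SeminormedMul.of_withSeminorms Rapid.withSeminorms fun n =>
    ⟨Rapid.seminorm _ n, Rapid.withSeminorms.continuous_seminorm n, fun f g => by
      have h : ENNReal.ofReal (Rapid.seminorm circleWeight n (f * g)) ≤
          ENNReal.ofReal (Rapid.seminorm circleWeight n f * Rapid.seminorm circleWeight n g) := by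
        rw [ENNReal.ofReal_mul (apply_nonneg _ _)]
        simp only [Rapid.ofReal_seminorm]
        exact conv_esn_le f g n
      exact (ENNReal.ofReal_le_ofReal_iff
        (mul_nonneg (apply_nonneg _ _) (apply_nonneg _ _))).1 h⟩

instance : IsTopologicalRing SmoothCircle := SeminormedMul.isTopologicalRing _

end SmoothCircle

/-! ### The smooth Toeplitz algebra -/

/-- The weight `1 + i + j` on `ℕ × ℕ`. -/
def matrixWeight (q : ℕ × ℕ) : ℕ := 1 + q.1 + q.2

/-- The space of smooth compact operators: `ℕ × ℕ`-matrices with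
`∑ (1 + i + j) ^ n * ‖a i j‖ < ∞` for all `n`. -/
abbrev SmoothCompact : Type := Rapid matrixWeight

/-- The smooth Toeplitz algebra. As a locally convex space it is `𝒦 ⊕ C^∞(S¹)`. -/
@[ext] structure Toeplitz where
  /-- the component in `𝒦` -/
  cpt : SmoothCompact
  /-- the component in `C^∞(S¹)` -/
  sym : SmoothCircle

namespace Toeplitz

/-- The identification with the direct sum. -/
def equivProd : Toeplitz ≃ SmoothCompact × SmoothCircle where
  toFun := fun x => (x.cpt, x.sym)
  invFun := fun x => ⟨x.1, x.2⟩
  left_inv := fun _ => rfl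
  right_inv := fun _ => rfl

instance : AddCommGroup Toeplitz := equivProd.addCommGroup
instance : Module ℂ Toeplitz := equivProd.module ℂ
instance : TopologicalSpace Toeplitz := TopologicalSpace.induced equivProd inferInstance

/-- The components, as a linear map. -/
def toProd : Toeplitz →ₗ[ℂ] SmoothCompact × SmoothCircle where
  toFun := equivProd
  map_add' := fun _ _ => rfl
  map_smul' := fun _ _ => rfl

theorem isInducing_toProd : Topology.IsInducing toProd := ⟨rfl⟩

instance : IsTopologicalAddGroup Toeplitz := topologicalAddGroup_induced toProd

theorem continuous_cpt : Continuous cpt := continuous_fst.comp isInducing_toProd.continuous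
theorem continuous_sym : Continuous sym := continuous_snd.comp isInducing_toProd.continuous

@[simp] theorem cpt_add (x y : Toeplitz) : (x + y).cpt = x.cpt + y.cpt := rfl
@[simp] theorem sym_add (x y : Toeplitz) : (x + y).sym = x.sym + y.sym := rfl
@[simp] theorem cpt_smul (c : ℂ) (x : Toeplitz) : (c • x).cpt = c • x.cpt := rfl
@[simp] theorem sym_smul (c : ℂ) (x : Toeplitz) : (c • x).sym = c • x.sym := rfl
@[simp] theorem cpt_zero : (0 : Toeplitz).cpt = 0 := rfl
@[simp] theorem sym_zero : (0 : Toeplitz).sym = 0 := rfl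

/-- The matrix of `(a, f)`: the sum of `a` and the Toeplitz matrix `f (i - j)` of `f`. -/
def toMatrix (x : Toeplitz) (i j : ℕ) : ℂ := x.cpt (i, j) + x.sym ((i : ℤ) - j)

theorem toMatrix_add (x y : Toeplitz) (i j : ℕ) :
    toMatrix (x + y) i j = toMatrix x i j + toMatrix y i j := by
  simp only [toMatrix, cpt_add, sym_add, Rapid.add_apply]; ring

theorem toMatrix_smul (c : ℂ) (x : Toeplitz) (i j : ℕ) :
    toMatrix (c • x) i j = c * toMatrix x i j := by
  simp only [toMatrix, cpt_smul, sym_smul, Rapid.smul_apply]; ring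

theorem ext' {x y : Toeplitz} (h : ∀ i j, toMatrix x i j = toMatrix y i j) (h2 : x.sym = y.sym) :
    x = y := by
  refine Toeplitz.ext (Rapid.ext ?_) h2
  rintro ⟨i, j⟩
  have := h i j
  simp only [toMatrix, h2] at this
  exact add_right_cancel this

theorem compact_good (a : SmoothCompact) : GoodMatrix fun i j => a (i, j) where
  row := fun i => (Rapid.summable a).comp_injective
    (i := fun j : ℕ => (i, j)) fun _ _ h => (Prod.ext_iff.1 h).2
  col := fun j => (Rapid.summable a).comp_injective
    (i := fun i : ℕ => (i, j)) fun _ _ h => (Prod.ext_iff.1 h).1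
  bdd := ⟨_, fun i j => Rapid.norm_le a (i, j)⟩

theorem symbol_good (f : SmoothCircle) : GoodMatrix fun i j : ℕ => f ((i : ℤ) - j) where
  row := fun i => ((SmoothCircle.good f).row i).comp_injective Nat.cast_injective
  col := fun j => ((SmoothCircle.good f).col j).comp_injective Nat.cast_injective
  bdd := ⟨_, fun _ _ => Rapid.norm_le f _⟩

theorem good_add {ι : Type*} {a b : ι → ι → ℂ} (ha : GoodMatrix a) (hb : GoodMatrix b) :
    GoodMatrix fun i j => a i j + b i j where
  row := fun i => Summable.of_nonneg_of_le (fun _ => norm_nonneg _) (fun _ => norm_add_le _ _)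
    ((ha.row i).add (hb.row i))
  col := fun j => Summable.of_nonneg_of_le (fun _ => norm_nonneg _) (fun _ => norm_add_le _ _)
    ((ha.col j).add (hb.col j))
  bdd := by
    obtain ⟨C, hC⟩ := ha.bdd
    obtain ⟨D, hD⟩ := hb.bdd
    exact ⟨C + D, fun i j => (norm_add_le _ _).trans (add_le_add (hC i j) (hD i j))⟩

theorem good (x : Toeplitz) : GoodMatrix (toMatrix x) :=
  good_add (compact_good x.cpt) (symbol_good x.sym)

/-- One of the two Hankel matrices that measure the failure of `f ↦ (f (i - j))` to be
multiplicative. -/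
def hankelPos (f : SmoothCircle) (q : ℕ × ℕ) : ℂ := f ((q.1 : ℤ) + q.2 + 1)

/-- The other Hankel matrix. -/
def hankelNeg (f : SmoothCircle) (q : ℕ × ℕ) : ℂ := f (-((q.1 : ℤ) + q.2 + 1))

theorem esum_hankel_le (F : ℤ → ℂ) (φ : ℕ → ℤ) (hφ : Function.Injective φ)
    (hφ' : ∀ s, (φ s).natAbs = s + 1) (n : ℕ) :
    Rapid.esn matrixWeight n (fun q => F (φ (q.1 + q.2))) ≤ Rapid.esn circleWeight (n + 1) F := by
  have h1 : Rapid.esn matrixWeight n (fun q => F (φ (q.1 + q.2))) =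
      ∑' s : ℕ, ((s : ℝ≥0∞) + 1) * ((1 + (s : ℝ≥0∞)) ^ n * ‖F (φ s)‖ₑ) := by
    rw [Rapid.esn, ← (Finset.HasAntidiagonal.sigmaAntidiagonalEquivProd (A := ℕ)).tsum_eq, ENNReal.tsum_sigma']
    refine tsum_congr fun s => ?_
    have : ∀ z : Finset.HasAntidiagonal.antidiagonal s,
        (matrixWeight (Finset.HasAntidiagonal.sigmaAntidiagonalEquivProd ⟨s, z⟩) : ℝ≥0∞) ^ n *
          ‖F (φ ((Finset.HasAntidiagonal.sigmaAntidiagonalEquivProd ⟨s, z⟩).1 +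
            (Finset.HasAntidiagonal.sigmaAntidiagonalEquivProd ⟨s, z⟩).2))‖ₑ =
        (1 + (s : ℝ≥0∞)) ^ n * ‖F (φ s)‖ₑ := fun z => by
      have hz : z.1.1 + z.1.2 = s :=
        Finset.HasAntidiagonal.mem_antidiagonal.1 z.2
      simp only [Finset.HasAntidiagonal.sigmaAntidiagonalEquivProd_apply, matrixWeight, add_assoc, hz]
      push_cast
      rfl
    simp only [this, tsum_fintype, Finset.sum_const, Finset.card_univ, Fintype.card_coe,
      Finset.Nat.card_antidiagonal, nsmul_eq_mul, Nat.cast_add, Nat.cast_one]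
  rw [h1]
  calc _ ≤ ∑' s : ℕ, (circleWeight (φ s) : ℝ≥0∞) ^ (n + 1) * ‖F (φ s)‖ₑ := by
        refine ENNReal.tsum_le_tsum fun s => ?_
        rw [← mul_assoc, add_comm (s : ℝ≥0∞) 1, ← pow_succ']
        gcongr
        have : 1 + s ≤ circleWeight (φ s) := by rw [circleWeight, hφ']; omega
        exact_mod_cast this
    _ ≤ _ := ENNReal.tsum_comp_le_tsum_of_injective hφ
        fun k => (circleWeight k : ℝ≥0∞) ^ (n + 1) * ‖F k‖ₑ

theorem hankelPos_esn_le (f : SmoothCircle) (n : ℕ) :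
    Rapid.esn matrixWeight n (hankelPos f) ≤ Rapid.esn circleWeight (n + 1) f := by
  refine le_trans (le_of_eq ?_) (esum_hankel_le f (fun s => (s : ℤ) + 1)
    (fun a b h => by simpa using h) (fun s => by omega) n)
  simp [Rapid.esn, hankelPos]

theorem hankelNeg_esn_le (f : SmoothCircle) (n : ℕ) :
    Rapid.esn matrixWeight n (hankelNeg f) ≤ Rapid.esn circleWeight (n + 1) f := by
  refine le_trans (le_of_eq ?_) (esum_hankel_le f (fun s => -((s : ℤ) + 1))
    (fun a b h => by simpa using h) (fun s => by omega) n)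
  simp [Rapid.esn, hankelNeg]

/-- The extended seminorms of the Toeplitz algebra. -/
def esn (n : ℕ) (x : Toeplitz) : ℝ≥0∞ :=
  Rapid.esn matrixWeight n x.cpt + Rapid.esn circleWeight n x.sym

/-- The product of matrices minus the Toeplitz matrix of the product of symbols. -/
def mulCompact (x y : Toeplitz) (q : ℕ × ℕ) : ℂ :=
  (∑' m, toMatrix x q.1 m * toMatrix y m q.2) - (x.sym * y.sym) ((q.1 : ℤ) - q.2)

theorem mulCompact_eq (x y : Toeplitz) (q : ℕ × ℕ) :
    mulCompact x y q = (∑' m, x.cpt (q.1, m) * y.cpt (m, q.2)) +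
      (∑' m : ℕ, x.sym ((q.1 : ℤ) - m) * y.cpt (m, q.2)) +
      (∑' m : ℕ, x.cpt (q.1, m) * y.sym ((m : ℤ) - q.2)) +
      - ∑' m : ℕ, hankelPos x.sym (q.1, m) * hankelNeg y.sym (m, q.2) := by
  obtain ⟨i, j⟩ := q
  have hx1 := compact_good x.cpt
  have hx2 := symbol_good x.sym
  have hy1 := compact_good y.cpt
  have hy2 := symbol_good y.sym
  have hL : Summable fun m : ℤ =>
      SmoothCircle.laurent x.sym i m * SmoothCircle.laurent y.sym m j :=
    (SmoothCircle.good x.sym).summable_mul (SmoothCircle.good y.sym) i j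
  have hconv : (x.sym * y.sym) ((i : ℤ) - j) = (∑' m : ℕ, x.sym ((i : ℤ) - m) * y.sym ((m : ℤ) - j)) +
      ∑' m : ℕ, hankelPos x.sym (i, m) * hankelNeg y.sym (m, j) := by
    have h0 : (x.sym * y.sym) ((i : ℤ) - j) = SmoothCircle.laurent (x.sym * y.sym) i j := rfl
    have hn : Function.Injective fun m : ℕ => -((m : ℤ) + 1) := fun a b h => by simpa using h
    have hc : Function.Injective fun m : ℕ => (m : ℤ) := Nat.cast_injective
    rw [h0, SmoothCircle.laurent_mul]
    set G : ℤ → ℂ := fun m => SmoothCircle.laurent x.sym i m * SmoothCircle.laurent y.sym m j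
      with hG
    rw [tsum_of_nat_of_neg_add_one (f := G) (hL.comp_injective hc) (hL.comp_injective hn)]
    congr 1
    refine tsum_congr fun m => ?_
    have e1 : (i : ℤ) - -((m : ℤ) + 1) = (i : ℤ) + m + 1 := by ring
    have e2 : -((m : ℤ) + 1) - (j : ℤ) = -((m : ℤ) + j + 1) := by ring
    simp only [hG, SmoothCircle.laurent, hankelPos, hankelNeg, e1, e2]
  have hprod : (∑' m, toMatrix x i m * toMatrix y m j) = (∑' m, x.cpt (i, m) * y.cpt (m, j)) +
      (∑' m : ℕ, x.sym ((i : ℤ) - m) * y.cpt (m, j)) +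
      (∑' m : ℕ, x.cpt (i, m) * y.sym ((m : ℤ) - j)) +
      (∑' m : ℕ, x.sym ((i : ℤ) - m) * y.sym ((m : ℤ) - j)) := by
    have s1 := hx1.summable_mul hy1 i j
    have s2 := hx2.summable_mul hy1 i j
    have s3 := hx1.summable_mul hy2 i j
    have s4 := hx2.summable_mul hy2 i j
    rw [← s1.tsum_add s2, ← (s1.add s2).tsum_add s3, ← ((s1.add s2).add s3).tsum_add s4]
    refine tsum_congr fun m => ?_
    simp only [toMatrix]; ring
  simp only [mulCompact, hconv, hprod]
  ring

theorem mulCompact_esn_le (x y : Toeplitz) (n : ℕ) :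
    Rapid.esn matrixWeight n (mulCompact x y) ≤ esn (n + 1) x * esn (n + 1) y := by
  have hK : ∀ q, 1 ≤ matrixWeight q := fun q => by simp [matrixWeight, add_assoc]
  have hC : ∀ q, 1 ≤ circleWeight q := fun q => by simp [circleWeight]
  have hKK : ∀ a b : ℕ × ℕ → ℂ, Rapid.esn matrixWeight n
      (fun q => ∑' m, a (q.1, m) * b (m, q.2)) ≤
        Rapid.esn matrixWeight n a * Rapid.esn matrixWeight n b := fun a b => by
    refine (esum_mul_le (fun i j => matrixWeight (i, j)) (fun i m => matrixWeight (i, m))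
      (fun m j => matrixWeight (m, j)) (fun i m j => by
        simp only [matrixWeight]; nlinarith [Nat.zero_le (i * j), Nat.zero_le (i * m),
          Nat.zero_le (m * j), Nat.zero_le (m * m)]) n (fun i m => a (i, m))
      (fun m j => b (m, j))).trans ?_
    have h1 : ∀ m, ∑' i, (matrixWeight (i, m) : ℝ≥0∞) ^ n * ‖a (i, m)‖ₑ ≤
        Rapid.esn matrixWeight n a := fun m =>
      ENNReal.tsum_comp_le_tsum_of_injective (f := fun i : ℕ => (i, m))
        (fun _ _ h => (Prod.ext_iff.1 h).1) fun q => (matrixWeight q : ℝ≥0∞) ^ n * ‖a q‖ₑ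
    refine (ENNReal.tsum_le_tsum fun m => mul_le_mul_left (h1 m) _).trans ?_
    rw [ENNReal.tsum_mul_left, ← ENNReal.tsum_prod (f := fun m j =>
      (matrixWeight (m, j) : ℝ≥0∞) ^ n * ‖b (m, j)‖ₑ)]
    rfl
  have hCK : Rapid.esn matrixWeight n
      (fun q => ∑' m : ℕ, x.sym ((q.1 : ℤ) - m) * y.cpt (m, q.2)) ≤
        Rapid.esn circleWeight n x.sym * Rapid.esn matrixWeight n y.cpt := by
    refine (esum_mul_le (fun i j => matrixWeight (i, j))
      (fun i m : ℕ => circleWeight ((i : ℤ) - m))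
      (fun m j => matrixWeight (m, j)) (fun i m j => by
        simp only [matrixWeight, circleWeight]
        have : i ≤ ((i : ℤ) - m).natAbs + m := by omega
        nlinarith [Nat.zero_le (((i : ℤ) - m).natAbs * m),
          Nat.zero_le (((i : ℤ) - m).natAbs * j)]) n (fun i m : ℕ => x.sym ((i : ℤ) - m))
      (fun m j => y.cpt (m, j))).trans ?_
    have h1 : ∀ m : ℕ, ∑' i : ℕ, (circleWeight ((i : ℤ) - m) : ℝ≥0∞) ^ n *
        ‖x.sym ((i : ℤ) - m)‖ₑ ≤ Rapid.esn circleWeight n x.sym := fun m =>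
      ENNReal.tsum_comp_le_tsum_of_injective (f := fun i : ℕ => (i : ℤ) - m)
        (fun _ _ h => by simpa using h) fun q => (circleWeight q : ℝ≥0∞) ^ n * ‖x.sym q‖ₑ
    refine (ENNReal.tsum_le_tsum fun m => mul_le_mul_left (h1 m) _).trans ?_
    rw [ENNReal.tsum_mul_left, ← ENNReal.tsum_prod (f := fun m j =>
      (matrixWeight (m, j) : ℝ≥0∞) ^ n * ‖y.cpt (m, j)‖ₑ)]
    rfl
  have hKC : Rapid.esn matrixWeight n
      (fun q => ∑' m : ℕ, x.cpt (q.1, m) * y.sym ((m : ℤ) - q.2)) ≤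
        Rapid.esn matrixWeight n x.cpt * Rapid.esn circleWeight n y.sym := by
    refine (esum_mul_le (fun i j => matrixWeight (i, j))
      (fun i m => matrixWeight (i, m)) (fun m j : ℕ => circleWeight ((m : ℤ) - j))
      (fun i m j => by
        simp only [matrixWeight, circleWeight]
        have : j ≤ ((m : ℤ) - j).natAbs + m := by omega
        nlinarith [Nat.zero_le (((m : ℤ) - j).natAbs * m),
          Nat.zero_le (((m : ℤ) - j).natAbs * i)]) n (fun i m => x.cpt (i, m))
      (fun m j : ℕ => y.sym ((m : ℤ) - j))).trans ?_
    have h1 : ∀ m : ℕ, ∑' j : ℕ, (circleWeight ((m : ℤ) - j) : ℝ≥0∞) ^ n *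
        ‖y.sym ((m : ℤ) - j)‖ₑ ≤ Rapid.esn circleWeight n y.sym := fun m =>
      ENNReal.tsum_comp_le_tsum_of_injective (f := fun j : ℕ => (m : ℤ) - j)
        (fun _ _ h => by simpa using h) fun q => (circleWeight q : ℝ≥0∞) ^ n * ‖y.sym q‖ₑ
    refine (ENNReal.tsum_le_tsum fun m => mul_le_mul_right (h1 m) _).trans ?_
    rw [ENNReal.tsum_mul_right, ENNReal.tsum_comm, ← ENNReal.tsum_prod (f := fun i m =>
      (matrixWeight (i, m) : ℝ≥0∞) ^ n * ‖x.cpt (i, m)‖ₑ)]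
    rfl
  have hHH := (hKK (hankelPos x.sym) (hankelNeg y.sym)).trans
    (mul_le_mul' (hankelPos_esn_le x.sym n) (hankelNeg_esn_le y.sym n))
  have e : mulCompact x y = fun q => (∑' m, x.cpt (q.1, m) * y.cpt (m, q.2)) +
      (∑' m : ℕ, x.sym ((q.1 : ℤ) - m) * y.cpt (m, q.2)) +
      (∑' m : ℕ, x.cpt (q.1, m) * y.sym ((m : ℤ) - q.2)) +
      - ∑' m : ℕ, hankelPos x.sym (q.1, m) * hankelNeg y.sym (m, q.2) := funext (mulCompact_eq x y)
  have m1 := Rapid.esn_mono hK (Nat.le_succ n) x.cpt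
  have m2 := Rapid.esn_mono hC (Nat.le_succ n) x.sym
  have m3 := Rapid.esn_mono hK (Nat.le_succ n) y.cpt
  have m4 := Rapid.esn_mono hC (Nat.le_succ n) y.sym
  rw [e]
  refine (Rapid.esn_add_le n _ _).trans ((add_le_add ((Rapid.esn_add_le n _ _).trans
    (add_le_add (Rapid.esn_add_le n _ _) le_rfl)) le_rfl).trans ?_)
  rw [Rapid.esn_neg]
  refine (add_le_add (add_le_add (add_le_add ((hKK x.cpt y.cpt).trans (mul_le_mul' m1 m3))
    (hCK.trans (mul_le_mul' m2 m3))) (hKC.trans (mul_le_mul' m1 m4))) hHH).trans (le_of_eq ?_)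
  simp only [esn]
  ring

theorem esn_ne_top (n : ℕ) (x : Toeplitz) : esn n x ≠ ∞ :=
  ENNReal.add_ne_top.2 ⟨Rapid.esn_ne_top n x.cpt, Rapid.esn_ne_top n x.sym⟩

/-- The product: the matrices are multiplied and so are the symbols. -/
instance : Mul Toeplitz :=
  ⟨fun x y => ⟨⟨mulCompact x y, (Rapid.mem_iff _).2 fun n =>
    ne_top_of_le_ne_top (ENNReal.mul_ne_top (esn_ne_top (n + 1) x) (esn_ne_top (n + 1) y))
      (mulCompact_esn_le x y n)⟩, x.sym * y.sym⟩⟩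

instance : One Toeplitz := ⟨⟨0, 1⟩⟩

@[simp] theorem sym_mul (x y : Toeplitz) : (x * y).sym = x.sym * y.sym := rfl
@[simp] theorem sym_one : (1 : Toeplitz).sym = 1 := rfl
@[simp] theorem cpt_one : (1 : Toeplitz).cpt = 0 := rfl

theorem toMatrix_mul (x y : Toeplitz) (i j : ℕ) :
    toMatrix (x * y) i j = ∑' m, toMatrix x i m * toMatrix y m j := by
  change mulCompact x y (i, j) + (x.sym * y.sym) _ = _
  simp [mulCompact]

theorem toMatrix_one (i j : ℕ) : toMatrix 1 i j = if i = j then 1 else 0 := by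
  change (0 : SmoothCompact) (i, j) + SmoothCircle.laurent 1 i j = _
  rw [SmoothCircle.laurent_one]
  simp

theorem toMatrix_zero (i j : ℕ) : toMatrix 0 i j = 0 := by
  change (0 : SmoothCompact) (i, j) + (0 : SmoothCircle) _ = _
  simp

instance : Ring Toeplitz :=
  { (inferInstance : AddCommGroup Toeplitz), (inferInstance : Mul Toeplitz),
    (inferInstance : One Toeplitz) with
    zero_mul := fun f => ext' (fun i j => by simp [toMatrix_mul, toMatrix_zero]) (zero_mul f.sym)
    mul_zero := fun f => ext' (fun i j => by simp [toMatrix_mul, toMatrix_zero]) (mul_zero f.sym)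
    one_mul := fun f => ext' (fun i j => by
      rw [toMatrix_mul]
      simp only [toMatrix_one]
      rw [tsum_eq_single i fun m hm => by simp [Ne.symm hm]]
      simp) (one_mul f.sym)
    mul_one := fun f => ext' (fun i j => by
      rw [toMatrix_mul]
      simp only [toMatrix_one]
      rw [tsum_eq_single j fun m hm => by simp [hm]]
      simp) (mul_one f.sym)
    mul_assoc := fun f g k => ext' (fun i j => by
      simp only [toMatrix_mul]
      exact (good f).mul_assoc (good g) (good k) i j) (mul_assoc f.sym g.sym k.sym)
    left_distrib := fun f g k => ext' (fun i j => by
      simp only [toMatrix_mul, toMatrix_add, mul_add]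
      exact ((good f).summable_mul (good g) i j).tsum_add ((good f).summable_mul (good k) i j))
      (mul_add f.sym g.sym k.sym)
    right_distrib := fun f g k => ext' (fun i j => by
      simp only [toMatrix_mul, toMatrix_add, add_mul]
      exact ((good f).summable_mul (good k) i j).tsum_add ((good g).summable_mul (good k) i j))
      (add_mul f.sym g.sym k.sym) }

instance : Algebra ℂ Toeplitz :=
  Algebra.ofModule
    (fun c f g => ext' (fun i j => by
      simp only [toMatrix_mul, toMatrix_smul, mul_assoc, tsum_mul_left])
      (smul_mul_assoc c f.sym g.sym))
    (fun c f g => ext' (fun i j => by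
      simp only [toMatrix_mul, toMatrix_smul, mul_left_comm _ c, tsum_mul_left])
      (mul_smul_comm c f.sym g.sym))

/-- The seminorms of the Toeplitz algebra. -/
def seminorm (n : ℕ) : Seminorm ℂ Toeplitz :=
  (Rapid.seminorm matrixWeight n).comp (LinearMap.fst ℂ SmoothCompact SmoothCircle ∘ₗ toProd) +
    (Rapid.seminorm circleWeight n).comp (LinearMap.snd ℂ SmoothCompact SmoothCircle ∘ₗ toProd)

theorem seminorm_apply (n : ℕ) (x : Toeplitz) :
    seminorm n x = Rapid.seminorm matrixWeight n x.cpt + Rapid.seminorm circleWeight n x.sym := rfl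

theorem ofReal_seminorm (n : ℕ) (x : Toeplitz) : ENNReal.ofReal (seminorm n x) = esn n x := by
  rw [seminorm_apply, ENNReal.ofReal_add (apply_nonneg _ _) (apply_nonneg _ _),
    Rapid.ofReal_seminorm, Rapid.ofReal_seminorm, esn]

theorem continuous_seminorm (n : ℕ) : Continuous (seminorm n) :=
  ((Rapid.withSeminorms.continuous_seminorm n).comp continuous_cpt).add
    ((Rapid.withSeminorms.continuous_seminorm n).comp continuous_sym)

theorem withSeminorms : WithSeminorms seminorm := by
  rw [SeminormFamily.withSeminorms_iff_nhds_eq_iInf]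
  refine le_antisymm (le_iInf fun n => ?_) ?_
  · rw [← tendsto_iff_comap]
    exact (continuous_seminorm n).tendsto' 0 0 (map_zero _)
  · rw [isInducing_toProd.nhds_eq_comap, map_zero, ← tendsto_iff_comap, Prod.zero_eq_mk,
      nhds_prod_eq]
    have aux : ∀ n, Tendsto (seminorm n) (⨅ i, comap (seminorm i) (𝓝 0)) (𝓝 0) := fun n =>
      tendsto_iff_comap.2 (iInf_le _ n)
    change Tendsto (fun x : Toeplitz => (x.cpt, x.sym)) _ _
    refine Tendsto.prodMk ?_ ?_
    · rw [Rapid.withSeminorms.tendsto_nhds]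
      intro n ε hε
      filter_upwards [(aux n).eventually (gt_mem_nhds hε)] with x hx
      rw [sub_zero]
      rw [seminorm_apply] at hx
      linarith [apply_nonneg (Rapid.seminorm circleWeight n) x.sym]
    · rw [Rapid.withSeminorms.tendsto_nhds]
      intro n ε hε
      filter_upwards [(aux n).eventually (gt_mem_nhds hε)] with x hx
      rw [sub_zero]
      rw [seminorm_apply] at hx
      linarith [apply_nonneg (Rapid.seminorm matrixWeight n) x.cpt]

instance : SeminormedMul Toeplitz :=
  SeminormedMul.of_withSeminorms withSeminorms fun n =>
    ⟨(2 : NNReal) • seminorm (n + 1), by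
      have : (((2 : NNReal) • seminorm (n + 1) : Seminorm ℂ Toeplitz) : Toeplitz → ℝ) =
        fun x => 2 * seminorm (n + 1) x := rfl
      rw [this]
      exact continuous_const.mul (continuous_seminorm (n + 1)), fun x y => by
      have h1 : ENNReal.ofReal (Rapid.seminorm matrixWeight n (x * y).cpt) ≤
          ENNReal.ofReal (seminorm (n + 1) x * seminorm (n + 1) y) := by
        rw [ENNReal.ofReal_mul (apply_nonneg _ _)]
        simp only [ofReal_seminorm, Rapid.ofReal_seminorm]
        exact mulCompact_esn_le x y n
      have h2 : ENNReal.ofReal (Rapid.seminorm circleWeight n (x * y).sym) ≤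
          ENNReal.ofReal (seminorm (n + 1) x * seminorm (n + 1) y) := by
        rw [ENNReal.ofReal_mul (apply_nonneg _ _)]
        simp only [ofReal_seminorm, Rapid.ofReal_seminorm]
        have hC : ∀ q, 1 ≤ circleWeight q := fun q => by simp [circleWeight]
        refine (SmoothCircle.conv_esn_le x.sym y.sym n).trans (mul_le_mul' ?_ ?_)
        · exact (Rapid.esn_mono hC (Nat.le_succ n) x.sym).trans le_add_self
        · exact (Rapid.esn_mono hC (Nat.le_succ n) y.sym).trans le_add_self
      have hpos : 0 ≤ seminorm (n + 1) x * seminorm (n + 1) y :=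
        mul_nonneg (apply_nonneg _ _) (apply_nonneg _ _)
      rw [ENNReal.ofReal_le_ofReal_iff hpos] at h1 h2
      change seminorm n (x * y) ≤ (2 * seminorm (n + 1) x) * (2 * seminorm (n + 1) y)
      rw [seminorm_apply]
      nlinarith⟩

instance : IsTopologicalRing Toeplitz := SeminormedMul.isTopologicalRing _

/-- The elementary matrix `e i j`. -/
def e (i j : ℕ) : Toeplitz := ⟨Rapid.single matrixWeight (i, j), 0⟩

/-- The element `v k = (0, z ^ k)`. -/
def v (k : ℤ) : Toeplitz := ⟨0, SmoothCircle.zpow k⟩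

/-- The shift `S`. -/
def S : Toeplitz := v 1

/-- The one-sided inverse `S*` of the shift. -/
def Sstar : Toeplitz := v (-1)

/-- The quotient map `𝒯 → C^∞(S¹)`. -/
def symbol : Toeplitz →ₐ[ℂ] SmoothCircle where
  toFun := fun x => x.sym
  map_one' := rfl
  map_mul' := fun _ _ => rfl
  map_zero' := rfl
  map_add' := fun _ _ => rfl
  commutes' := fun c => by
    rw [Algebra.algebraMap_eq_smul_one, Algebra.algebraMap_eq_smul_one]
    rfl

theorem continuous_symbol : Continuous symbol := continuous_sym

end Toeplitz

namespace Toeplitz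

theorem sym_sub (x y : Toeplitz) : (x - y).sym = x.sym - y.sym := rfl

theorem toMatrix_sub (x y : Toeplitz) (i j : ℕ) :
    toMatrix (x - y) i j = toMatrix x i j - toMatrix y i j := by
  rw [sub_eq_add_neg, ← neg_one_smul ℂ y, toMatrix_add, toMatrix_smul]; ring

theorem toMatrix_sum {κ : Type*} (s : Finset κ) (x : κ → Toeplitz) (i j : ℕ) :
    toMatrix (∑ m ∈ s, x m) i j = ∑ m ∈ s, toMatrix (x m) i j := by
  classical
  induction s using Finset.induction_on with
  | empty => simp [toMatrix_zero]
  | insert a t ha ih => rw [Finset.sum_insert ha, Finset.sum_insert ha, toMatrix_add, ih]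

theorem toMatrix_e (i j a b : ℕ) : toMatrix (e i j) a b = if a = i ∧ b = j then 1 else 0 := by
  simp [toMatrix, e, Rapid.single_apply, Prod.ext_iff]

theorem toMatrix_v (k : ℤ) (a b : ℕ) :
    toMatrix (v k) a b = if (a : ℤ) - b = k then 1 else 0 := by
  simp [toMatrix, v, SmoothCircle.zpow, Rapid.single_apply]

theorem zpow_mul_zpow (k l : ℤ) :
    SmoothCircle.zpow k * SmoothCircle.zpow l = SmoothCircle.zpow (k + l) := by
  ext n
  simp only [SmoothCircle.mul_apply, SmoothCircle.zpow, Rapid.single_apply]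
  rw [tsum_eq_single l fun m hm => by simp [hm]]
  simp [sub_eq_iff_eq_add]

theorem e_mul_e (i j k l : ℕ) : e i j * e k l = if j = k then e i l else 0 := by
  refine ext' (fun a b => ?_) ?_
  · rw [toMatrix_mul, tsum_eq_single j fun m hm => by simp [toMatrix_e, hm]]
    split_ifs with h <;> simp [toMatrix_e, toMatrix_zero, h, ← ite_and, and_comm]
  · split_ifs <;> simp [e]

theorem v_mul_e (k : ℤ) (i j : ℕ) :
    v k * e i j = if 0 ≤ i + k then e (i + k).toNat j else 0 := by
  refine ext' (fun a b => ?_) ?_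
  · rw [toMatrix_mul, tsum_eq_single i fun m hm => by simp [toMatrix_e, hm]]
    split_ifs with h
    · simp only [toMatrix_e, toMatrix_v, true_and, ← ite_and, mul_ite, mul_one, mul_zero]
      congr 1
      exact propext ⟨by omega, by omega⟩
    · simp only [toMatrix_e, toMatrix_v, toMatrix_zero]
      rw [if_neg (by omega), zero_mul]
  · split_ifs <;> simp [e]

theorem e_mul_v (k : ℤ) (i j : ℕ) :
    e i j * v k = if 0 ≤ j - k then e i (j - k).toNat else 0 := by
  refine ext' (fun a b => ?_) ?_
  · rw [toMatrix_mul, tsum_eq_single j fun m hm => by simp [toMatrix_e, hm]]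
    split_ifs with h
    · simp only [toMatrix_e, toMatrix_v, and_true, ← ite_and, mul_ite, mul_one, mul_zero]
      congr 1
      exact propext ⟨by omega, by omega⟩
    · rw [toMatrix_v, toMatrix_zero, if_neg (by omega), mul_zero]
  · split_ifs <;> simp [e]

theorem v_mul_v_natCast (k : ℤ) (l : ℕ) : v k * v l = v (k + l) := by
  refine ext' (fun a b => ?_) (zpow_mul_zpow k l)
  rw [toMatrix_mul, tsum_eq_single (b + l) fun m hm => by
    rw [toMatrix_v l, if_neg (by omega), mul_zero]]
  simp only [toMatrix_v]
  rw [if_pos (by omega : ((b + l : ℕ) : ℤ) - b = l), mul_one]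
  congr 1
  exact propext ⟨by omega, by omega⟩

theorem v_mul_v_neg (k : ℤ) (l : ℕ) :
    v k * v (-l) = v (k - l) * (1 - ∑ m ∈ Finset.range l, e m m) := by
  refine ext' (fun a b => ?_) ?_
  · have hR : ∀ c, toMatrix (1 - ∑ m ∈ Finset.range l, e m m) c b =
        if c = b ∧ l ≤ b then 1 else 0 := fun c => by
      rw [toMatrix_sub, toMatrix_sum, toMatrix_one]
      simp only [toMatrix_e]
      by_cases h : c = b
      · subst h
        by_cases h' : l ≤ c
        · rw [Finset.sum_eq_zero fun m hm => by
            rw [Finset.mem_range] at hm; rw [if_neg (by omega)]]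
          simp [h']
        · rw [Finset.sum_eq_single_of_mem c (by simp; omega) fun m _ hm => by
            rw [if_neg (by omega)]]
          simp [h']
      · rw [Finset.sum_eq_zero fun m _ => by rw [if_neg (by omega)]]
        simp [h]
    have hr : toMatrix (v (k - l) * (1 - ∑ m ∈ Finset.range l, e m m)) a b =
        toMatrix (v (k - l)) a b * if b = b ∧ l ≤ b then 1 else 0 := by
      rw [toMatrix_mul, tsum_eq_single b fun m hm => by rw [hR, if_neg (by tauto), mul_zero], hR]
    rw [hr, toMatrix_mul]
    by_cases h : l ≤ b
    · rw [tsum_eq_single (b - l) fun m hm => by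
        rw [toMatrix_v (-l), if_neg (by omega), mul_zero]]
      simp only [toMatrix_v, h, and_self, if_true, mul_one]
      rw [if_pos (by omega : ((b - l : ℕ) : ℤ) - b = -l), mul_one]
      congr 1
      exact propext ⟨by omega, by omega⟩
    · rw [if_neg (by tauto), mul_zero]
      refine (tsum_congr fun m => ?_).trans tsum_zero
      rw [toMatrix_v (-l), if_neg (by omega), mul_zero]
  · have h0 : (∑ m ∈ Finset.range l, e m m).sym = 0 := by
      change symbol _ = 0
      rw [map_sum]
      exact Finset.sum_eq_zero fun _ _ => rfl
    rw [sym_mul, sym_mul, sym_sub, h0, sym_one, sub_zero, mul_one]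
    exact zpow_mul_zpow k (-l)

end Toeplitz

/-! ### Projective tensor products -/

/-- The algebraic tensor product `E ⊗ F` of two algebras, to be equipped with the projective
topology. -/
def ProjTensor (E F : Type*) [Ring E] [Algebra ℂ E] [Ring F] [Algebra ℂ F] : Type _ := E ⊗[ℂ] F

namespace ProjTensor

section Topology

variable (E F : Type*) [Ring E] [Algebra ℂ E] [Ring F] [Algebra ℂ F]

instance : Ring (ProjTensor E F) := inferInstanceAs (Ring (E ⊗[ℂ] F))
instance : Algebra ℂ (ProjTensor E F) := inferInstanceAs (Algebra ℂ (E ⊗[ℂ] F))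

variable {E F}

/-- The elementary tensor `x ⊗ y`. -/
def tmul (x : E) (y : F) : ProjTensor E F := x ⊗ₜ[ℂ] y

theorem tmul_mul_tmul (x x' : E) (y y' : F) :
    tmul x y * tmul x' y' = tmul (x * x') (y * y') :=
  Algebra.TensorProduct.tmul_mul_tmul x x' y y'

theorem induction_on {motive : ProjTensor E F → Prop} (z : ProjTensor E F) (zero : motive 0)
    (tmul : ∀ x y, motive (tmul x y)) (add : ∀ x y, motive x → motive y → motive (x + y)) :
    motive z :=
  TensorProduct.induction_on z zero tmul add

variable (E F) [TopologicalSpace E] [TopologicalSpace F]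

/-- The seminorms `r` on `E ⊗ F` with `r (x ⊗ y) ≤ p x * q y` for some continuous seminorms `p` on
`E` and `q` on `F`. They define the projective topology: it is the finest locally convex topology
for which `(x, y) ↦ x ⊗ y` is continuous. -/
def IsProjSeminorm (r : Seminorm ℂ (ProjTensor E F)) : Prop :=
  ∃ p : Seminorm ℂ E, Continuous p ∧ ∃ q : Seminorm ℂ F, Continuous q ∧
    ∀ x y, r (tmul x y) ≤ p x * q y

/-- The family of all these seminorms. -/
def projSeminorms : SeminormFamily ℂ (ProjTensor E F) {r // IsProjSeminorm E F r} := fun r => r.1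

instance : Nonempty {r // IsProjSeminorm E F r} :=
  ⟨⟨0, 0, continuous_const, 0, continuous_const, fun _ _ => by simp⟩⟩

/-- The uniform structure of the projective topology. -/
instance : UniformSpace (ProjTensor E F) :=
  letI : TopologicalSpace (ProjTensor E F) := (projSeminorms E F).moduleFilterBasis.topology
  haveI : IsTopologicalAddGroup (ProjTensor E F) :=
    (WithSeminorms.mk rfl : WithSeminorms (projSeminorms E F)).topologicalAddGroup
  IsTopologicalAddGroup.rightUniformSpace (ProjTensor E F)

theorem withSeminorms : WithSeminorms (projSeminorms E F) := ⟨rfl⟩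

instance : IsUniformAddGroup (ProjTensor E F) := by
  let _ : TopologicalSpace (ProjTensor E F) := (projSeminorms E F).moduleFilterBasis.topology
  have : IsTopologicalAddGroup (ProjTensor E F) :=
    (WithSeminorms.mk rfl : WithSeminorms (projSeminorms E F)).topologicalAddGroup
  exact isUniformAddGroup_of_addCommGroup

instance : ContinuousSMul ℂ (ProjTensor E F) := (withSeminorms E F).continuousSMul

instance : UniformContinuousConstSMul ℂ (ProjTensor E F) :=
  uniformContinuousConstSMul_of_continuousConstSMul ℂ (ProjTensor E F)

end Topology

section Mul

variable {E F : Type*} [Ring E] [Algebra ℂ E] [Ring F] [Algebra ℂ F]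

/-- The seminorms bounded by `p x * q y` on elementary tensors. -/
def boundedBy (p : Seminorm ℂ E) (q : Seminorm ℂ F) : Set (Seminorm ℂ (ProjTensor E F)) :=
  {r | ∀ x y, r (tmul x y) ≤ p x * q y}

theorem boundedBy_bddAbove (p : Seminorm ℂ E) (q : Seminorm ℂ F) :
    BddAbove (boundedBy p q) := by
  rw [Seminorm.bddAbove_iff]
  have h : ∀ z : ProjTensor E F, ∃ C, ∀ r ∈ boundedBy p q, r z ≤ C := fun z => by
    induction z using induction_on with
    | zero => exact ⟨0, fun r _ => by simp⟩
    | tmul x y => exact ⟨_, fun r hr => hr x y⟩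
    | add x y hx hy =>
      obtain ⟨C, hC⟩ := hx
      obtain ⟨D, hD⟩ := hy
      exact ⟨C + D, fun r hr => (map_add_le_add r x y).trans (add_le_add (hC r hr) (hD r hr))⟩
  choose C hC using h
  exact ⟨C, by rintro _ ⟨r, hr, rfl⟩ z; exact hC z r hr⟩

/-- The projective tensor product of two seminorms: the largest seminorm with
`r (x ⊗ y) ≤ p x * q y`. -/
def proj (p : Seminorm ℂ E) (q : Seminorm ℂ F) : Seminorm ℂ (ProjTensor E F) :=
  sSup (boundedBy p q)

theorem le_proj {p : Seminorm ℂ E} {q : Seminorm ℂ F} {r : Seminorm ℂ (ProjTensor E F)}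
    (hr : ∀ x y, r (tmul x y) ≤ p x * q y) (z : ProjTensor E F) : r z ≤ proj p q z :=
  (Seminorm.bddAbove_iff.1 (boundedBy_bddAbove p q)).elim fun _ _ => by
    rw [proj, Seminorm.sSup_apply (boundedBy_bddAbove p q)]
    obtain ⟨u, hu⟩ := boundedBy_bddAbove p q
    exact le_ciSup (f := fun r : boundedBy p q => (r : Seminorm ℂ (ProjTensor E F)) z)
      ⟨u z, by rintro _ ⟨s, rfl⟩; exact hu s.2 z⟩ ⟨r, hr⟩

theorem proj_tmul_le (p : Seminorm ℂ E) (q : Seminorm ℂ F) (x : E) (y : F) :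
    proj p q (tmul x y) ≤ p x * q y := by
  rw [proj, Seminorm.sSup_apply (boundedBy_bddAbove p q)]
  have : Nonempty (boundedBy p q) := ⟨⟨0, fun x y => by
    simpa using mul_nonneg (apply_nonneg p x) (apply_nonneg q y)⟩⟩
  exact ciSup_le fun r => r.2 x y

theorem le_mul_proj {p : Seminorm ℂ E} {q : Seminorm ℂ F} {r : Seminorm ℂ (ProjTensor E F)}
    {C : ℝ} (hC : 0 ≤ C) (hr : ∀ x y, r (tmul x y) ≤ C * (p x * q y)) (z : ProjTensor E F) :
    r z ≤ C * proj p q z := by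
  rcases hC.eq_or_lt with rfl | hC'
  · have : r z ≤ 0 := by
      induction z using induction_on with
      | zero => simp
      | tmul x y => simpa using hr x y
      | add x y hx hy => exact (map_add_le_add r x y).trans (by linarith)
    simpa using this
  · let c : NNReal := ⟨C⁻¹, inv_nonneg.2 hC⟩
    have h := le_proj (p := p) (q := q) (r := c • r)
      (fun x y => by
        change C⁻¹ * r (tmul x y) ≤ _
        rw [inv_mul_le_iff₀ hC']
        exact hr x y) z
    change C⁻¹ * r z ≤ _ at h
    rwa [inv_mul_le_iff₀ hC'] at h

variable (E F) [TopologicalSpace E] [TopologicalSpace F] [SeminormedMul E] [SeminormedMul F]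

instance : SeminormedMul (ProjTensor E F) :=
  SeminormedMul.of_withSeminorms (withSeminorms E F) fun r => by
    obtain ⟨r, p, hp, q, hq, hr⟩ := r
    obtain ⟨p', hp', hpp⟩ := SeminormedMul.exists_mul_le p hp
    obtain ⟨q', hq', hqq⟩ := SeminormedMul.exists_mul_le q hq
    refine ⟨proj p' q', (withSeminorms E F).continuous_seminorm
      ⟨proj p' q', p', hp', q', hq', proj_tmul_le p' q'⟩, fun z w => ?_⟩
    change r (z * w) ≤ _
    have h1 : ∀ x y, r (z * tmul x y) ≤ (p' x * q' y) * proj p' q' z := fun x y => by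
      refine le_mul_proj (r := r.comp (LinearMap.mulRight ℂ (tmul x y)))
        (mul_nonneg (apply_nonneg _ _) (apply_nonneg _ _)) (fun a b => ?_) z
      rw [Seminorm.comp_apply, LinearMap.mulRight_apply, tmul_mul_tmul]
      refine (hr _ _).trans ((mul_le_mul (hpp a x) (hqq b y) (apply_nonneg _ _)
        (mul_nonneg (apply_nonneg _ _) (apply_nonneg _ _))).trans (le_of_eq ?_))
      ring
    refine le_mul_proj (r := r.comp (LinearMap.mulLeft ℂ z)) (apply_nonneg _ _)
      (fun a b => ?_) w
    rw [Seminorm.comp_apply, LinearMap.mulLeft_apply]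
    exact (h1 a b).trans (le_of_eq (mul_comm _ _))

instance : IsTopologicalRing (ProjTensor E F) := SeminormedMul.isTopologicalRing _

end Mul

end ProjTensor

section Completed

variable (E F : Type*) [Ring E] [Algebra ℂ E] [TopologicalSpace E] [SeminormedMul E]
  [Ring F] [Algebra ℂ F] [TopologicalSpace F] [SeminormedMul F]

/-- The completed projective tensor product `E ⊗_π F` of two locally convex algebras. -/
abbrev CompletedTensor : Type _ := UniformSpace.Completion (ProjTensor E F)

variable {E F}

/-- The elementary tensor `x ⊗ y` in `E ⊗_π F`, as a linear map in `y`. -/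
def ctmul (x : E) : F →ₗ[ℂ] CompletedTensor E F where
  toFun := fun y => ((ProjTensor.tmul x y : ProjTensor E F) : CompletedTensor E F)
  map_add' := fun y z => by
    rw [← UniformSpace.Completion.coe_add]
    exact congrArg _ (TensorProduct.tmul_add x y z)
  map_smul' := fun c y => by
    rw [RingHom.id_apply, ← UniformSpace.Completion.coe_smul]
    exact congrArg _ (TensorProduct.tmul_smul c x y)

variable {E' : Type*} [Ring E'] [Algebra ℂ E'] [TopologicalSpace E'] [SeminormedMul E']

/-- The map `φ ⊗ id` on algebraic tensor products. -/
def projMap (F : Type*) [Ring F] [Algebra ℂ F] (φ : E →ₐ[ℂ] E') :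
    ProjTensor E F →ₐ[ℂ] ProjTensor E' F :=
  Algebra.TensorProduct.map φ (AlgHom.id ℂ F)

theorem projMap_tmul {E E' F : Type*} [Ring E] [Algebra ℂ E] [Ring E'] [Algebra ℂ E'] [Ring F]
    [Algebra ℂ F] (φ : E →ₐ[ℂ] E') (x : E) (y : F) :
    projMap F φ (ProjTensor.tmul x y) = ProjTensor.tmul (φ x) y :=
  Algebra.TensorProduct.map_tmul φ (AlgHom.id ℂ F) x y

theorem continuous_projMap (φ : E →ₐ[ℂ] E') (hφ : Continuous φ) :
    Continuous (projMap F φ) := by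
  have : Continuous (projMap F φ).toLinearMap := by
    refine WithSeminorms.continuous_of_continuous_comp (ProjTensor.withSeminorms E' F) _ fun r => ?_
    obtain ⟨r, p, hp, q, hq, hr⟩ := r
    exact (ProjTensor.withSeminorms E F).continuous_seminorm
      ⟨r.comp (projMap F φ).toLinearMap, p.comp φ.toLinearMap, hp.comp hφ, q, hq,
        fun x y => by
          have := hr (φ x) y
          rwa [← projMap_tmul] at this⟩
  exact this

/-- The map `φ ⊗ id : E ⊗_π F → E' ⊗_π F` induced by a continuous homomorphism `φ : E → E'`. -/
def completedMap (F : Type*) [Ring F] [Algebra ℂ F] [TopologicalSpace F] [SeminormedMul F]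
    (φ : E →ₐ[ℂ] E') (hφ : Continuous φ) :
    CompletedTensor E F →ₐ[ℂ] CompletedTensor E' F :=
  { UniformSpace.Completion.mapRingHom (projMap F φ).toRingHom (continuous_projMap φ hφ) with
    commutes' := fun c => by
      change UniformSpace.Completion.mapRingHom (projMap F φ).toRingHom (continuous_projMap φ hφ)
        (algebraMap ℂ (ProjTensor E F) c : CompletedTensor E F) = _
      rw [UniformSpace.Completion.mapRingHom_coe, UniformSpace.Completion.algebraMap_def]
      exact congrArg _ ((projMap F φ).commutes c) }

end Completed

/-! ### Generalized Weyl algebras -/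

/-- Generators of the generalized Weyl algebra. -/
inductive GWAGen
  | h
  | x
  | y

namespace GWA

open Polynomial

/-- The element of the free algebra given by a polynomial in `h`. -/
def freeD (d : ℂ[X]) : FreeAlgebra ℂ GWAGen := aeval (FreeAlgebra.ι ℂ GWAGen.h) d

/-- The defining relations
`x d = σ(d) x`, `y d = σ⁻¹(d) y`, `y x = P`, `x y = σ(P)` for `d ∈ ℂ[h]`. -/
inductive Rel (σ : ℂ[X] ≃ₐ[ℂ] ℂ[X]) (P : ℂ[X]) :
    FreeAlgebra ℂ GWAGen → FreeAlgebra ℂ GWAGen → Prop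
  | x_mul (d : ℂ[X]) : Rel σ P (FreeAlgebra.ι ℂ GWAGen.x * freeD d)
      (freeD (σ d) * FreeAlgebra.ι ℂ GWAGen.x)
  | y_mul (d : ℂ[X]) : Rel σ P (FreeAlgebra.ι ℂ GWAGen.y * freeD d)
      (freeD (σ.symm d) * FreeAlgebra.ι ℂ GWAGen.y)
  | y_mul_x : Rel σ P (FreeAlgebra.ι ℂ GWAGen.y * FreeAlgebra.ι ℂ GWAGen.x) (freeD P)
  | x_mul_y : Rel σ P (FreeAlgebra.ι ℂ GWAGen.x * FreeAlgebra.ι ℂ GWAGen.y) (freeD (σ P))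

end GWA

/-- The generalized Weyl algebra `ℂ[h](σ, P)`: the algebra generated by `x` and `y` over `ℂ[h]`
subject to the relations `GWA.Rel`. -/
def GWA (σ : Polynomial ℂ ≃ₐ[ℂ] Polynomial ℂ) (P : Polynomial ℂ) : Type := RingQuot (GWA.Rel σ P)

namespace GWA

open Polynomial

variable (σ : ℂ[X] ≃ₐ[ℂ] ℂ[X]) (P : ℂ[X])

instance : Ring (GWA σ P) := inferInstanceAs (Ring (RingQuot (GWA.Rel σ P)))
instance : Algebra ℂ (GWA σ P) := inferInstanceAs (Algebra ℂ (RingQuot (GWA.Rel σ P)))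

/-- The quotient map from the free algebra. -/
def mk : FreeAlgebra ℂ GWAGen →ₐ[ℂ] GWA σ P := RingQuot.mkAlgHom ℂ (GWA.Rel σ P)

theorem mk_surjective : Function.Surjective (mk σ P) := RingQuot.mkAlgHom_surjective ℂ _

/-- The generator `x`. -/
def x : GWA σ P := mk σ P (FreeAlgebra.ι ℂ GWAGen.x)

/-- The generator `y`. -/
def y : GWA σ P := mk σ P (FreeAlgebra.ι ℂ GWAGen.y)

/-- The structure map `ℂ[h] → ℂ[h](σ, P)`. -/
def ofPoly : ℂ[X] →ₐ[ℂ] GWA σ P := aeval (mk σ P (FreeAlgebra.ι ℂ GWAGen.h))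

/-- The homogeneous component of degree `n`: it is `D = ℂ[h]` for `n = 0`, `D y ^ n` for `n > 0`
and `D x ^ (-n)` for `n < 0`. -/
def component (n : ℤ) : Submodule ℂ (GWA σ P) :=
  (LinearMap.range (ofPoly σ P).toLinearMap).map
    (LinearMap.mulRight ℂ (if 0 ≤ n then y σ P ^ n.toNat else x σ P ^ (-n).toNat))

instance : Countable GWAGen :=
  Function.Injective.countable (f := fun g : GWAGen => match g with
    | .h => (0 : ℕ)
    | .x => 1
    | .y => 2) (by intro a b; cases a <;> cases b <;> simp)

theorem exists_countable_basis :
    ∃ J : Type, Countable J ∧ Nonempty (Module.Basis J ℂ (GWA σ P)) := by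
  let b := FreeAlgebra.basisFreeMonoid ℂ GWAGen
  let s : Set (GWA σ P) := Set.range fun m => mk σ P (b m)
  have hs : Submodule.span ℂ s = ⊤ := by
    have h1 : s = (mk σ P).toLinearMap '' Set.range b := by
      rw [← Set.range_comp]; rfl
    rw [h1, Submodule.span_image, b.span_eq, Submodule.map_top]
    exact LinearMap.range_eq_top.2 (mk_surjective σ P)
  obtain ⟨t, hts, hspan, hlin⟩ := exists_linearIndependent ℂ s
  have hc : s.Countable := by
    have : Countable (FreeMonoid GWAGen) := inferInstance
    exact Set.countable_range _
  have hct : Countable t := (hc.mono hts).to_subtype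
  refine ⟨t, hct, ⟨Module.Basis.mk hlin ?_⟩⟩
  rw [Subtype.range_coe, hspan, hs]

/-- Generalized Weyl algebras carry the fine topology. -/
instance : UniformSpace (GWA σ P) := fineUniformSpace (GWA σ P)

instance : IsUniformAddGroup (GWA σ P) := fine_isUniformAddGroup (GWA σ P)

instance : SeminormedMul (GWA σ P) := by
  obtain ⟨J, hJ, ⟨b⟩⟩ := exists_countable_basis σ P
  exact fine_seminormedMul b

end GWA

/-! ### The Toeplitz algebra of a graded algebra -/

section ToeplitzOf

variable {B : Type*} [Ring B] [Algebra ℂ B] [TopologicalSpace B] [SeminormedMul B]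

/-- The closed subalgebra of `𝒯 ⊗_π B` generated by `1 ⊗ B₀`, `S ⊗ B₁` and `S* ⊗ B₋₁`. -/
def toeplitzOf (𝓑 : ℤ → Submodule ℂ B) : Subalgebra ℂ (CompletedTensor Toeplitz B) :=
  (Algebra.adjoin ℂ
    (ctmul (1 : Toeplitz) '' (𝓑 0 : Set B) ∪ ctmul Toeplitz.S '' (𝓑 1 : Set B) ∪
      ctmul Toeplitz.Sstar '' (𝓑 (-1) : Set B))).topologicalClosure

/-- The subspace `e i j ⊗ B_{i+1} B_{-(j+1)}` of `𝒯 ⊗_π B`. -/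
def lambdaPiece (𝓑 : ℤ → Submodule ℂ B) (q : ℕ × ℕ) :
    Submodule ℂ (CompletedTensor Toeplitz B) :=
  (𝓑 ((q.1 : ℤ) + 1) * 𝓑 (-((q.2 : ℤ) + 1))).map (ctmul (Toeplitz.e q.1 q.2))

/-- The algebraic sum of the subspaces `e i j ⊗ B_{i+1} B_{-(j+1)}`. -/
def lambdaAlg (𝓑 : ℤ → Submodule ℂ B) : Submodule ℂ (CompletedTensor Toeplitz B) :=
  ⨆ q, lambdaPiece 𝓑 q

/-- The closed sum of the subspaces `e i j ⊗ B_{i+1} B_{-(j+1)}`. -/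
def lambdaOf (𝓑 : ℤ → Submodule ℂ B) : Submodule ℂ (CompletedTensor Toeplitz B) :=
  (lambdaAlg 𝓑).topologicalClosure

/-- The map `p : 𝒯 ⊗_π B → C^∞(S¹) ⊗_π B`. -/
def symbolTensor (B : Type*) [Ring B] [Algebra ℂ B] [TopologicalSpace B] [SeminormedMul B] :
    CompletedTensor Toeplitz B →ₐ[ℂ] CompletedTensor SmoothCircle B :=
  completedMap B Toeplitz.symbol Toeplitz.continuous_symbol

end ToeplitzOf

end

/-! Write `s` for `gradedSection`, `j` for `gradedEmbedding` and `v k` for `(0, z ^ k)`.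

The embedding. The elements `1 ⊗ d`, `z⁻¹ ⊗ x` and `z ⊗ y` satisfy the defining relations of `A`, so
`j` exists by the universal property; uniqueness of the homogeneous decomposition is not needed for
this. Evaluation at `z = 1`, tensored with the identity of `A`, is a continuous left inverse of `j`
(`slice_gradedEmbedding`). It takes values in `A` because `A` is Hausdorff and complete in the fine
topology, and `j` is continuous because every linear map from a fine space to a locally convex space
is. Hence `j` is an embedding with closed range. Following `j` by `f ↦ (0, f)` on the first factor
gives the continuous linear map `s`, `a ↦ v n ⊗ a` for `a` in `A_n`, and its symbol is `j`.

The extension. The map `k ↦ v k` is almost multiplicative: `S* v n = v (n - 1)` for all `n` and `S v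
n = v (n + 1)` for `n ≥ 0`, while `S v (-(l+1)) = v (-l) - e 0 l`. So left multiplication by a
generator preserves the sum of `s(A)` and the algebraic direct sum, and as `1` lies there, so does
the subalgebra that the generators produce (`adjoin_le_range_sup_lambdaAlg`). Therefore `t - s (j⁻¹
(p t))` lies in the algebraic sum for `t` in a dense subalgebra, and in `Λ_A` for every `t` in
`𝒯_A`. Since `p` vanishes on `Λ_A`, the kernel is exactly `Λ_A`. In the other direction `e i j = v i
v (-j) - v (i+1) v (-(j+1))` places `Λ_A` inside `𝒯_A`. The ideal property is a shift of rows and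
columns that matches the shift of degrees.

Directness and closedness. The matrix entries of the compact part give continuous slice maps to `A`,
which separate the summands. A projective seminorm dominates the weighted `ℓ¹`-sum of the entries
(`sum_slice_entry_le`), so an element of `Λ_A` is determined by its entries, and these stay in
`A_{i+1} A_{-(j+1)}` because all subspaces of `A` are closed. If `P` is non constant, a nonzero
element of `A_{i+1} A_{-(j+1)}` is a multiple of `y^{i+1} x^{j+1}`, in which more than `min i j`
twisted copies of `P` have been split off; it thus has a coefficient of degree greater than `min i
j` in `h`. Each monomial is then available to only finitely many `(i, j)`, and a seminorm on `A` can
be chosen that is at least `1` on every nonzero entry of a given element. Summability leaves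
finitely many entries (`finite_slice_ne_zero`). For `P = 0` all summands vanish. For a nonzero
constant `P` the argument fails: `∑ 2⁻ⁱ e i i ⊗ 1` has infinitely many entries. -/

noncomputable section

open scoped TensorProduct ENNReal Topology
open Filter UniformSpace

/-! ### The fine topology is Hausdorff and complete -/

/-- The weighted `ℓ¹`-seminorm `u ↦ ∑ i, w i * ‖u i‖` on finitely supported families. -/
def weightedSeminorm {J : Type*} (w : J → NNReal) : Seminorm ℂ (J →₀ ℂ) :=
  Seminorm.of (fun u => u.sum fun i z => (w i : ℝ) * ‖z‖)
    (fun u v => by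
      classical
      have hsub : ∀ (u : J →₀ ℂ) (s : Finset J), u.support ⊆ s →
          (u.sum fun i z => (w i : ℝ) * ‖z‖) = ∑ i ∈ s, (w i : ℝ) * ‖u i‖ := fun u s hs =>
        Finsupp.sum_of_support_subset u hs _ (by simp)
      rw [hsub _ (u.support ∪ v.support) Finsupp.support_add,
        hsub _ (u.support ∪ v.support) Finset.subset_union_left,
        hsub _ (u.support ∪ v.support) Finset.subset_union_right, ← Finset.sum_add_distrib]
      refine Finset.sum_le_sum fun i _ => ?_
      rw [← mul_add, Finsupp.add_apply]
      exact mul_le_mul_of_nonneg_left (norm_add_le _ _) (w i).2)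
    (fun c u => by
      rcases eq_or_ne c 0 with rfl | hc
      · simp
      · rw [Finsupp.sum, Finsupp.support_smul_eq hc, Finsupp.sum, Finset.mul_sum]
        refine Finset.sum_congr rfl fun i _ => ?_
        simp only [Finsupp.smul_apply, smul_eq_mul, norm_mul]
        ring)

theorem weightedSeminorm_eq_sum {J : Type*} (w : J → NNReal) (u : J →₀ ℂ) (s : Finset J)
    (hs : u.support ⊆ s) : weightedSeminorm w u = ∑ i ∈ s, (w i : ℝ) * ‖u i‖ :=
  Finsupp.sum_of_support_subset u hs (fun i z => (w i : ℝ) * ‖z‖) (by simp)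

theorem sum_le_weightedSeminorm {J : Type*} (w : J → NNReal) (u : J →₀ ℂ) (s : Finset J) :
    ∑ i ∈ s, (w i : ℝ) * ‖u i‖ ≤ weightedSeminorm w u := by
  classical
  rw [weightedSeminorm_eq_sum w u (s ∪ u.support) Finset.subset_union_right]
  exact Finset.sum_le_sum_of_subset_of_nonneg Finset.subset_union_left
    fun i _ _ => mul_nonneg (w i).2 (norm_nonneg _)

section Fine

variable (A : Type*) [AddCommGroup A] [Module ℂ A]

theorem fine_continuous_seminorm (p : Seminorm ℂ A) :
    @Continuous _ _ (fineUniformSpace A).toTopologicalSpace _ p :=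
  let _ := fineUniformSpace A
  (fine_withSeminorms A).continuous_seminorm p

/-- Linear maps from a space with the fine topology to a locally convex space are continuous. -/
theorem fine_continuous_linearMap {F : Type*} [AddCommGroup F] [Module ℂ F] [TopologicalSpace F]
    [PolynormableSpace ℂ F] (f : A →ₗ[ℂ] F) :
    @Continuous _ _ (fineUniformSpace A).toTopologicalSpace _ f := by
  let _ := fineUniformSpace A
  have := fine_isUniformAddGroup A
  exact WithSeminorms.continuous_of_continuous_comp (PolynormableSpace.withSeminorms ℂ F) f
    fun i => fine_continuous_seminorm A _

/-- The `ℓ¹`-norm of the coordinates in a basis is a seminorm that vanishes only at `0`. -/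
theorem fine_t2Space : @T2Space A (fineUniformSpace A).toTopologicalSpace := by
  let _ := fineUniformSpace A
  have := fine_isUniformAddGroup A
  have : T1Space A := by
    refine (fine_withSeminorms A).T1_of_separating fun x hx => ?_
    let b := Module.Basis.ofVectorSpace ℂ A
    refine ⟨(weightedSeminorm fun _ => 1).comp b.repr.toLinearMap, fun h => hx ?_⟩
    apply b.repr.injective
    ext i
    have h1 := sum_le_weightedSeminorm (fun _ => 1) (b.repr x) {i}
    have h2 : weightedSeminorm (fun _ => 1) (b.repr x) = 0 := h
    rw [h2] at h1
    simpa using h1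
  infer_instance

/-- In the fine topology every subspace is closed. -/
theorem fine_isClosed_submodule (V : Submodule ℂ A) :
    @IsClosed A (fineUniformSpace A).toTopologicalSpace (V : Set A) := by
  let _ := fineUniformSpace A
  rw [← isOpen_compl_iff, isOpen_iff_mem_nhds]
  intro x hx
  -- A linear functional that kills `V` but not `x` is automatically continuous here, and the open
  -- set where it is nonzero avoids `V`.
  obtain ⟨f, hf, hV⟩ := Submodule.exists_le_ker_of_notMem (p := V) (v := x) hx
  have hc : Continuous f := fine_continuous_linearMap A f
  filter_upwards [hc.continuousAt.eventually_ne hf] with y hy hyV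
  exact hy (hV hyV)

/-- The coordinates of a Cauchy filter converge. The freedom to choose arbitrary weights on the
basis forces the limit family to have finite support, and the same weighted `ℓ¹`-estimates give
convergence for all seminorms. -/
theorem fine_completeSpace : @CompleteSpace A (fineUniformSpace A) := by
  let _ := fineUniformSpace A
  have := fine_isUniformAddGroup A
  let b := Module.Basis.ofVectorSpace ℂ A
  set J := Module.Basis.ofVectorSpaceIndex ℂ A
  have hcoord : ∀ k : J, UniformContinuous fun a : A => b.repr a k := fun k => by
    have hc : Continuous ((Finsupp.lapply k : (J →₀ ℂ) →ₗ[ℂ] ℂ) ∘ₗ b.repr.toLinearMap) :=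
      fine_continuous_linearMap A _
    exact uniformContinuous_addMonoidHom_of_continuous
      (f := ((Finsupp.lapply k : (J →₀ ℂ) →ₗ[ℂ] ℂ) ∘ₗ b.repr.toLinearMap)) hc
  refine ⟨fun {F} hF => ?_⟩
  have hFne : F.NeBot := hF.1
  choose x hx using fun k : J => cauchy_map_iff_exists_tendsto.1 (hF.map (hcoord k))
  have hcauchy : ∀ q : Seminorm ℂ A, ∀ ε > 0, ∃ M ∈ F, ∀ a ∈ M, ∀ c ∈ M, q (a - c) ≤ ε := by
    intro q ε hε
    have hF2 := hF.2
    rw [uniformity_eq_comap_nhds_zero] at hF2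
    have h0 : {z : A | q z < ε} ∈ 𝓝 (0 : A) :=
      (fine_continuous_seminorm A q).continuousAt.eventually_lt continuousAt_const
        (by simpa using hε)
    have h1 := hF2 (preimage_mem_comap h0)
    obtain ⟨M, hM, hMM⟩ := mem_prod_same_iff.1 h1
    refine ⟨M, hM, fun a ha c hc => ?_⟩
    have := hMM (Set.mk_mem_prod hc ha)
    exact le_of_lt this
  -- the bound on partial sums passes to the limit in one variable
  have hlim : ∀ w : J → NNReal, ∀ ε > 0, ∃ M ∈ F, ∀ a ∈ M, ∀ s : Finset J,
      ∑ k ∈ s, (w k : ℝ) * ‖b.repr a k - x k‖ ≤ ε := by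
    intro w ε hε
    obtain ⟨M, hM, h⟩ := hcauchy ((weightedSeminorm w).comp b.repr.toLinearMap) ε hε
    refine ⟨M, hM, fun a ha s => ?_⟩
    have ht : Tendsto (fun c => ∑ k ∈ s, (w k : ℝ) * ‖b.repr a k - b.repr c k‖) F
        (𝓝 (∑ k ∈ s, (w k : ℝ) * ‖b.repr a k - x k‖)) :=
      tendsto_finsetSum s fun k _ => ((tendsto_const_nhds.sub (hx k)).norm).const_mul _
    refine le_of_tendsto ht ?_
    filter_upwards [hM] with c hc
    have h1 := sum_le_weightedSeminorm w (b.repr (a - c)) s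
    have h2 : weightedSeminorm w (b.repr (a - c)) ≤ ε := h a ha c hc
    simp only [map_sub, Finsupp.sub_apply] at h1 h2
    exact h1.trans h2
  have hfin : (Function.support x).Finite := by
    -- With weight `1 / ‖x k‖` (and `0` where `x k = 0`), an index in the support of `x` at which
    -- `a` vanishes contributes exactly `1`. As `a` has finite support, an infinite support of `x`
    -- would provide two such indices, against the bound `1`.
    obtain ⟨M, hM, h⟩ := hlim (fun k => ‖x k‖₊⁻¹) 1 one_pos
    obtain ⟨a, ha⟩ := nonempty_of_mem hM
    by_contra hinf
    have hinf' : (Function.support x \ (b.repr a).support).Infinite :=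
      Set.Infinite.sdiff hinf (Finset.finite_toSet _)
    obtain ⟨t, ht, htc⟩ := hinf'.exists_subset_card_eq 2
    have h1 := h a ha t
    have h2 : ∑ k ∈ t, ((‖x k‖₊⁻¹ : NNReal) : ℝ) * ‖b.repr a k - x k‖ = ∑ k ∈ t, (1 : ℝ) := by
      refine Finset.sum_congr rfl fun k hk => ?_
      have hk' := ht hk
      have h3 : b.repr a k = 0 := by simpa using hk'.2
      have h4 : ‖x k‖ ≠ 0 := by simpa using hk'.1
      rw [h3, zero_sub, norm_neg]
      simp [h4]
    rw [h2] at h1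
    simp [htc] at h1
  let X : J →₀ ℂ := Finsupp.ofSupportFinite x hfin
  refine ⟨b.repr.symm X, ?_⟩
  rw [show F = Filter.map id F from Filter.map_id.symm]
  change Tendsto id F _
  rw [(fine_withSeminorms A).tendsto_nhds]
  intro q ε hε
  -- By the triangle inequality `q` is at most the `ℓ¹`-seminorm with weights `q (b k)`, so `hlim`
  -- applies to `q`.
  let w : J → NNReal := fun k => ⟨q (b k), apply_nonneg _ _⟩
  obtain ⟨M, hM, h⟩ := hlim w (ε / 2) (half_pos hε)
  filter_upwards [hM] with a ha
  have hq : ∀ u : A, q u ≤ weightedSeminorm w (b.repr u) := fun u => by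
    rw [weightedSeminorm_eq_sum w _ _ subset_rfl]
    conv_lhs => rw [← b.linearCombination_repr u, Finsupp.linearCombination_apply, Finsupp.sum]
    refine (Finset.le_sum_of_subadditive q (map_zero q).le (map_add_le_add q) _ _).trans
      (Finset.sum_le_sum fun k _ => ?_)
    rw [map_smul_eq_mul, mul_comm]
    rfl
  refine lt_of_le_of_lt (hq _) (lt_of_le_of_lt ?_ (half_lt_self hε))
  rw [weightedSeminorm_eq_sum w _ _ subset_rfl]
  refine le_trans (le_of_eq (Finset.sum_congr rfl fun k _ => ?_)) (h a ha _)
  have hX : X k = x k := rfl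
  simp [hX]

end Fine

/-! ### Completions -/

section Completion

open UniformSpace

variable {E : Type*} [AddCommGroup E] [Module ℂ E] [UniformSpace E] [IsUniformAddGroup E]

theorem Seminorm.uniformContinuous_of_continuous' (p : Seminorm ℂ E) (hp : Continuous p) :
    UniformContinuous p := p.uniformContinuous_of_continuousAt_zero hp.continuousAt

variable [UniformContinuousConstSMul ℂ E]

/-- The extension of a continuous seminorm to the completion. -/
def Seminorm.completion (p : Seminorm ℂ E) (hp : Continuous p) : Seminorm ℂ (Completion E) :=
  Seminorm.of (Completion.extension p)
    (fun x y => by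
      have hu := p.uniformContinuous_of_continuous' hp
      induction x, y using Completion.induction_on₂ with
      | hp =>
        exact isClosed_le (Completion.continuous_extension.comp continuous_add)
          ((Completion.continuous_extension.comp continuous_fst).add
            (Completion.continuous_extension.comp continuous_snd))
      | ih x y =>
        rw [← Completion.coe_add, Completion.extension_coe hu, Completion.extension_coe hu,
          Completion.extension_coe hu]
        exact map_add_le_add p x y)
    (fun c x => by
      have hu := p.uniformContinuous_of_continuous' hp
      induction x using Completion.induction_on with
      | hp =>
        exact isClosed_eq (Completion.continuous_extension.comp (continuous_const_smul c))
          (continuous_const.mul Completion.continuous_extension)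
      | ih x =>
        rw [← Completion.coe_smul, Completion.extension_coe hu, Completion.extension_coe hu]
        exact map_smul_eq_mul p c x)

theorem Seminorm.completion_coe (p : Seminorm ℂ E) (hp : Continuous p) (x : E) :
    p.completion hp (x : Completion E) = p x :=
  Completion.extension_coe (p.uniformContinuous_of_continuous' hp) x

theorem Seminorm.continuous_completion (p : Seminorm ℂ E) (hp : Continuous p) :
    Continuous (p.completion hp) := Completion.continuous_extension

/-- The completion is regular, so a neighbourhood of `0` contains a closed one, `V`. A finite
intersection of seminorm balls of `E` maps into `V`; the corresponding open set in the completion is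
contained in the closure of its trace on `E`, hence also in `V`. -/
theorem withSeminorms_completion {κ : Type*} [Nonempty κ] {p : SeminormFamily ℂ E κ}
    (hp : WithSeminorms p) :
    WithSeminorms fun i => (p i).completion (hp.continuous_seminorm i) := by
  rw [SeminormFamily.withSeminorms_iff_nhds_eq_iInf]
  refine le_antisymm (le_iInf fun i => ?_) fun U hU => ?_
  · rw [← tendsto_iff_comap]
    exact ((p i).continuous_completion _).tendsto' 0 0 (map_zero _)
  · obtain ⟨V, hV, hVc, hVU⟩ := exists_mem_nhds_isClosed_subset hU
    have h0 : ((↑) : E → Completion E) ⁻¹' V ∈ 𝓝 (0 : E) :=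
      (Completion.continuous_coe E).continuousAt.preimage_mem_nhds
        (by rwa [Completion.coe_zero])
    obtain ⟨s, r, hr, hs⟩ := (hp.mem_nhds_iff _ _).1 h0
    have hopen : IsOpen (⋂ i ∈ s, {z | (p i).completion (hp.continuous_seminorm i) z < r}) :=
      isOpen_biInter_finset fun i _ => isOpen_lt ((p i).continuous_completion _) continuous_const
    have hsub : (⋂ i ∈ s, {z | (p i).completion (hp.continuous_seminorm i) z < r}) ⊆ V := by
      refine (Completion.denseRange_coe.open_subset_closure_inter hopen).trans
        (closure_minimal ?_ hVc)
      rintro _ ⟨hz, x, rfl⟩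
      apply hs
      rw [Seminorm.mem_ball, sub_zero]
      refine Seminorm.finset_sup_apply_lt hr fun i hi => ?_
      have := Set.mem_iInter₂.1 hz i hi
      rwa [Set.mem_ofPred_eq, Seminorm.completion_coe] at this
    refine mem_of_superset ?_ (hsub.trans hVU)
    refine (biInter_finset_mem s).2 fun i _ => ?_
    refine mem_iInf_of_mem i ⟨Set.Iio r, Iio_mem_nhds hr, fun z hz => hz⟩

end Completion

theorem SeminormedMul.completion {E : Type*} [Ring E] [Algebra ℂ E] [UniformSpace E]
    [IsUniformAddGroup E] [IsTopologicalRing E] [UniformContinuousConstSMul ℂ E]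
    [SeminormedMul E] : SeminormedMul (UniformSpace.Completion E) := by
  have hw := PolynormableSpace.withSeminorms ℂ E
  have : Nonempty {p : Seminorm ℂ E // Continuous p} := ⟨⟨0, continuous_const⟩⟩
  refine SeminormedMul.of_withSeminorms (withSeminorms_completion hw) fun i => ?_
  obtain ⟨q, hq, h⟩ := SeminormedMul.exists_mul_le i.1 i.2
  refine ⟨q.completion hq, q.continuous_completion hq, fun a b => ?_⟩
  induction a, b using UniformSpace.Completion.induction_on₂ with
  | hp =>
    exact isClosed_le ((Seminorm.continuous_completion _ _).comp continuous_mul)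
      (((Seminorm.continuous_completion _ _).comp continuous_fst).mul
        ((Seminorm.continuous_completion _ _).comp continuous_snd))
  | ih a b =>
    rw [← UniformSpace.Completion.coe_mul, Seminorm.completion_coe, Seminorm.completion_coe,
      Seminorm.completion_coe]
    exact h a b

theorem SeminormedMul.of_isInducing {E F : Type*} [NonUnitalRing E] [Module ℂ E]
    [TopologicalSpace E] [NonUnitalRing F] [Module ℂ F] [TopologicalSpace F] [SeminormedMul F]
    (f : E →ₙₐ[ℂ] F) (hf : Topology.IsInducing f) : SeminormedMul E := by
  let g : E →ₗ[ℂ] F := f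
  have hw := PolynormableSpace.withSeminorms ℂ F
  have : Nonempty {p : Seminorm ℂ F // Continuous p} := ⟨⟨0, continuous_const⟩⟩
  have hg : Topology.IsInducing g := hf
  refine SeminormedMul.of_withSeminorms (hg.withSeminorms hw) fun i => ?_
  obtain ⟨q, hq, h⟩ := SeminormedMul.exists_mul_le i.1 i.2
  refine ⟨q.comp g, hq.comp hg.continuous, fun a b => ?_⟩
  have := h (f a) (f b)
  rwa [← map_mul] at this

/-! ### Linear maps on completed projective tensor products -/

namespace ProjTensor

section

variable {E F G : Type*} [Ring E] [Algebra ℂ E] [Ring F] [Algebra ℂ F] [AddCommGroup G]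
  [Module ℂ G]

/-- The linear map on `E ⊗ F` defined by a bilinear map. -/
def lift (B : E →ₗ[ℂ] F →ₗ[ℂ] G) : ProjTensor E F →ₗ[ℂ] G :=
  (TensorProduct.lift B : E ⊗[ℂ] F →ₗ[ℂ] G)

theorem lift_tmul (B : E →ₗ[ℂ] F →ₗ[ℂ] G) (x : E) (y : F) : lift B (tmul x y) = B x y :=
  TensorProduct.lift.tmul x y

/-- Pulled back along `lift B`, a continuous seminorm of `G` becomes one of the seminorms that
define the projective topology. -/
theorem continuous_lift [TopologicalSpace E] [TopologicalSpace F] [TopologicalSpace G]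
    [PolynormableSpace ℂ G] (B : E →ₗ[ℂ] F →ₗ[ℂ] G)
    (h : ∀ r : Seminorm ℂ G, Continuous r → ∃ p : Seminorm ℂ E, Continuous p ∧
      ∃ q : Seminorm ℂ F, Continuous q ∧ ∀ x y, r (B x y) ≤ p x * q y) :
    Continuous (lift B) := by
  refine WithSeminorms.continuous_of_continuous_comp (PolynormableSpace.withSeminorms ℂ G) _
    fun r => ?_
  obtain ⟨p, hp, q, hq, hb⟩ := h r.1 r.2
  exact (withSeminorms E F).continuous_seminorm ⟨r.1.comp (lift B), p, hp, q, hq, fun x y => by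
    have := hb x y
    rwa [← lift_tmul] at this⟩

end

end ProjTensor

section CompletedTensor

variable {E E' F : Type*} [Ring E] [Algebra ℂ E] [TopologicalSpace E] [SeminormedMul E]
  [Ring E'] [Algebra ℂ E'] [TopologicalSpace E'] [SeminormedMul E'] [Ring F] [Algebra ℂ F]

section

variable [TopologicalSpace F] [SeminormedMul F]

instance CompletedTensor.seminormedMul : SeminormedMul (CompletedTensor E F) :=
  SeminormedMul.completion

theorem ctmul_mul_ctmul (x x' : E) (y y' : F) :
    ctmul x y * ctmul x' y' = (ctmul (x * x') (y * y') : CompletedTensor E F) := by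
  change ((ProjTensor.tmul x y : ProjTensor E F) : CompletedTensor E F) *
    (ProjTensor.tmul x' y' : ProjTensor E F) = _
  rw [← Completion.coe_mul, ProjTensor.tmul_mul_tmul]
  rfl

theorem ctmul_sub_left (x x' : E) (y : F) :
    (ctmul (x - x') y : CompletedTensor E F) = ctmul x y - ctmul x' y := by
  change ((ProjTensor.tmul (x - x') y : ProjTensor E F) : CompletedTensor E F) =
    (ProjTensor.tmul x y : ProjTensor E F) - (ProjTensor.tmul x' y : ProjTensor E F)
  rw [← Completion.coe_sub]
  exact congrArg _ (TensorProduct.sub_tmul x x' y)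

theorem ctmul_zero_left (y : F) : (ctmul (0 : E) y : CompletedTensor E F) = 0 := by
  rw [← sub_self (0 : E), ctmul_sub_left, sub_self]

theorem ctmul_one_one : (ctmul (1 : E) (1 : F) : CompletedTensor E F) = 1 := rfl

theorem completedMap_ctmul (φ : E →ₐ[ℂ] E') (hφ : Continuous φ) (x : E) (y : F) :
    completedMap F φ hφ (ctmul x y) = ctmul (φ x) y := by
  change Completion.mapRingHom (projMap F φ).toRingHom (continuous_projMap φ hφ)
    ((ProjTensor.tmul x y : ProjTensor E F) : CompletedTensor E F) = _
  rw [Completion.mapRingHom_coe]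
  exact congrArg _ (projMap_tmul φ x y)

theorem continuous_completedMap (φ : E →ₐ[ℂ] E') (hφ : Continuous φ) :
    Continuous (completedMap F φ hφ) :=
  Completion.continuous_map

/-- The map `T ⊗ id : E ⊗_π F → E' ⊗_π F` induced by a continuous linear map `T : E → E'`. -/
def completedMapL (F : Type*) [Ring F] [Algebra ℂ F] [TopologicalSpace F] [SeminormedMul F]
    (T : E →L[ℂ] E') : CompletedTensor E F →L[ℂ] CompletedTensor E' F :=
  ContinuousLinearMap.completion
    ⟨ProjTensor.lift ((TensorProduct.mk ℂ E' F : E' →ₗ[ℂ] F →ₗ[ℂ] ProjTensor E' F) ∘ₗ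
      (T : E →ₗ[ℂ] E')), by
      refine WithSeminorms.continuous_of_continuous_comp (ProjTensor.withSeminorms E' F) _
        fun r => ?_
      obtain ⟨r, p, hp, q, hq, hr⟩ := r
      refine (ProjTensor.withSeminorms E F).continuous_seminorm
        ⟨r.comp (ProjTensor.lift _), p.comp (T : E →ₗ[ℂ] E'), hp.comp T.continuous, q, hq,
          fun x y => ?_⟩
      rw [Seminorm.comp_apply, ProjTensor.lift_tmul]
      exact hr (T x) y⟩

theorem completedMapL_ctmul (T : E →L[ℂ] E') (x : E) (y : F) :
    completedMapL F T (ctmul x y) = ctmul (T x) y := by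
  change ContinuousLinearMap.completion _
    ((ProjTensor.tmul x y : ProjTensor E F) : CompletedTensor E F) = _
  rw [ContinuousLinearMap.completion_apply_coe]
  exact congrArg _ (ProjTensor.lift_tmul _ x y)

end

variable [UniformSpace F] [SeminormedMul F] [IsUniformAddGroup F]
  [UniformContinuousConstSMul ℂ F] [T2Space F] [CompleteSpace F]

/-- The slice map `φ ⊗ id : E ⊗_π F → F` of a continuous functional `φ`. -/
def slice (F : Type*) [Ring F] [Algebra ℂ F] [UniformSpace F] [SeminormedMul F]
    [IsUniformAddGroup F] [UniformContinuousConstSMul ℂ F] [T2Space F] [CompleteSpace F]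
    (φ : E →L[ℂ] ℂ) : CompletedTensor E F →L[ℂ] F :=
  ContinuousLinearMap.fromCompletion
    ⟨ProjTensor.lift ((LinearMap.lsmul ℂ F).comp (φ : E →ₗ[ℂ] ℂ)), by
      refine ProjTensor.continuous_lift _ fun r hr =>
        ⟨(normSeminorm ℂ ℂ).comp (φ : E →ₗ[ℂ] ℂ), φ.continuous.norm, r, hr, fun x y => ?_⟩
      simp [map_smul_eq_mul]⟩

theorem slice_ctmul (φ : E →L[ℂ] ℂ) (x : E) (y : F) : slice F φ (ctmul x y) = φ x • y := by
  change ContinuousLinearMap.fromCompletion _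
    ((ProjTensor.tmul x y : ProjTensor E F) : CompletedTensor E F) = _
  rw [ContinuousLinearMap.fromCompletion_apply_coe]
  exact ProjTensor.lift_tmul _ x y

end CompletedTensor

/-! ### Structure of generalized Weyl algebras -/

namespace GWA

open Polynomial

variable (σ : ℂ[X] ≃ₐ[ℂ] ℂ[X]) (P : ℂ[X])

instance : T2Space (GWA σ P) := fine_t2Space _
instance : CompleteSpace (GWA σ P) := fine_completeSpace _
instance : ContinuousSMul ℂ (GWA σ P) := (fine_withSeminorms (GWA σ P)).continuousSMul
instance : UniformContinuousConstSMul ℂ (GWA σ P) :=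
  uniformContinuousConstSMul_of_continuousConstSMul ℂ (GWA σ P)

variable {σ P}

theorem mk_freeD (d : ℂ[X]) : mk σ P (freeD d) = ofPoly σ P d :=
  (aeval_algHom_apply (mk σ P) _ d).symm

theorem mk_rel {a b : FreeAlgebra ℂ GWAGen} (h : Rel σ P a b) : mk σ P a = mk σ P b :=
  RingQuot.mkAlgHom_rel ℂ h

theorem x_mul_ofPoly (d : ℂ[X]) : x σ P * ofPoly σ P d = ofPoly σ P (σ d) * x σ P := by
  have h := mk_rel (Rel.x_mul (σ := σ) (P := P) d)
  simp only [map_mul, mk_freeD] at h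
  exact h

theorem y_mul_ofPoly (d : ℂ[X]) : y σ P * ofPoly σ P d = ofPoly σ P (σ.symm d) * y σ P := by
  have h := mk_rel (Rel.y_mul (σ := σ) (P := P) d)
  simp only [map_mul, mk_freeD] at h
  exact h

theorem y_mul_x : y σ P * x σ P = ofPoly σ P P := by
  have h := mk_rel (Rel.y_mul_x (σ := σ) (P := P))
  simp only [map_mul, mk_freeD] at h
  exact h

theorem x_mul_y : x σ P * y σ P = ofPoly σ P (σ P) := by
  have h := mk_rel (Rel.x_mul_y (σ := σ) (P := P))
  simp only [map_mul, mk_freeD] at h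
  exact h

variable (σ P) in
/-- The generator of the component of degree `n`, i.e. `y ^ n` or `x ^ (-n)`. -/
def unit (n : ℤ) : GWA σ P := if 0 ≤ n then y σ P ^ n.toNat else x σ P ^ (-n).toNat

theorem unit_natCast (n : ℕ) : unit σ P n = y σ P ^ n := by simp [unit]

theorem unit_neg_natCast (n : ℕ) : unit σ P (-n) = x σ P ^ n := by
  rcases n with _ | n
  · simp [unit]
  · rw [unit, if_neg (by omega)]
    congr 1

theorem unit_zero : unit σ P 0 = 1 := by simp [unit]

theorem mem_component {n : ℤ} {a : GWA σ P} :
    a ∈ component σ P n ↔ ∃ d, ofPoly σ P d * unit σ P n = a := by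
  simp only [component, Submodule.mem_map, LinearMap.mem_range]
  constructor
  · rintro ⟨_, ⟨d, rfl⟩, rfl⟩
    exact ⟨d, rfl⟩
  · rintro ⟨d, rfl⟩
    exact ⟨_, ⟨d, rfl⟩, rfl⟩

theorem ofPoly_mul_unit_mem (d : ℂ[X]) (n : ℤ) :
    ofPoly σ P d * unit σ P n ∈ component σ P n := mem_component.2 ⟨d, rfl⟩

theorem unit_mem (n : ℤ) : unit σ P n ∈ component σ P n :=
  mem_component.2 ⟨1, by simp⟩

theorem ofPoly_mem (d : ℂ[X]) : ofPoly σ P d ∈ component σ P 0 :=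
  mem_component.2 ⟨d, by simp [unit_zero]⟩

theorem one_mem_component_zero : (1 : GWA σ P) ∈ component σ P 0 := by
  simpa using ofPoly_mem (σ := σ) (P := P) 1

theorem y_mem : y σ P ∈ component σ P 1 := by
  have h := unit_mem (σ := σ) (P := P) (1 : ℕ)
  rwa [unit_natCast, pow_one] at h

theorem x_mem : x σ P ∈ component σ P (-1) := by
  have h := unit_mem (σ := σ) (P := P) (-(1 : ℕ))
  rwa [unit_neg_natCast, pow_one] at h

theorem ofPoly_mul_mem (d : ℂ[X]) {n : ℤ} {a : GWA σ P} (ha : a ∈ component σ P n) :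
    ofPoly σ P d * a ∈ component σ P n := by
  obtain ⟨c, rfl⟩ := mem_component.1 ha
  exact mem_component.2 ⟨d * c, by rw [map_mul, mul_assoc]⟩

/-- After `y` has passed the polynomial, either it extends the power of `y`, or it cancels one
factor `x` through `y x = P`. -/
theorem y_mul_mem {n : ℤ} {a : GWA σ P} (ha : a ∈ component σ P n) :
    y σ P * a ∈ component σ P (n + 1) := by
  obtain ⟨c, rfl⟩ := mem_component.1 ha
  rw [← mul_assoc, y_mul_ofPoly, mul_assoc]
  refine ofPoly_mul_mem _ ?_
  obtain ⟨m, rfl | rfl⟩ := n.eq_nat_or_neg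
  · rw [unit_natCast, ← pow_succ', ← unit_natCast]
    exact_mod_cast unit_mem _
  · rcases m with _ | m
    · simpa [unit_zero] using y_mem
    · rw [unit_neg_natCast, pow_succ', ← mul_assoc, y_mul_x, ← unit_neg_natCast,
        show -((m + 1 : ℕ) : ℤ) + 1 = -(m : ℤ) by push_cast; ring]
      exact ofPoly_mul_unit_mem _ _

theorem x_mul_mem {n : ℤ} {a : GWA σ P} (ha : a ∈ component σ P n) :
    x σ P * a ∈ component σ P (n - 1) := by
  obtain ⟨c, rfl⟩ := mem_component.1 ha
  rw [← mul_assoc, x_mul_ofPoly, mul_assoc]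
  refine ofPoly_mul_mem _ ?_
  obtain ⟨m, rfl | rfl⟩ := n.eq_nat_or_neg
  · rcases m with _ | m
    · simpa [unit_zero] using x_mem
    · rw [unit_natCast, pow_succ', ← mul_assoc, x_mul_y, ← unit_natCast,
        show ((m + 1 : ℕ) : ℤ) - 1 = (m : ℤ) by push_cast; ring]
      exact ofPoly_mul_unit_mem _ _
  · rw [unit_neg_natCast, ← pow_succ', ← unit_neg_natCast,
      show -(m : ℤ) - 1 = -((m + 1 : ℕ) : ℤ) by push_cast; ring]
    exact unit_mem _

/-- Induction on the number of factors `y` or `x` on the left, each of which shifts the degree by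
one. -/
theorem mul_mem_component {m n : ℤ} {a b : GWA σ P} (ha : a ∈ component σ P m)
    (hb : b ∈ component σ P n) : a * b ∈ component σ P (m + n) := by
  obtain ⟨c, rfl⟩ := mem_component.1 ha
  rw [mul_assoc]
  refine ofPoly_mul_mem _ ?_
  obtain ⟨k, rfl | rfl⟩ := m.eq_nat_or_neg
  · rw [unit_natCast]
    induction k with
    | zero => simpa using hb
    | succ k ih =>
      rw [pow_succ', mul_assoc]
      rw [show ((k + 1 : ℕ) : ℤ) + n = k + n + 1 by push_cast; ring]
      exact y_mul_mem (ih (ofPoly_mul_unit_mem c _))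
  · rw [unit_neg_natCast]
    induction k with
    | zero => simpa using hb
    | succ k ih =>
      rw [pow_succ', mul_assoc]
      rw [show -((k + 1 : ℕ) : ℤ) + n = -k + n - 1 by push_cast; ring]
      exact x_mul_mem (ih (ofPoly_mul_unit_mem c _))

-- The sum of the components contains `1` and is stable under left multiplication by the generators,
-- hence by all of `A`.
variable (σ P) in
theorem iSup_component : ⨆ n, component σ P n = ⊤ := by
  have hle : ∀ n, component σ P n ≤ ⨆ n, component σ P n := le_iSup _
  have hgen : ∀ (m : ℤ) (c : GWA σ P), c ∈ component σ P m →
      ∀ w ∈ ⨆ n, component σ P n, c * w ∈ ⨆ n, component σ P n := by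
    intro m c hc w hw
    induction hw using Submodule.iSup_induction' with
    | mem n w hw => exact hle _ (mul_mem_component hc hw)
    | zero => simp
    | add u v _ _ hu hv => rw [mul_add]; exact add_mem hu hv
  have hall : ∀ f : FreeAlgebra ℂ GWAGen, ∀ w ∈ ⨆ n, component σ P n,
      mk σ P f * w ∈ ⨆ n, component σ P n := by
    intro f
    induction f using FreeAlgebra.induction with
    | grade0 r =>
      intro w hw
      rw [AlgHom.commutes, ← Algebra.smul_def]
      exact Submodule.smul_mem _ _ hw
    | grade1 g =>
      cases g with
      | h => exact hgen 0 _ (by simpa [ofPoly] using ofPoly_mem (σ := σ) (P := P) X)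
      | x => exact hgen (-1) _ x_mem
      | y => exact hgen 1 _ y_mem
    | mul f g hf hg => intro w hw; rw [map_mul, mul_assoc]; exact hf _ (hg w hw)
    | add f g hf hg => intro w hw; rw [map_add, add_mul]; exact add_mem (hf w hw) (hg w hw)
  rw [eq_top_iff]
  rintro a -
  obtain ⟨f, rfl⟩ := mk_surjective σ P a
  simpa using hall f 1 (hle 0 one_mem_component_zero)

theorem induction_component {motive : GWA σ P → Prop} (a : GWA σ P)
    (mem : ∀ n, ∀ a ∈ component σ P n, motive a) (zero : motive 0)
    (add : ∀ a b, motive a → motive b → motive (a + b)) : motive a :=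
  Submodule.iSup_induction _ (motive := motive)
    (show a ∈ ⨆ n, component σ P n by rw [iSup_component]; trivial) mem zero add

/-- Homomorphisms out of a generalized Weyl algebra. -/
def lift {R : Type*} [Ring R] [Algebra ℂ R] (δ : ℂ[X] →ₐ[ℂ] R) (xR yR : R)
    (hx : ∀ d, xR * δ d = δ (σ d) * xR) (hy : ∀ d, yR * δ d = δ (σ.symm d) * yR)
    (hyx : yR * xR = δ P) (hxy : xR * yR = δ (σ P)) : GWA σ P →ₐ[ℂ] R :=
  RingQuot.liftAlgHom ℂ ⟨FreeAlgebra.lift ℂ fun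
      | .h => δ X
      | .x => xR
      | .y => yR, by
    have hd : ∀ d : ℂ[X], FreeAlgebra.lift ℂ (fun
        | .h => δ X
        | .x => xR
        | .y => yR) (freeD d) = δ d := fun d => by
      rw [freeD, ← aeval_algHom_apply, FreeAlgebra.lift_ι_apply, aeval_algHom_apply, aeval_X_left,
        AlgHom.id_apply]
    intro a b h
    cases h <;> simp only [map_mul, hd, FreeAlgebra.lift_ι_apply]
    · exact hx _
    · exact hy _
    · exact hyx
    · exact hxy⟩

section Lift

variable {R : Type*} [Ring R] [Algebra ℂ R] (δ : ℂ[X] →ₐ[ℂ] R) (xR yR : R)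
    (hx : ∀ d, xR * δ d = δ (σ d) * xR) (hy : ∀ d, yR * δ d = δ (σ.symm d) * yR)
    (hyx : yR * xR = δ P) (hxy : xR * yR = δ (σ P))

theorem lift_x : lift δ xR yR hx hy hyx hxy (x σ P) = xR :=
  (RingQuot.liftAlgHom_mkAlgHom_apply ℂ _ _ _).trans (FreeAlgebra.lift_ι_apply _ _)

theorem lift_y : lift δ xR yR hx hy hyx hxy (y σ P) = yR :=
  (RingQuot.liftAlgHom_mkAlgHom_apply ℂ _ _ _).trans (FreeAlgebra.lift_ι_apply _ _)

theorem lift_ofPoly (d : ℂ[X]) : lift δ xR yR hx hy hyx hxy (ofPoly σ P d) = δ d := by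
  have h : lift δ xR yR hx hy hyx hxy (mk σ P (FreeAlgebra.ι ℂ GWAGen.h)) = δ X :=
    (RingQuot.liftAlgHom_mkAlgHom_apply ℂ _ _ _).trans (FreeAlgebra.lift_ι_apply _ _)
  rw [ofPoly, ← aeval_algHom_apply, h, aeval_algHom_apply, aeval_X_left, AlgHom.id_apply]

end Lift

/-! ### Normal forms -/

variable (σ P) in
/-- The action of `x` on the free `ℂ[h]`-module with basis `unit n`. -/
def actX : Module.End ℂ (ℤ →₀ ℂ[X]) :=
  Finsupp.lsum ℂ fun n => Finsupp.lsingle (n - 1) ∘ₗ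
    LinearMap.mulLeft ℂ (if n ≤ 0 then 1 else σ P) ∘ₗ σ.toLinearMap

variable (σ P) in
/-- The action of `y` on the free `ℂ[h]`-module with basis `unit n`. -/
def actY : Module.End ℂ (ℤ →₀ ℂ[X]) :=
  Finsupp.lsum ℂ fun n => Finsupp.lsingle (n + 1) ∘ₗ
    LinearMap.mulLeft ℂ (if 0 ≤ n then 1 else P) ∘ₗ σ.symm.toLinearMap

/-- The action of `ℂ[h]` on the free `ℂ[h]`-module with basis `unit n`. -/
def actPoly : ℂ[X] →ₐ[ℂ] Module.End ℂ (ℤ →₀ ℂ[X]) := Algebra.lsmul ℂ ℂ (ℤ →₀ ℂ[X])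

theorem actX_single (n : ℤ) (f : ℂ[X]) :
    actX σ P (Finsupp.single n f) =
      Finsupp.single (n - 1) ((if n ≤ 0 then 1 else σ P) * σ f) := by
  simp [actX]

theorem actY_single (n : ℤ) (f : ℂ[X]) :
    actY σ P (Finsupp.single n f) =
      Finsupp.single (n + 1) ((if 0 ≤ n then 1 else P) * σ.symm f) := by
  simp [actY]

theorem actPoly_single (d : ℂ[X]) (n : ℤ) (f : ℂ[X]) :
    actPoly d (Finsupp.single n f) = Finsupp.single n (d * f) := by
  simp [actPoly]

variable (σ P) in
/-- The representation on the free `ℂ[h]`-module with basis `unit n`. -/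
def rep : GWA σ P →ₐ[ℂ] Module.End ℂ (ℤ →₀ ℂ[X]) :=
  lift actPoly (actX σ P) (actY σ P)
    (fun d => Finsupp.lhom_ext fun n f => by
      simp only [Module.End.mul_apply, actPoly_single, actX_single, map_mul]
      congr 1; ring)
    (fun d => Finsupp.lhom_ext fun n f => by
      simp only [Module.End.mul_apply, actPoly_single, actY_single, map_mul]
      congr 1; ring)
    (Finsupp.lhom_ext fun n f => by
      simp only [Module.End.mul_apply, actPoly_single, actX_single, actY_single, map_mul,
        sub_add_cancel, AlgEquiv.symm_apply_apply]
      congr 1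
      -- The factor `P` appears exactly once: for `n ≤ 0` it comes from `y` acting in degree `n - 1
      -- < 0`, for `n > 0` from `x`, as `σ P` untwisted by the following `y`.
      by_cases h : n ≤ 0
      · rw [if_neg (by omega), if_pos h, map_one, one_mul]
      · rw [if_pos (by omega), if_neg h, one_mul, AlgEquiv.symm_apply_apply])
    (Finsupp.lhom_ext fun n f => by
      simp only [Module.End.mul_apply, actPoly_single, actX_single, actY_single, map_mul,
        add_sub_cancel_right, AlgEquiv.apply_symm_apply]
      congr 1
      by_cases h : 0 ≤ n
      · rw [if_neg (by omega), if_pos h, map_one, one_mul]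
      · rw [if_pos (by omega), if_neg h, one_mul])

variable (σ P) in
/-- The coordinates with respect to the `unit n` over `ℂ[h]`. -/
def normalForm : GWA σ P →ₗ[ℂ] ℤ →₀ ℂ[X] :=
  LinearMap.applyₗ (Finsupp.single 0 1) ∘ₗ (rep σ P).toLinearMap

theorem normalForm_apply (a : GWA σ P) :
    normalForm σ P a = rep σ P a (Finsupp.single 0 1) := rfl

/-- Starting from the basis vector of degree `0`, the powers of `y` or `x` move away from `0`, so no
factor `P` is picked up. The coefficients over `ℂ[h]` are thus well defined, and they measure
degrees in `h` in the proof of closedness. -/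
theorem normalForm_ofPoly_mul_unit (d : ℂ[X]) (n : ℤ) :
    normalForm σ P (ofPoly σ P d * unit σ P n) = Finsupp.single n d := by
  have hx : rep σ P (x σ P) = actX σ P := lift_x ..
  have hy : rep σ P (y σ P) = actY σ P := lift_y ..
  have hd : rep σ P (ofPoly σ P d) = actPoly d := lift_ofPoly ..
  have hu : rep σ P (unit σ P n) (Finsupp.single 0 1) = Finsupp.single n 1 := by
    obtain ⟨m, rfl | rfl⟩ := n.eq_nat_or_neg
    · rw [unit_natCast, map_pow, hy]
      induction m with
      | zero => simp
      | succ m ih => rw [pow_succ', Module.End.mul_apply, ih, actY_single]; simp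
    · rw [unit_neg_natCast, map_pow, hx]
      induction m with
      | zero => simp
      | succ m ih =>
        rw [pow_succ', Module.End.mul_apply, ih, actX_single, if_pos (by omega), map_one, one_mul]
        congr 1
        push_cast; ring
  rw [normalForm_apply, map_mul, Module.End.mul_apply, hu, hd, actPoly_single, mul_one]

end GWA

/-! ### Functionals and shifts -/

namespace SmoothCircle

theorem zpow_zero : zpow 0 = 1 := rfl

theorem zpow_pow (k : ℤ) (n : ℕ) : zpow k ^ n = zpow (n * k) := by
  induction n with
  | zero => simp [zpow_zero]
  | succ n ih =>
    rw [pow_succ, ih, Toeplitz.zpow_mul_zpow]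
    congr 1
    push_cast; ring

/-- Evaluation at the point `1` of the circle. -/
def evalOne : SmoothCircle →L[ℂ] ℂ where
  toFun := fun f => ∑' k, f k
  map_add' := fun f g => (Rapid.summable f).of_norm.tsum_add (Rapid.summable g).of_norm
  map_smul' := fun c f => tsum_mul_left
  cont := by
    let L : SmoothCircle →ₗ[ℂ] ℂ :=
      { toFun := fun f => ∑' k, f k
        map_add' := fun f g => (Rapid.summable f).of_norm.tsum_add (Rapid.summable g).of_norm
        map_smul' := fun c f => tsum_mul_left }
    refine WithSeminorms.continuous_normedSpace_rng ℂ
      (Rapid.withSeminorms (w := circleWeight)) L ⟨{0}, 1, fun f => ?_⟩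
    simp only [Finset.sup_singleton, one_smul, Seminorm.comp_apply, coe_normSeminorm,
      Rapid.seminorm_apply, pow_zero, one_mul]
    exact norm_tsum_le_tsum_norm (Rapid.summable f)

theorem evalOne_zpow (k : ℤ) : evalOne (zpow k) = 1 := by
  change ∑' l, zpow k l = 1
  simp [zpow, Rapid.single_apply]

end SmoothCircle

namespace Toeplitz

/-- The linear section `f ↦ (0, f)` of the symbol map. -/
def ofSymbol : SmoothCircle →L[ℂ] Toeplitz where
  toFun := fun f => ⟨0, f⟩
  map_add' := fun _ _ => Toeplitz.ext (add_zero _).symm rfl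
  map_smul' := fun _ _ => Toeplitz.ext (smul_zero _).symm rfl
  cont := isInducing_toProd.continuous_iff.2 (continuous_const.prodMk continuous_id)

theorem ofSymbol_zpow (k : ℤ) : ofSymbol (SmoothCircle.zpow k) = v k := rfl

/-- The entry `(i, j)` of the compact part. -/
def entry (q : ℕ × ℕ) : Toeplitz →L[ℂ] ℂ where
  toFun := fun t => t.cpt q
  map_add' := fun _ _ => rfl
  map_smul' := fun _ _ => rfl
  cont := by
    let L : Toeplitz →ₗ[ℂ] ℂ :=
      { toFun := fun t => t.cpt q, map_add' := fun _ _ => rfl, map_smul' := fun _ _ => rfl }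
    refine WithSeminorms.continuous_normedSpace_rng ℂ withSeminorms L ⟨{0}, 1, fun t => ?_⟩
    simp only [Finset.sup_singleton, one_smul, Seminorm.comp_apply, coe_normSeminorm,
      seminorm_apply, Rapid.seminorm_apply, pow_zero, one_mul]
    exact (Rapid.norm_le t.cpt q).trans
      (le_add_of_nonneg_right (tsum_nonneg fun _ => norm_nonneg _))

theorem entry_e (q q' : ℕ × ℕ) : entry q (e q'.1 q'.2) = if q = q' then 1 else 0 := rfl

theorem v_zero : v 0 = 1 := rfl

/-- For `n = -l` the correction terms `e r r` have `r < l` and are shifted out of the matrix by `v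
(-1 - l)`; for `n ≥ 0` there is no correction. -/
theorem v_neg_one_mul_v (n : ℤ) : v (-1) * v n = v (-1 + n) := by
  obtain ⟨l, rfl | rfl⟩ := n.eq_nat_or_neg
  · exact v_mul_v_natCast _ _
  · rw [v_mul_v_neg, mul_sub, mul_one, Finset.mul_sum, Finset.sum_eq_zero, sub_zero,
      sub_eq_add_neg]
    intro r hr
    rw [Finset.mem_range] at hr
    rw [v_mul_e, if_neg (by omega)]

/-- Of the correction terms `e r r` with `r ≤ l`, only `r = l` survives the shift by `-l`, and it
lands in row `0`. This is the only way a generator fails to act on the `v n` by a pure shift. -/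
theorem v_one_mul_v_neg (l : ℕ) : v 1 * v (-(l + 1 : ℕ)) = v (-l) - e 0 l := by
  rw [v_mul_v_neg, mul_sub, mul_one, Finset.mul_sum,
    Finset.sum_eq_single_of_mem l (by simp), v_mul_e, if_pos (by omega)]
  · congr 2 <;> omega
  · intro r hr hrl
    rw [Finset.mem_range] at hr
    rw [v_mul_e, if_neg (by omega)]

/-- This is `S^i (1 - S S*) (S*)^j`, where `1 - S S*` is the projection `e 0 0`. It produces matrix
units from the generators. -/
theorem v_mul_v_sub (i j : ℕ) :
    v i * v (-j) - v (i + 1 : ℕ) * v (-(j + 1 : ℕ)) = e i j := by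
  rw [v_mul_v_neg, v_mul_v_neg, show ((i + 1 : ℕ) : ℤ) - (j + 1 : ℕ) = i - j by push_cast; ring,
    ← mul_sub, Finset.sum_range_succ, sub_sub_sub_cancel_left, add_sub_cancel_left, v_mul_e,
    if_pos (by omega)]
  congr 1
  omega

theorem v_one_pow (n : ℕ) : v 1 ^ n = v n := by
  induction n with
  | zero => simp [v_zero]
  | succ n ih =>
    rw [pow_succ, ih]
    exact (v_mul_v_natCast n 1).trans (by congr 1)

theorem v_neg_one_pow (n : ℕ) : v (-1) ^ n = v (-n) := by
  induction n with
  | zero => simp [v_zero]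
  | succ n ih =>
    rw [pow_succ', ih, v_neg_one_mul_v]
    congr 1
    push_cast; ring

end Toeplitz

/-! ### Elementary tensors: powers and symbols -/

section

variable {E F : Type*} [Ring E] [Algebra ℂ E] [TopologicalSpace E] [SeminormedMul E]
  [Ring F] [Algebra ℂ F] [TopologicalSpace F] [SeminormedMul F]

theorem ctmul_pow (x : E) (y : F) (n : ℕ) :
    (ctmul x y : CompletedTensor E F) ^ n = ctmul (x ^ n) (y ^ n) := by
  induction n with
  | zero => simp [ctmul_one_one]
  | succ n ih => rw [pow_succ, ih, ctmul_mul_ctmul, ← pow_succ, ← pow_succ]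

variable (E F) in
/-- The homomorphism `y ↦ 1 ⊗ y`. -/
def ctmulOne : F →ₐ[ℂ] CompletedTensor E F :=
  AlgHom.ofLinearMap (ctmul 1) ctmul_one_one fun a b => by rw [ctmul_mul_ctmul, one_mul]

theorem ctmulOne_apply (y : F) : ctmulOne E F y = ctmul 1 y := rfl

end

theorem symbolTensor_ctmul {B : Type*} [Ring B] [Algebra ℂ B] [TopologicalSpace B]
    [SeminormedMul B] (t : Toeplitz) (b : B) :
    symbolTensor B (ctmul t b) = ctmul t.sym b :=
  completedMap_ctmul _ _ t b

theorem continuous_symbolTensor (B : Type*) [Ring B] [Algebra ℂ B] [TopologicalSpace B]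
    [SeminormedMul B] : Continuous (symbolTensor B) :=
  continuous_completedMap _ _

/-! ### The Toeplitz extension of a generalized Weyl algebra -/

namespace GWA

open Polynomial

variable (σ : ℂ[X] ≃ₐ[ℂ] ℂ[X]) (P : ℂ[X])

/-- The homomorphism `a ↦ z ^ n ⊗ a`, for `a` of degree `n`. -/
def gradedEmbedding : GWA σ P →ₐ[ℂ] CompletedTensor SmoothCircle (GWA σ P) :=
  lift ((ctmulOne SmoothCircle (GWA σ P)).comp (ofPoly σ P))
    (ctmul (SmoothCircle.zpow (-1)) (x σ P)) (ctmul (SmoothCircle.zpow 1) (y σ P))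
    (fun d => by
      simp only [AlgHom.comp_apply, ctmulOne_apply, ctmul_mul_ctmul, one_mul, mul_one,
        x_mul_ofPoly])
    (fun d => by
      simp only [AlgHom.comp_apply, ctmulOne_apply, ctmul_mul_ctmul, one_mul, mul_one,
        y_mul_ofPoly])
    (by
      simp only [AlgHom.comp_apply, ctmulOne_apply, ctmul_mul_ctmul, y_mul_x,
        Toeplitz.zpow_mul_zpow, add_neg_cancel, SmoothCircle.zpow_zero])
    (by
      simp only [AlgHom.comp_apply, ctmulOne_apply, ctmul_mul_ctmul, x_mul_y,
        Toeplitz.zpow_mul_zpow, neg_add_cancel, SmoothCircle.zpow_zero])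

variable {σ P}

theorem gradedEmbedding_of_mem {n : ℤ} {a : GWA σ P} (ha : a ∈ component σ P n) :
    gradedEmbedding σ P a = ctmul (SmoothCircle.zpow n) a := by
  obtain ⟨d, rfl⟩ := mem_component.1 ha
  have hd : gradedEmbedding σ P (ofPoly σ P d) = ctmul 1 (ofPoly σ P d) := lift_ofPoly ..
  have hx : gradedEmbedding σ P (x σ P) = ctmul (SmoothCircle.zpow (-1)) (x σ P) := lift_x ..
  have hy : gradedEmbedding σ P (y σ P) = ctmul (SmoothCircle.zpow 1) (y σ P) := lift_y ..
  have hu : gradedEmbedding σ P (unit σ P n) = ctmul (SmoothCircle.zpow n) (unit σ P n) := by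
    obtain ⟨m, rfl | rfl⟩ := n.eq_nat_or_neg
    · rw [unit_natCast, map_pow, hy, ctmul_pow, SmoothCircle.zpow_pow, mul_one]
    · rw [unit_neg_natCast, map_pow, hx, ctmul_pow, SmoothCircle.zpow_pow, mul_neg_one]
  rw [map_mul, hd, hu, ctmul_mul_ctmul, one_mul]

/-- Evaluation at `1` sends every `z ^ n` to `1`, so it forgets the degree and returns `a`. -/
theorem slice_gradedEmbedding (a : GWA σ P) :
    slice (GWA σ P) SmoothCircle.evalOne (gradedEmbedding σ P a) = a := by
  induction a using induction_component with
  | mem n a ha =>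
    rw [gradedEmbedding_of_mem ha, slice_ctmul, SmoothCircle.evalOne_zpow, one_smul]
  | zero => simp
  | add a b ha hb => rw [map_add, map_add, ha, hb]

variable (σ P)

theorem continuous_gradedEmbedding : Continuous (gradedEmbedding σ P) :=
  fine_continuous_linearMap (GWA σ P) (gradedEmbedding σ P).toLinearMap

theorem isEmbedding_gradedEmbedding : Topology.IsEmbedding (gradedEmbedding σ P) :=
  Function.LeftInverse.isEmbedding (f := slice (GWA σ P) SmoothCircle.evalOne)
    slice_gradedEmbedding (ContinuousLinearMap.continuous _) (continuous_gradedEmbedding σ P)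

/-- With a continuous left inverse at hand, the range is the fixed-point set of a continuous
retraction of a Hausdorff space. -/
theorem isClosed_range_gradedEmbedding : IsClosed (Set.range (gradedEmbedding σ P)) := by
  have h : Set.range (gradedEmbedding σ P) =
      {z | gradedEmbedding σ P (slice (GWA σ P) SmoothCircle.evalOne z) = z} := by
    ext z
    constructor
    · rintro ⟨a, rfl⟩
      exact congrArg _ (slice_gradedEmbedding a)
    · exact fun hz => ⟨_, hz⟩
  rw [h]
  exact isClosed_eq ((continuous_gradedEmbedding σ P).comp (ContinuousLinearMap.continuous _))
    continuous_id

/-- The linear section `a ↦ v n ⊗ a`, for `a` of degree `n`. -/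
def gradedSection : GWA σ P →L[ℂ] CompletedTensor Toeplitz (GWA σ P) :=
  (completedMapL (GWA σ P) Toeplitz.ofSymbol).comp
    ⟨(gradedEmbedding σ P).toLinearMap, continuous_gradedEmbedding σ P⟩

variable {σ P}

theorem gradedSection_of_mem {n : ℤ} {a : GWA σ P} (ha : a ∈ component σ P n) :
    gradedSection σ P a = ctmul (Toeplitz.v n) a := by
  change completedMapL (GWA σ P) Toeplitz.ofSymbol (gradedEmbedding σ P a) = _
  rw [gradedEmbedding_of_mem ha, completedMapL_ctmul, Toeplitz.ofSymbol_zpow]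

theorem symbolTensor_gradedSection (a : GWA σ P) :
    symbolTensor (GWA σ P) (gradedSection σ P a) = gradedEmbedding σ P a := by
  induction a using induction_component with
  | mem n a ha =>
    rw [gradedSection_of_mem ha, gradedEmbedding_of_mem ha, symbolTensor_ctmul]
    rfl
  | zero => simp
  | add a b ha hb => rw [map_add, map_add, map_add, ha, hb]

theorem gradedSection_one : gradedSection σ P 1 = 1 :=
  gradedSection_of_mem one_mem_component_zero

/-! ### Generators and homogeneous elements of the Toeplitz algebra -/

variable (σ P) in
/-- The generators of the Toeplitz algebra of `ℂ[h](σ, P)`. -/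
def toeplitzGens : Set (CompletedTensor Toeplitz (GWA σ P)) :=
  ctmul (1 : Toeplitz) '' (component σ P 0 : Set (GWA σ P)) ∪
    ctmul Toeplitz.S '' (component σ P 1 : Set (GWA σ P)) ∪
    ctmul Toeplitz.Sstar '' (component σ P (-1) : Set (GWA σ P))

theorem adjoin_induction_gens {motive : CompletedTensor Toeplitz (GWA σ P) → Prop}
    (gen : ∀ k : ℤ, (k = 0 ∨ k = 1 ∨ k = -1) → ∀ a ∈ component σ P k,
      motive (ctmul (Toeplitz.v k) a))
    (algebraMap : ∀ c, motive (algebraMap ℂ _ c))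
    (add : ∀ s t, motive s → motive t → motive (s + t))
    (mul : ∀ s t, motive s → motive t → motive (s * t))
    {t : CompletedTensor Toeplitz (GWA σ P)}
    (ht : t ∈ Algebra.adjoin ℂ (toeplitzGens σ P)) : motive t := by
  induction ht using Algebra.adjoin_induction with
  | mem t ht =>
    rcases ht with (⟨a, ha, rfl⟩ | ⟨a, ha, rfl⟩) | ⟨a, ha, rfl⟩
    · exact gen 0 (by simp) a ha
    · exact gen 1 (by simp) a ha
    · exact gen (-1) (by simp) a ha
  | algebraMap c => exact algebraMap c
  | add s t _ _ hs ht => exact add s t hs ht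
  | mul s t _ _ hs ht => exact mul s t hs ht

/-- The tensor factors as `1 ⊗ d` times a power of `S ⊗ y` or of `S* ⊗ x`. -/
theorem ctmul_v_mem {n : ℤ} {a : GWA σ P} (ha : a ∈ component σ P n) :
    ctmul (Toeplitz.v n) a ∈ toeplitzOf (component σ P) := by
  refine Subalgebra.le_topologicalClosure _ ?_
  obtain ⟨d, rfl⟩ := mem_component.1 ha
  change _ ∈ Algebra.adjoin ℂ (toeplitzGens σ P)
  have hd : ctmul (1 : Toeplitz) (ofPoly σ P d) ∈ Algebra.adjoin ℂ (toeplitzGens σ P) :=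
    Algebra.subset_adjoin (Or.inl (Or.inl ⟨_, ofPoly_mem d, rfl⟩))
  have hy : ctmul (Toeplitz.v 1) (y σ P) ∈ Algebra.adjoin ℂ (toeplitzGens σ P) :=
    Algebra.subset_adjoin (Or.inl (Or.inr ⟨_, y_mem, rfl⟩))
  have hx : ctmul (Toeplitz.v (-1)) (x σ P) ∈ Algebra.adjoin ℂ (toeplitzGens σ P) :=
    Algebra.subset_adjoin (Or.inr ⟨_, x_mem, rfl⟩)
  rw [← one_mul (Toeplitz.v n), ← ctmul_mul_ctmul]
  refine mul_mem hd ?_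
  obtain ⟨m, rfl | rfl⟩ := n.eq_nat_or_neg
  · rw [unit_natCast, ← Toeplitz.v_one_pow, ← ctmul_pow]
    exact Subalgebra.pow_mem _ hy _
  · rw [unit_neg_natCast, ← Toeplitz.v_neg_one_pow, ← ctmul_pow]
    exact Subalgebra.pow_mem _ hx _

theorem gradedSection_mem (a : GWA σ P) : gradedSection σ P a ∈ toeplitzOf (component σ P) := by
  induction a using induction_component with
  | mem n a ha => rw [gradedSection_of_mem ha]; exact ctmul_v_mem ha
  | zero => rw [map_zero]; exact zero_mem _
  | add a b ha hb => rw [map_add]; exact add_mem ha hb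

theorem isClosed_toeplitzOf :
    IsClosed (toeplitzOf (component σ P) : Set (CompletedTensor Toeplitz (GWA σ P))) :=
  Subalgebra.isClosed_topologicalClosure _

/-! ### The closed sum as an ideal of the Toeplitz algebra -/

theorem isClosed_lambdaOf :
    IsClosed (lambdaOf (component σ P) : Set (CompletedTensor Toeplitz (GWA σ P))) :=
  Submodule.isClosed_topologicalClosure _

theorem lambdaAlg_le_lambdaOf : lambdaAlg (component σ P) ≤ lambdaOf (component σ P) :=
  Submodule.le_topologicalClosure _

theorem ctmul_e_mem_lambdaAlg {i j : ℕ} {a b : GWA σ P} (ha : a ∈ component σ P (i + 1))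
    (hb : b ∈ component σ P (-(j + 1))) :
    ctmul (Toeplitz.e i j) (a * b) ∈ lambdaAlg (component σ P) :=
  le_iSup (lambdaPiece (component σ P)) (i, j)
    (Submodule.mem_map_of_mem (Submodule.mul_mem_mul ha hb))

theorem lambdaAlg_induction {motive : CompletedTensor Toeplitz (GWA σ P) → Prop}
    (ctmul : ∀ (i j : ℕ), ∀ a ∈ component σ P (i + 1), ∀ b ∈ component σ P (-(j + 1)),
      motive (ctmul (Toeplitz.e i j) (a * b)))
    (zero : motive 0) (add : ∀ s t, motive s → motive t → motive (s + t))
    {t : CompletedTensor Toeplitz (GWA σ P)} (ht : t ∈ lambdaAlg (component σ P)) : motive t := by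
  refine Submodule.iSup_induction _ (motive := motive) ht ?_ zero add
  rintro ⟨i, j⟩ _ ⟨c, hc, rfl⟩
  refine Submodule.mul_induction_on (C := fun c => motive (_root_.ctmul (Toeplitz.e i j) c)) hc
    (fun a ha b hb => ctmul i j a ha b hb) fun a b ha hb => ?_
  rw [map_add]
  exact add _ _ ha hb

/-- Substituting `e i j = v i v (-j) - v (i+1) v (-(j+1))` splits `e i j ⊗ a b` into two terms, each
of which factors into homogeneous elements of the Toeplitz algebra. -/
theorem lambdaAlg_le_toeplitzOf :
    lambdaAlg (component σ P) ≤ (toeplitzOf (component σ P)).toSubmodule := by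
  intro t ht
  refine lambdaAlg_induction (motive := (· ∈ toeplitzOf (component σ P)))
    ?_ (zero_mem _) (fun _ _ => add_mem) ht
  · intro i j a ha b hb
    obtain ⟨d, rfl⟩ := mem_component.1 ha
    rw [← Toeplitz.v_mul_v_sub, ctmul_sub_left]
    refine sub_mem ?_ ?_
    -- One factor `y` moves from `a` to `b`, so that the two factors have degrees `i` and `-j`, as
    -- required by `v i` and `v (-j)`.
    · have h : ofPoly σ P d * unit σ P (i + 1) * b =
          (ofPoly σ P d * unit σ P i) * (y σ P * b) := by
        rw [show ((i : ℤ) + 1) = (i + 1 : ℕ) by push_cast; ring, unit_natCast, unit_natCast,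
          pow_succ]
        simp only [mul_assoc]
      have h2 : y σ P * b ∈ component σ P (-j) := by
        have := y_mul_mem hb
        rwa [show -((j : ℤ) + 1) + 1 = -j by ring] at this
      rw [h, ← ctmul_mul_ctmul]
      exact mul_mem (ctmul_v_mem (ofPoly_mul_unit_mem d _)) (ctmul_v_mem h2)
    · rw [← ctmul_mul_ctmul]
      refine mul_mem (ctmul_v_mem (by exact_mod_cast ha)) (ctmul_v_mem ?_)
      exact_mod_cast hb

theorem lambdaOf_le_toeplitzOf :
    lambdaOf (component σ P) ≤ (toeplitzOf (component σ P)).toSubmodule :=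
  Submodule.topologicalClosure_minimal _ lambdaAlg_le_toeplitzOf isClosed_toeplitzOf

/-- Multiplication by `v k` moves row `i` to `i + k`, or column `j` to `j - k`, in step with the
degree of the neighbouring factor; an index that would become negative gives `0`. -/
theorem ctmul_v_mul_mem_lambdaAlg (k : ℤ) {a : GWA σ P} (ha : a ∈ component σ P k)
    {u : CompletedTensor Toeplitz (GWA σ P)} (hu : u ∈ lambdaAlg (component σ P)) :
    ctmul (Toeplitz.v k) a * u ∈ lambdaAlg (component σ P) ∧
      u * ctmul (Toeplitz.v k) a ∈ lambdaAlg (component σ P) := by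
  refine lambdaAlg_induction
    (motive := fun u => ctmul (Toeplitz.v k) a * u ∈ lambdaAlg (component σ P) ∧
      u * ctmul (Toeplitz.v k) a ∈ lambdaAlg (component σ P)) ?_ (by simp) ?_ hu
  rotate_left
  · intro s t hs ht
    rw [mul_add, add_mul]
    exact ⟨add_mem hs.1 ht.1, add_mem hs.2 ht.2⟩
  · intro i j b hb c hc
    rw [ctmul_mul_ctmul, ctmul_mul_ctmul, Toeplitz.v_mul_e, Toeplitz.e_mul_v, ← mul_assoc,
      mul_assoc b]
    constructor
    · split_ifs with h
      · refine ctmul_e_mem_lambdaAlg ?_ hc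
        rw [show (((i + k).toNat : ℕ) : ℤ) + 1 = k + (i + 1) by omega]
        exact mul_mem_component ha hb
      · rw [ctmul_zero_left]; exact zero_mem _
    · split_ifs with h
      · refine ctmul_e_mem_lambdaAlg hb ?_
        rw [show -((((j - k).toNat : ℕ) : ℤ) + 1) = -(j + 1) + k by omega]
        exact mul_mem_component hc ha
      · rw [ctmul_zero_left]; exact zero_mem _

/-- The algebraic sum is stable under the subalgebra generated by the generators, and joint
continuity of the product carries this to both closures. -/
theorem mul_mem_lambdaOf {t u : CompletedTensor Toeplitz (GWA σ P)}
    (ht : t ∈ toeplitzOf (component σ P)) (hu : u ∈ lambdaOf (component σ P)) :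
    t * u ∈ lambdaOf (component σ P) ∧ u * t ∈ lambdaOf (component σ P) := by
  have key : ∀ t ∈ Algebra.adjoin ℂ (toeplitzGens σ P),
      ∀ u ∈ lambdaAlg (component σ P),
        t * u ∈ lambdaAlg (component σ P) ∧ u * t ∈ lambdaAlg (component σ P) := by
    intro t ht
    refine adjoin_induction_gens (motive := fun t => ∀ u ∈ lambdaAlg (component σ P),
        t * u ∈ lambdaAlg (component σ P) ∧ u * t ∈ lambdaAlg (component σ P))
      (fun k _ a ha u hu => ctmul_v_mul_mem_lambdaAlg k ha hu) ?_ ?_ ?_ ht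
    · intro c u hu
      rw [← Algebra.commutes, and_self, ← Algebra.smul_def]
      exact Submodule.smul_mem _ _ hu
    · intro s t hs ht u hu
      rw [mul_add, add_mul]
      exact ⟨add_mem (hs u hu).1 (ht u hu).1, add_mem (hs u hu).2 (ht u hu).2⟩
    · intro s t hs ht u hu
      rw [mul_assoc, ← mul_assoc u]
      exact ⟨(hs _ (ht u hu).1).1, (ht _ (hs u hu).2).2⟩
  exact ⟨map_mem_closure₂ continuous_mul ht hu fun t ht u hu => (key t ht u hu).1,
    map_mem_closure₂ continuous_mul hu ht fun u hu t ht => (key t ht u hu).2⟩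

/-! ### Kernel and image of the symbol map -/

theorem symbolTensor_eq_zero_of_mem_lambdaOf {u : CompletedTensor Toeplitz (GWA σ P)}
    (hu : u ∈ lambdaOf (component σ P)) : symbolTensor (GWA σ P) u = 0 := by
  have h : lambdaOf (component σ P) ≤ LinearMap.ker (symbolTensor (GWA σ P)).toLinearMap := by
    refine Submodule.topologicalClosure_minimal _ (fun t ht => ?_)
      (isClosed_singleton.preimage (continuous_symbolTensor _))
    refine lambdaAlg_induction
      (motive := (· ∈ LinearMap.ker (symbolTensor (GWA σ P)).toLinearMap))
      (fun i j a _ b _ => ?_) (zero_mem _) (fun _ _ => add_mem) ht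
    · change symbolTensor (GWA σ P) _ = 0
      rw [symbolTensor_ctmul]
      exact ctmul_zero_left _
  exact h hu

/-- Each generator `v k ⊗ a` has symbol `j a`. As the range of `j` is a closed subalgebra, its
preimage contains the closed subalgebra generated. -/
theorem symbolTensor_mem_range {t : CompletedTensor Toeplitz (GWA σ P)}
    (ht : t ∈ toeplitzOf (component σ P)) :
    symbolTensor (GWA σ P) t ∈ (gradedEmbedding σ P).range := by
  have h : toeplitzOf (component σ P) ≤
      (gradedEmbedding σ P).range.comap (symbolTensor (GWA σ P)) := by
    refine Subalgebra.topologicalClosure_minimal (fun t ht => ?_)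
      ((isClosed_range_gradedEmbedding σ P).preimage (continuous_symbolTensor _))
    refine adjoin_induction_gens
      (motive := (· ∈ (gradedEmbedding σ P).range.comap (symbolTensor (GWA σ P))))
      (fun k _ a ha => ?_) (Subalgebra.algebraMap_mem _) (fun _ _ => add_mem)
      (fun _ _ => mul_mem) ht
    · refine ⟨a, ?_⟩
      change gradedEmbedding σ P a = symbolTensor (GWA σ P) _
      rw [gradedEmbedding_of_mem ha, symbolTensor_ctmul]
      rfl
  exact h ht

/-- The section is multiplicative on these products up to one rank-one matrix unit, which occurs
only when `S` meets a negative degree. -/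
theorem ctmul_v_mul_gradedSection_mem {k : ℤ} (hk : k = 0 ∨ k = 1 ∨ k = -1) {a : GWA σ P}
    (ha : a ∈ component σ P k) (b : GWA σ P) :
    ctmul (Toeplitz.v k) a * gradedSection σ P b ∈
      LinearMap.range (gradedSection σ P : GWA σ P →ₗ[ℂ] _) ⊔ lambdaAlg (component σ P) := by
  induction b using induction_component with
  | zero => simp
  | add b c hb hc => rw [map_add, mul_add]; exact add_mem hb hc
  | mem n b hb =>
    rw [gradedSection_of_mem hb, ctmul_mul_ctmul]
    have hab := mul_mem_component ha hb
    have hsec : ctmul (Toeplitz.v (k + n)) (a * b) ∈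
        LinearMap.range (gradedSection σ P : GWA σ P →ₗ[ℂ] _) :=
      ⟨a * b, gradedSection_of_mem hab⟩
    rcases hk with rfl | rfl | rfl
    · rw [zero_add] at hsec
      rw [Toeplitz.v_zero, one_mul]
      exact Submodule.mem_sup_left hsec
    · obtain ⟨l, rfl | rfl⟩ := n.eq_nat_or_neg
      · rw [Toeplitz.v_mul_v_natCast]
        exact Submodule.mem_sup_left hsec
      · rcases l with _ | l
        · rw [Nat.cast_zero, neg_zero, Toeplitz.v_zero, mul_one]
          exact Submodule.mem_sup_left hsec
        · rw [show (1 : ℤ) + -(l + 1 : ℕ) = -l by push_cast; ring] at hsec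
          -- The error is `e 0 l ⊗ a b` with `a` in `A_1` and `b` in `A_{-(l+1)}`, an element of the
          -- summand with index `(0, l)`.
          rw [Toeplitz.v_one_mul_v_neg, ctmul_sub_left]
          refine sub_mem (Submodule.mem_sup_left hsec) (Submodule.mem_sup_right ?_)
          refine ctmul_e_mem_lambdaAlg (by simpa using ha) ?_
          exact_mod_cast hb
    · rw [Toeplitz.v_neg_one_mul_v]
      exact Submodule.mem_sup_left hsec

theorem adjoin_le_range_sup_lambdaAlg {t : CompletedTensor Toeplitz (GWA σ P)}
    (ht : t ∈ Algebra.adjoin ℂ (toeplitzGens σ P)) :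
    t ∈ LinearMap.range (gradedSection σ P : GWA σ P →ₗ[ℂ] _) ⊔ lambdaAlg (component σ P) := by
  -- The induction runs on stability under left multiplication, which passes to products; membership
  -- of `t` is the case `w = 1 = s 1`.
  suffices h : ∀ w ∈ LinearMap.range (gradedSection σ P : GWA σ P →ₗ[ℂ] _) ⊔
      lambdaAlg (component σ P), t * w ∈
        LinearMap.range (gradedSection σ P : GWA σ P →ₗ[ℂ] _) ⊔ lambdaAlg (component σ P) by
    simpa using h 1 (Submodule.mem_sup_left ⟨1, gradedSection_one⟩)
  refine adjoin_induction_gens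
    (motive := fun t => ∀ w ∈ LinearMap.range (gradedSection σ P : GWA σ P →ₗ[ℂ] _) ⊔
      lambdaAlg (component σ P), t * w ∈
        LinearMap.range (gradedSection σ P : GWA σ P →ₗ[ℂ] _) ⊔ lambdaAlg (component σ P))
    ?_ ?_ ?_ ?_ ht
  · intro k hk a ha w hw
    obtain ⟨_, ⟨b, rfl⟩, u, hu, rfl⟩ := Submodule.mem_sup.1 hw
    rw [mul_add]
    exact add_mem (ctmul_v_mul_gradedSection_mem hk ha b)
      (Submodule.mem_sup_right (ctmul_v_mul_mem_lambdaAlg k ha hu).1)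
  · intro c w hw
    rw [← Algebra.smul_def]
    exact Submodule.smul_mem _ _ hw
  · intro s t hs ht w hw
    rw [add_mul]
    exact add_mem (hs w hw) (ht w hw)
  · intro s t hs ht w hw
    rw [mul_assoc]
    exact hs _ (ht w hw)

/-- The Toeplitz algebra is the sum of the section and of the kernel. -/
theorem sub_gradedSection_mem_lambdaOf {t : CompletedTensor Toeplitz (GWA σ P)}
    (ht : t ∈ toeplitzOf (component σ P)) :
    t - gradedSection σ P (slice (GWA σ P) SmoothCircle.evalOne (symbolTensor (GWA σ P) t)) ∈
      lambdaOf (component σ P) := by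
  have hc : Continuous fun t => t - gradedSection σ P
      (slice (GWA σ P) SmoothCircle.evalOne (symbolTensor (GWA σ P) t)) :=
    continuous_id.sub ((gradedSection σ P).continuous.comp
      ((slice (GWA σ P) SmoothCircle.evalOne).continuous.comp (continuous_symbolTensor _)))
  -- The condition is closed in `t`, so it is enough to take `t = s b + u` with `u` in the algebraic
  -- sum, where the difference is `u`.
  refine closure_minimal (fun t ht => ?_) (isClosed_lambdaOf.preimage hc) ht
  obtain ⟨_, ⟨b, rfl⟩, u, hu, rfl⟩ := Submodule.mem_sup.1 (adjoin_le_range_sup_lambdaAlg ht)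
  have hmem := lambdaAlg_le_lambdaOf hu
  change gradedSection σ P b + u - gradedSection σ P (slice (GWA σ P) SmoothCircle.evalOne
    (symbolTensor (GWA σ P) (gradedSection σ P b + u))) ∈ lambdaOf (component σ P)
  rw [map_add, symbolTensor_eq_zero_of_mem_lambdaOf hmem, add_zero, symbolTensor_gradedSection,
    slice_gradedEmbedding, add_sub_cancel_left]
  exact hmem

end GWA

/-! ### Matrix entries -/

theorem Rapid.seminorm_mono {ι : Type*} {w : ι → ℕ} (hw : ∀ i, 1 ≤ w i) {m n : ℕ} (h : m ≤ n)
    (a : Rapid w) : Rapid.seminorm w m a ≤ Rapid.seminorm w n a := by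
  refine Summable.tsum_le_tsum (fun i => ?_) (a.rapid m) (a.rapid n)
  have : (1 : ℝ) ≤ w i := by exact_mod_cast hw i
  gcongr

namespace Toeplitz

theorem seminorm_mono {m n : ℕ} (h : m ≤ n) (t : Toeplitz) : seminorm m t ≤ seminorm n t :=
  add_le_add (Rapid.seminorm_mono (fun q => by simp [matrixWeight, add_assoc]) h t.cpt)
    (Rapid.seminorm_mono (fun q => by simp [circleWeight]) h t.sym)

/-- The seminorms increase with `n`, so a finite supremum is dominated by the one of largest index.
-/
theorem exists_le_seminorm (p : Seminorm ℂ Toeplitz) (hp : Continuous p) :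
    ∃ (n : ℕ) (C : NNReal), ∀ t, p t ≤ C * seminorm n t := by
  obtain ⟨s, C, -, hC⟩ := Seminorm.bound_of_continuous withSeminorms p hp
  refine ⟨s.sup id, C, fun t => (hC t).trans ?_⟩
  change (C : ℝ) * s.sup seminorm t ≤ _
  gcongr
  exact Seminorm.finset_sup_apply_le (apply_nonneg _ _) fun i hi =>
    seminorm_mono (Finset.le_sup (f := id) hi) t

theorem seminorm_e (n : ℕ) (q : ℕ × ℕ) : seminorm n (e q.1 q.2) = (matrixWeight q : ℝ) ^ n := by
  have h1 : Rapid.seminorm circleWeight n (e q.1 q.2).sym = 0 := map_zero _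
  have h2 : ∀ r, (e q.1 q.2).cpt r = if r = q then 1 else 0 := fun r => rfl
  rw [seminorm_apply, h1, add_zero, Rapid.seminorm_apply,
    tsum_eq_single q fun r hr => by rw [h2, if_neg hr, norm_zero, mul_zero], h2]
  simp

theorem sum_entry_le_seminorm (n : ℕ) (s : Finset (ℕ × ℕ)) (t : Toeplitz) :
    ∑ k ∈ s, (matrixWeight k : ℝ) ^ n * ‖entry k t‖ ≤ seminorm n t :=
  ((t.cpt.rapid n).sum_le_tsum s fun _ _ => by positivity).trans
    (le_add_of_nonneg_right (apply_nonneg _ _))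

end Toeplitz

section Entries

variable {F : Type*} [Ring F] [Algebra ℂ F] [UniformSpace F]

theorem ProjTensor.continuous_proj {E F : Type*} [Ring E] [Algebra ℂ E] [Ring F] [Algebra ℂ F]
    [TopologicalSpace E] [TopologicalSpace F] {p : Seminorm ℂ E} (hp : Continuous p)
    {q : Seminorm ℂ F} (hq : Continuous q) : Continuous (ProjTensor.proj p q) :=
  (ProjTensor.withSeminorms E F).continuous_seminorm
    ⟨ProjTensor.proj p q, p, hp, q, hq, ProjTensor.proj_tmul_le p q⟩

/-- The continuous seminorm on `𝒯 ⊗_π F` defined by the `n`-th seminorm of `𝒯` and a continuous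
seminorm of `F`. -/
def toeplitzProj (n : ℕ) (q : Seminorm ℂ F) (hq : Continuous q) :
    Seminorm ℂ (CompletedTensor Toeplitz F) :=
  (ProjTensor.proj (Toeplitz.seminorm n) q).completion
    (ProjTensor.continuous_proj (Toeplitz.continuous_seminorm n) hq)

theorem continuous_toeplitzProj (n : ℕ) (q : Seminorm ℂ F) (hq : Continuous q) :
    Continuous (toeplitzProj n q hq) := Seminorm.continuous_completion _ _

theorem toeplitzProj_ctmul_le [SeminormedMul F] (n : ℕ) (q : Seminorm ℂ F) (hq : Continuous q)
    (t : Toeplitz) (a : F) : toeplitzProj n q hq (ctmul t a) ≤ Toeplitz.seminorm n t * q a := by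
  change toeplitzProj n q hq
    ((ProjTensor.tmul t a : ProjTensor Toeplitz F) : CompletedTensor Toeplitz F) ≤ _
  rw [toeplitzProj, Seminorm.completion_coe]
  exact ProjTensor.proj_tmul_le _ _ t a

/-- The seminorms `toeplitzProj n q` separate the points of `𝒯 ⊗_π F`. -/
theorem eq_zero_of_toeplitzProj_eq_zero {z : CompletedTensor Toeplitz F}
    (h : ∀ n q hq, toeplitzProj n q hq z = 0) : z = 0 := by
  by_contra hz
  obtain ⟨⟨r, p, hp, q, hq, hr⟩, hrz⟩ :=
    (withSeminorms_completion (ProjTensor.withSeminorms Toeplitz F)).separating_of_T1 z hz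
  obtain ⟨n, C, hC⟩ := Toeplitz.exists_le_seminorm p hp
  -- The constant from `p ≤ C * seminorm n` is absorbed in the second factor, so that `r` is
  -- dominated by `toeplitzProj n (C • q)`.
  have hq' : Continuous (C • q : Seminorm ℂ F) := continuous_const.mul hq
  refine hrz (le_antisymm ?_ (apply_nonneg _ _))
  rw [← h n (C • q) hq']
  clear hrz h hz
  induction z using Completion.induction_on with
  | hp => exact isClosed_le (Seminorm.continuous_completion _ _) (continuous_toeplitzProj _ _ _)
  | ih z =>
    rw [toeplitzProj, Seminorm.completion_coe, Seminorm.completion_coe]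
    refine ProjTensor.le_proj (fun x y => (hr x y).trans ?_) z
    change p x * q y ≤ Toeplitz.seminorm n x * (C * q y)
    calc p x * q y ≤ (C * Toeplitz.seminorm n x) * q y := by gcongr; exact hC x
      _ = _ := by ring

variable [SeminormedMul F] [IsUniformAddGroup F] [UniformContinuousConstSMul ℂ F] [T2Space F]
  [CompleteSpace F]

theorem slice_entry_ctmul_e (k l : ℕ × ℕ) (a : F) :
    slice F (Toeplitz.entry k) (ctmul (Toeplitz.e l.1 l.2) a) = if k = l then a else 0 := by
  rw [slice_ctmul, Toeplitz.entry_e]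
  split_ifs <;> simp

/-- The left side is a seminorm in `z`, bounded on `t ⊗ a` by `seminorm n t * q a`; the projective
seminorm is the largest with this bound, and density does the rest. Since `toeplitzProj_ctmul_le`
gives the opposite estimate on finite sums of `e i j ⊗ a`, the seminorm is there the weighted
`ℓ¹`-norm of the entries. -/
theorem sum_slice_entry_le (n : ℕ) (q : Seminorm ℂ F) (hq : Continuous q) (s : Finset (ℕ × ℕ))
    (z : CompletedTensor Toeplitz F) :
    ∑ k ∈ s, (matrixWeight k : ℝ) ^ n * q (slice F (Toeplitz.entry k) z) ≤
      toeplitzProj n q hq z := by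
  induction z using Completion.induction_on with
  | hp =>
    refine isClosed_le (continuous_finsetSum s fun k _ => continuous_const.mul
      (hq.comp (ContinuousLinearMap.continuous _))) (continuous_toeplitzProj _ _ _)
  | ih z =>
    rw [toeplitzProj, Seminorm.completion_coe]
    let r : Seminorm ℂ (ProjTensor Toeplitz F) := Seminorm.of
      (fun z => ∑ k ∈ s, (matrixWeight k : ℝ) ^ n *
        q (slice F (Toeplitz.entry k) (z : CompletedTensor Toeplitz F)))
      (fun x y => by
        rw [← Finset.sum_add_distrib]
        refine Finset.sum_le_sum fun k _ => ?_
        rw [← mul_add, Completion.coe_add, map_add]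
        gcongr
        exact map_add_le_add q _ _)
      (fun c x => by
        rw [Finset.mul_sum]
        refine Finset.sum_congr rfl fun k _ => ?_
        rw [Completion.coe_smul, map_smul, map_smul_eq_mul]
        ring)
    refine ProjTensor.le_proj (r := r) (fun t a => ?_) z
    change ∑ k ∈ s, (matrixWeight k : ℝ) ^ n *
      q (slice F (Toeplitz.entry k) (ctmul t a)) ≤ _
    refine le_trans (le_of_eq ?_)
      (mul_le_mul_of_nonneg_right (Toeplitz.sum_entry_le_seminorm n s t) (apply_nonneg q a))
    rw [Finset.sum_mul]
    refine Finset.sum_congr rfl fun k _ => ?_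
    rw [slice_ctmul, map_smul_eq_mul, mul_assoc]

end Entries

/-! ### Directness and closedness of the sum -/

namespace GWA

open Polynomial

variable {σ : ℂ[X] ≃ₐ[ℂ] ℂ[X]} {P : ℂ[X]}

/-- The slice at the entry `k` recovers `a` from `e k ⊗ a` and kills all other summands. -/
theorem iSupIndep_lambdaPiece : iSupIndep (lambdaPiece (component σ P)) := by
  rw [iSupIndep_def]
  intro k
  rw [Submodule.disjoint_def]
  rintro _ ⟨a, -, rfl⟩ hx
  have hker : (⨆ (l) (_ : l ≠ k), lambdaPiece (component σ P) l) ≤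
      LinearMap.ker (slice (GWA σ P) (Toeplitz.entry k) :
        CompletedTensor Toeplitz (GWA σ P) →ₗ[ℂ] GWA σ P) := by
    refine iSup₂_le fun l hl => ?_
    rintro _ ⟨b, -, rfl⟩
    change slice (GWA σ P) (Toeplitz.entry k) (ctmul (Toeplitz.e l.1 l.2) b) = 0
    rw [slice_entry_ctmul_e, if_neg hl.symm]
  have h : slice (GWA σ P) (Toeplitz.entry k) (ctmul (Toeplitz.e k.1 k.2) a) = 0 := hker hx
  rw [slice_entry_ctmul_e, if_pos rfl] at h
  rw [h, map_zero]

/-- Allowing every larger index set lets two elements share one set, which makes the property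
additive. -/
theorem exists_eq_sum_slice {t : CompletedTensor Toeplitz (GWA σ P)}
    (ht : t ∈ lambdaAlg (component σ P)) : ∃ s : Finset (ℕ × ℕ), ∀ s', s ⊆ s' →
      ∑ k ∈ s', ctmul (Toeplitz.e k.1 k.2) (slice (GWA σ P) (Toeplitz.entry k) t) = t := by
  classical
  refine lambdaAlg_induction (motive := fun t => ∃ s : Finset (ℕ × ℕ), ∀ s', s ⊆ s' →
      ∑ k ∈ s', ctmul (Toeplitz.e k.1 k.2) (slice (GWA σ P) (Toeplitz.entry k) t) = t)
    ?_ ⟨∅, by simp⟩ ?_ ht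
  · intro i j a _ b _
    refine ⟨{(i, j)}, fun s' hs => ?_⟩
    rw [Finset.sum_eq_single_of_mem (i, j) (hs (by simp)),
      slice_entry_ctmul_e (i, j) (i, j), if_pos rfl]
    intro k _ hk
    rw [slice_entry_ctmul_e k (i, j), if_neg hk, map_zero]
  · rintro t u ⟨s₁, h₁⟩ ⟨s₂, h₂⟩
    refine ⟨s₁ ∪ s₂, fun s' hs => ?_⟩
    simp only [map_add, Finset.sum_add_distrib]
    rw [h₁ s' (Finset.union_subset_left hs), h₂ s' (Finset.union_subset_right hs)]

/-- Elements of the closed sum are determined by their entries. -/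
theorem eq_zero_of_slice_eq_zero {z : CompletedTensor Toeplitz (GWA σ P)}
    (hz : z ∈ lambdaOf (component σ P))
    (h : ∀ k, slice (GWA σ P) (Toeplitz.entry k) z = 0) : z = 0 := by
  refine eq_zero_of_toeplitzProj_eq_zero fun n q hq =>
    le_antisymm (le_of_forall_pos_le_add fun ε hε => ?_) (apply_nonneg _ _)
  have hopen : IsOpen {y | toeplitzProj n q hq (z - y) < ε / 2} :=
    isOpen_lt ((continuous_toeplitzProj n q hq).comp (continuous_const.sub continuous_id))
      continuous_const
  obtain ⟨y, hy, hyl⟩ := mem_closure_iff.1 hz _ hopen (by simpa using half_pos hε)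
  obtain ⟨s, hs⟩ := exists_eq_sum_slice hyl
  -- Since `z` has no entries, `y` and `z - y` have the same entries up to sign. The seminorm of `y`
  -- is at most the weighted sum of its entries, hence at most the seminorm of `z - y`.
  have h1 : toeplitzProj n q hq y ≤ toeplitzProj n q hq (z - y) := by
    refine le_trans ?_ (sum_slice_entry_le n q hq s (z - y))
    conv_lhs => rw [← hs s subset_rfl]
    refine (Finset.le_sum_of_subadditive _ (map_zero _).le (map_add_le_add _) _ _).trans
      (Finset.sum_le_sum fun k _ => ?_)
    rw [map_sub, h, zero_sub, map_neg_eq_map, ← Toeplitz.seminorm_e]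
    exact toeplitzProj_ctmul_le n q hq _ _
  have h2 : toeplitzProj n q hq z ≤ toeplitzProj n q hq (z - y) + toeplitzProj n q hq y := by
    simpa using map_add_le_add (toeplitzProj n q hq) (z - y) y
  have h3 : toeplitzProj n q hq (z - y) < ε / 2 := hy
  linarith

/-- True on the algebraic sum, and preserved in the closure because every subspace of `A` is closed
in the fine topology. -/
theorem slice_mem_of_mem_lambdaOf {z : CompletedTensor Toeplitz (GWA σ P)}
    (hz : z ∈ lambdaOf (component σ P)) (k : ℕ × ℕ) :
    slice (GWA σ P) (Toeplitz.entry k) z ∈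
      component σ P ((k.1 : ℤ) + 1) * component σ P (-((k.2 : ℤ) + 1)) := by
  refine closure_minimal (fun t ht => ?_) ((fine_isClosed_submodule (GWA σ P) _).preimage
    (slice (GWA σ P) (Toeplitz.entry k)).continuous) hz
  refine lambdaAlg_induction (motive := fun t => slice (GWA σ P) (Toeplitz.entry k) t ∈
      component σ P ((k.1 : ℤ) + 1) * component σ P (-((k.2 : ℤ) + 1))) ?_ ?_ ?_ ht
  · intro i j a ha b hb
    rw [slice_entry_ctmul_e k (i, j)]
    split_ifs with h
    · subst h
      exact Submodule.mul_mem_mul ha hb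
    · exact zero_mem _
  · rw [map_zero]; exact zero_mem _
  · intro s t hs ht
    rw [map_add]
    exact add_mem hs ht

theorem y_pow_mul_ofPoly (n : ℕ) (d : ℂ[X]) :
    y σ P ^ n * ofPoly σ P d = ofPoly σ P (σ.symm^[n] d) * y σ P ^ n := by
  induction n generalizing d with
  | zero => simp
  | succ n ih => rw [pow_succ, mul_assoc, y_mul_ofPoly, ← mul_assoc, ih, mul_assoc,
      Function.iterate_succ_apply]

/-- The innermost pair `y x` becomes `P`, which is twisted by `σ⁻¹` each time it passes one of the
remaining `i` factors `y`. -/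
theorem y_pow_mul_x_pow_succ (i j : ℕ) : y σ P ^ (i + 1) * x σ P ^ (j + 1) =
    ofPoly σ P (σ.symm^[i] P) * (y σ P ^ i * x σ P ^ j) := by
  rw [pow_succ, pow_succ', mul_assoc, ← mul_assoc (y σ P), y_mul_x, ← mul_assoc,
    y_pow_mul_ofPoly, mul_assoc]

theorem exists_of_mem_component_mul {i j : ℕ} {c : GWA σ P}
    (hc : c ∈ component σ P ((i : ℤ) + 1) * component σ P (-((j : ℤ) + 1))) :
    ∃ d, c = ofPoly σ P d * (y σ P ^ (i + 1) * x σ P ^ (j + 1)) := by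
  refine Submodule.mul_induction_on
    (C := fun c => ∃ d, c = ofPoly σ P d * (y σ P ^ (i + 1) * x σ P ^ (j + 1))) hc ?_ ?_
  · intro a ha b hb
    obtain ⟨d, rfl⟩ := mem_component.1 ha
    obtain ⟨d', rfl⟩ := mem_component.1 hb
    have hi : unit σ P ((i : ℤ) + 1) = y σ P ^ (i + 1) := by
      rw [← unit_natCast]; push_cast; rfl
    have hj : unit σ P (-((j : ℤ) + 1)) = x σ P ^ (j + 1) := by
      rw [← unit_neg_natCast]; push_cast; rfl
    refine ⟨d * σ.symm^[i + 1] d', ?_⟩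
    rw [hi, hj, mul_assoc, ← mul_assoc (y σ P ^ (i + 1)), y_pow_mul_ofPoly, map_mul]
    simp only [mul_assoc]
  · rintro _ _ ⟨d, rfl⟩ ⟨d', rfl⟩
    exact ⟨d + d', by rw [map_add, add_mul]⟩

/-- An automorphism over `ℂ` fixes constants, so only a constant can have constant image. -/
theorem natDegree_symm_pos {d : ℂ[X]} (hd : 0 < d.natDegree) : 0 < (σ.symm d).natDegree := by
  by_contra h
  have h0 := eq_C_of_natDegree_eq_zero (Nat.eq_zero_of_not_pos h)
  have h1 : d = C ((σ.symm d).coeff 0) := by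
    conv_lhs => rw [← σ.apply_symm_apply d, h0]
    exact σ.commutes _
  rw [h1, natDegree_C] at hd
  exact lt_irrefl _ hd

/-- Each of the `min i j` cancelled pairs contributes a twisted copy of `P`, of degree at least `1`.
-/
theorem exists_y_pow_mul_x_pow (hP : 0 < P.natDegree) (i j : ℕ) :
    ∃ Q : ℂ[X], Q ≠ 0 ∧ min i j ≤ Q.natDegree ∧
      y σ P ^ i * x σ P ^ j = ofPoly σ P Q * unit σ P ((i : ℤ) - j) := by
  induction i generalizing j with
  | zero =>
    refine ⟨1, one_ne_zero, by simp, ?_⟩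
    rw [Nat.cast_zero, zero_sub, unit_neg_natCast]
    simp
  | succ i ih =>
    rcases j with _ | j
    · refine ⟨1, one_ne_zero, by simp, ?_⟩
      rw [Nat.cast_zero, sub_zero, unit_natCast]
      simp
    · obtain ⟨Q, hQ, hdeg, h⟩ := ih j
      have hpos : 0 < (σ.symm^[i] P).natDegree := by
        clear ih h
        induction i with
        | zero => exact hP
        | succ i ih =>
          rw [Function.iterate_succ_apply']
          exact natDegree_symm_pos (ih (le_trans (by omega) hdeg))
      have hne : σ.symm^[i] P ≠ 0 := fun h0 => by simp [h0] at hpos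
      refine ⟨σ.symm^[i] P * Q, mul_ne_zero hne hQ, ?_, ?_⟩
      · rw [natDegree_mul hne hQ]
        omega
      · rw [y_pow_mul_x_pow_succ, h, map_mul, mul_assoc]
        congr 3
        push_cast; ring

/-- If `P` is zero or non constant, a nonzero element of `A_{i+1} A_{-(j+1)}` has a coefficient of
degree greater than `min i j` in `h`. -/
theorem exists_coeff_ne_zero (hP : P = 0 ∨ 0 < P.natDegree) {i j : ℕ} {c : GWA σ P}
    (hc : c ∈ component σ P ((i : ℤ) + 1) * component σ P (-((j : ℤ) + 1))) (hc0 : c ≠ 0) :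
    ∃ m, min i j < m ∧ (normalForm σ P c ((i : ℤ) - j)).coeff m ≠ 0 := by
  obtain ⟨d, rfl⟩ := exists_of_mem_component_mul hc
  rcases hP with rfl | hP
  · refine absurd ?_ hc0
    have h0 : σ.symm^[i] 0 = 0 := Function.iterate_fixed (map_zero _) i
    rw [y_pow_mul_x_pow_succ, h0, map_zero, zero_mul, mul_zero]
  · obtain ⟨Q, hQ, hdeg, h⟩ := exists_y_pow_mul_x_pow (σ := σ) hP (i + 1) (j + 1)
    have hd : d ≠ 0 := by
      rintro rfl
      simp at hc0
    -- The leading coefficient of `d * Q` serves, as `deg (d Q) ≥ deg Q ≥ min (i + 1) (j + 1) > min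
    -- i j`.
    refine ⟨(d * Q).natDegree, ?_, ?_⟩
    · rw [natDegree_mul hd hQ]
      omega
    · rw [h, ← mul_assoc, ← map_mul, normalForm_ofPoly_mul_unit,
        show ((i + 1 : ℕ) : ℤ) - (j + 1 : ℕ) = i - j by push_cast; ring, Finsupp.single_eq_same,
        coeff_natDegree]
      exact leadingCoeff_ne_zero.2 (mul_ne_zero hd hQ)

/-- A seminorm on `A` adapted to `z` is at least `1` on each nonzero entry, while
`sum_slice_entry_le` bounds the sum of its values over all finite sets of entries. -/
theorem finite_slice_ne_zero (hP : P = 0 ∨ 0 < P.natDegree)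
    {z : CompletedTensor Toeplitz (GWA σ P)} (hz : z ∈ lambdaOf (component σ P)) :
    {k | slice (GWA σ P) (Toeplitz.entry k) z ≠ 0}.Finite := by
  let a : ℕ × ℕ → GWA σ P := fun k => slice (GWA σ P) (Toeplitz.entry k) z
  let b : Module.Basis (Σ _ : ℤ, ℕ) ℂ (ℤ →₀ ℂ[X]) := Finsupp.basis fun _ => basisMonomials ℂ
  let L : GWA σ P →ₗ[ℂ] ((Σ _ : ℤ, ℕ) →₀ ℂ) := b.repr.toLinearMap ∘ₗ normalForm σ P
  have hL : ∀ c n m, L c ⟨n, m⟩ = (normalForm σ P c n).coeff m := fun c n m => by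
    simp only [L, b, LinearMap.comp_apply, LinearEquiv.coe_coe, Finsupp.basis_repr]
    rfl
  -- An entry `(i, j)` detected in degree `i - j` at a coefficient `m > min i j` satisfies `max i j
  -- < m + |i - j|`. So a coordinate `l` detects only entries in this finite box.
  let B : (Σ _ : ℤ, ℕ) → Finset (ℕ × ℕ) := fun l =>
    Finset.range (l.2 + l.1.natAbs) ×ˢ Finset.range (l.2 + l.1.natAbs)
  -- The sum makes `w l * ‖L (a k) l‖ ≥ 1` for every `k` in the box with a nonzero coordinate at
  -- `l`; inverses of vanishing coordinates count as `0`.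
  let w : (Σ _ : ℤ, ℕ) → NNReal := fun l => ∑ k ∈ B l, ‖L (a k) l‖₊⁻¹
  let q : Seminorm ℂ (GWA σ P) := (weightedSeminorm w).comp L
  have hq : Continuous q := fine_continuous_seminorm _ q
  have key : ∀ k, a k ≠ 0 → 1 ≤ q (a k) := by
    intro k hk
    obtain ⟨m, hm, hne⟩ := exists_coeff_ne_zero hP (slice_mem_of_mem_lambdaOf hz k) hk
    set l : (Σ _ : ℤ, ℕ) := ⟨(k.1 : ℤ) - k.2, m⟩ with hl
    have hne' : ‖L (a k) l‖₊ ≠ 0 := by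
      rw [nnnorm_ne_zero_iff, hL]
      exact hne
    have hkB : k ∈ B l := by
      simp only [B, hl, Finset.mem_product, Finset.mem_range]
      omega
    have h1 : ‖L (a k) l‖₊⁻¹ ≤ w l :=
      Finset.single_le_sum (f := fun k => ‖L (a k) l‖₊⁻¹) (fun _ _ => zero_le) hkB
    have h2 : (1 : NNReal) ≤ w l * ‖L (a k) l‖₊ := by
      calc (1 : NNReal) = ‖L (a k) l‖₊⁻¹ * ‖L (a k) l‖₊ := (inv_mul_cancel₀ hne').symm
        _ ≤ _ := by gcongr
    have h3 := sum_le_weightedSeminorm w (L (a k)) {l}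
    rw [Finset.sum_singleton] at h3
    exact le_trans (by exact_mod_cast h2) h3
  by_contra hinf
  -- More nonzero entries than the value of the seminorm at `z` contradict the `ℓ¹`-bound.
  obtain ⟨N, hN⟩ := exists_nat_gt (toeplitzProj 0 q hq z)
  obtain ⟨s, hs, hcard⟩ := Set.Infinite.exists_subset_card_eq hinf N
  have h1 := sum_slice_entry_le 0 q hq s z
  have h2 : (N : ℝ) ≤ ∑ k ∈ s, (matrixWeight k : ℝ) ^ 0 *
      q (slice (GWA σ P) (Toeplitz.entry k) z) := by
    rw [← hcard, ← nsmul_one]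
    refine Finset.card_nsmul_le_sum _ _ _ fun k hk => ?_
    rw [pow_zero, one_mul]
    exact key k (hs hk)
  linarith

theorem lambdaOf_eq_lambdaAlg (hP : P = 0 ∨ 0 < P.natDegree) :
    lambdaOf (component σ P) = lambdaAlg (component σ P) := by
  refine le_antisymm (fun z hz => ?_) lambdaAlg_le_lambdaOf
  have hfin := finite_slice_ne_zero hP hz
  set y := ∑ k ∈ hfin.toFinset, ctmul (Toeplitz.e k.1 k.2)
    (slice (GWA σ P) (Toeplitz.entry k) z) with hy
  have hyl : y ∈ lambdaAlg (component σ P) := sum_mem fun k _ =>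
    le_iSup (lambdaPiece (component σ P)) k
      (Submodule.mem_map_of_mem (slice_mem_of_mem_lambdaOf hz k))
  -- The element `z` and the finite sum `y` of its entries lie in the closed sum and have equal
  -- entries, so they coincide.
  have h0 : z - y = 0 := by
    refine eq_zero_of_slice_eq_zero (sub_mem hz (lambdaAlg_le_lambdaOf hyl)) fun k => ?_
    rw [map_sub, hy, map_sum]
    simp only [slice_entry_ctmul_e, Finset.sum_ite_eq]
    by_cases hk : slice (GWA σ P) (Toeplitz.entry k) z = 0
    · rw [hk]; simp
    · rw [if_pos (hfin.mem_toFinset.2 hk), sub_self]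
  rw [sub_eq_zero.1 h0]
  exact hyl

/-! ### The extension -/

variable (σ P)

/-- The closed sum as an ideal of the Toeplitz algebra. -/
def lambdaIdeal : NonUnitalSubalgebra ℂ (toeplitzOf (component σ P)) where
  carrier := {t | (t : CompletedTensor Toeplitz (GWA σ P)) ∈ lambdaOf (component σ P)}
  add_mem' := fun ha hb => (lambdaOf (component σ P)).add_mem ha hb
  zero_mem' := zero_mem (lambdaOf (component σ P))
  mul_mem' := fun {a _} _ hb => (mul_mem_lambdaOf a.2 hb).1
  smul_mem' := fun c _ ha => (lambdaOf (component σ P)).smul_mem c ha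

variable {σ P} in
theorem mem_lambdaIdeal {t : toeplitzOf (component σ P)} : t ∈ lambdaIdeal σ P ↔
    (t : CompletedTensor Toeplitz (GWA σ P)) ∈ lambdaOf (component σ P) := Iff.rfl

/-- The restriction of the symbol map to the Toeplitz algebra, with values in `ℂ[h](σ, P)`. -/
def toeplitzSymbol : toeplitzOf (component σ P) →ₐ[ℂ] GWA σ P :=
  ((AlgEquiv.ofInjective (gradedEmbedding σ P)
      (isEmbedding_gradedEmbedding σ P).injective).symm : _ →ₐ[ℂ] GWA σ P).comp
    (((symbolTensor (GWA σ P)).comp (toeplitzOf (component σ P)).val).codRestrict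
      (gradedEmbedding σ P).range fun t => symbolTensor_mem_range t.2)

variable {σ P}

theorem gradedEmbedding_toeplitzSymbol (t : toeplitzOf (component σ P)) :
    gradedEmbedding σ P (toeplitzSymbol σ P t) =
      symbolTensor (GWA σ P) (t : CompletedTensor Toeplitz (GWA σ P)) :=
  congrArg Subtype.val (AlgEquiv.apply_symm_apply (AlgEquiv.ofInjective (gradedEmbedding σ P)
    (isEmbedding_gradedEmbedding σ P).injective) _)

/-- On the range of `j` the inverse of `j` is evaluation at `1`; this formula makes the continuity
of `toeplitzSymbol` visible. -/
theorem toeplitzSymbol_eq_slice (t : toeplitzOf (component σ P)) :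
    toeplitzSymbol σ P t = slice (GWA σ P) SmoothCircle.evalOne
      (symbolTensor (GWA σ P) (t : CompletedTensor Toeplitz (GWA σ P))) := by
  rw [← gradedEmbedding_toeplitzSymbol, slice_gradedEmbedding]

/-- If the symbol vanishes, the decomposition `t = s (p t) + u` reduces to its part `u` in the
closed sum. -/
theorem toeplitzSymbol_eq_zero_iff (t : toeplitzOf (component σ P)) :
    toeplitzSymbol σ P t = 0 ↔ t ∈ lambdaIdeal σ P := by
  constructor
  · intro h
    have := sub_gradedSection_mem_lambdaOf t.2
    rwa [← toeplitzSymbol_eq_slice, h, map_zero, sub_zero] at this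
  · intro h
    rw [toeplitzSymbol_eq_slice, symbolTensor_eq_zero_of_mem_lambdaOf (mem_lambdaIdeal.1 h),
      map_zero]

variable (σ P)

theorem range_gradedEmbedding : Set.range (gradedEmbedding σ P) =
    symbolTensor (GWA σ P) '' (toeplitzOf (component σ P) : Set _) := by
  ext z
  constructor
  · rintro ⟨a, rfl⟩
    exact ⟨_, gradedSection_mem a, symbolTensor_gradedSection a⟩
  · rintro ⟨t, ht, rfl⟩
    exact symbolTensor_mem_range ht

theorem map_lambdaIdeal : (lambdaIdeal σ P).toSubmodule.map
    (toeplitzOf (component σ P)).val.toLinearMap = lambdaOf (component σ P) := by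
  ext z
  constructor
  · rintro ⟨t, ht, rfl⟩
    exact ht
  · intro hz
    exact ⟨⟨z, lambdaOf_le_toeplitzOf hz⟩, hz, rfl⟩

theorem isLocallyConvexAlgebra : IsLocallyConvexAlgebra (GWA σ P) where
  isUniformAddGroup := inferInstance
  complete := inferInstance
  t2 := inferInstance

theorem isLocallyConvexAlgebra_toeplitzOf :
    IsLocallyConvexAlgebra (toeplitzOf (component σ P)) where
  toSeminormedMul := SeminormedMul.of_isInducing
    ((toeplitzOf (component σ P)).val :
      toeplitzOf (component σ P) →ₙₐ[ℂ] CompletedTensor Toeplitz (GWA σ P))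
    Topology.IsInducing.subtypeVal
  isUniformAddGroup :=
    inferInstanceAs (IsUniformAddGroup (toeplitzOf (component σ P)).toSubmodule.toAddSubgroup)
  complete := isClosed_toeplitzOf.completeSpace_coe
  t2 := inferInstance

theorem isClosed_lambdaIdeal : IsClosed (lambdaIdeal σ P : Set (toeplitzOf (component σ P))) :=
  isClosed_lambdaOf.preimage continuous_subtype_val

theorem isLocallyConvexAlgebra_lambdaIdeal : IsLocallyConvexAlgebra (lambdaIdeal σ P) where
  toSeminormedMul :=
    have := (isLocallyConvexAlgebra_toeplitzOf σ P).toSeminormedMul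
    SeminormedMul.of_isInducing (NonUnitalSubalgebraClass.subtype (lambdaIdeal σ P))
      Topology.IsInducing.subtypeVal
  isUniformAddGroup :=
    have := (isLocallyConvexAlgebra_toeplitzOf σ P).isUniformAddGroup
    inferInstanceAs (IsUniformAddGroup (lambdaIdeal σ P).toSubmodule.toAddSubgroup)
  complete :=
    have := (isLocallyConvexAlgebra_toeplitzOf σ P).complete
    (isClosed_lambdaIdeal σ P).completeSpace_coe
  t2 := inferInstance

theorem isLinearlySplitExtension_toeplitzSymbol :
    IsLinearlySplitExtension (NonUnitalSubalgebraClass.subtype (lambdaIdeal σ P))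
      (toeplitzSymbol σ P : toeplitzOf (component σ P) →ₙₐ[ℂ] GWA σ P) where
  left_lca := isLocallyConvexAlgebra_lambdaIdeal σ P
  middle_lca := isLocallyConvexAlgebra_toeplitzOf σ P
  right_lca := isLocallyConvexAlgebra σ P
  isEmbedding_left := Topology.IsEmbedding.subtypeVal
  continuous_right := by
    have h : Continuous fun t : toeplitzOf (component σ P) =>
        slice (GWA σ P) SmoothCircle.evalOne
          (symbolTensor (GWA σ P) (t : CompletedTensor Toeplitz (GWA σ P))) :=
      (ContinuousLinearMap.continuous _).comp
        ((continuous_symbolTensor _).comp continuous_subtype_val)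
    exact h.congr fun t => (toeplitzSymbol_eq_slice t).symm
  exact := fun t => (toeplitzSymbol_eq_zero_iff t).trans
    ⟨fun h => ⟨⟨t, h⟩, rfl⟩, by rintro ⟨u, rfl⟩; exact u.2⟩
  surjective_right := fun a => ⟨⟨gradedSection σ P a, gradedSection_mem a⟩,
    (toeplitzSymbol_eq_slice _).trans
      ((congrArg _ (symbolTensor_gradedSection a)).trans (slice_gradedEmbedding a))⟩
  exists_section := ⟨(gradedSection σ P).codRestrict (toeplitzOf (component σ P)).toSubmodule
      gradedSection_mem, fun a => (toeplitzSymbol_eq_slice _).trans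
        ((congrArg _ (symbolTensor_gradedSection a)).trans (slice_gradedEmbedding a))⟩

end GWA

end

theorem mainTheorem10 (σ : Polynomial ℂ ≃ₐ[ℂ] Polynomial ℂ) (P : Polynomial ℂ) :
    -- the sum of the `e i j ⊗ A_{i+1} A_{-(j+1)}` is direct, and closed unless `P` is a nonzero
    -- constant
    iSupIndep (lambdaPiece (GWA.component σ P)) ∧
    (P = 0 ∨ 0 < P.natDegree →
      lambdaOf (GWA.component σ P) = lambdaAlg (GWA.component σ P)) ∧
    -- the identification `a ↦ z ^ n ⊗ a`, for `a` in `A_n`, of `A` with the image of `𝒯_A`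
    ∃ j : GWA σ P →ₐ[ℂ] CompletedTensor SmoothCircle (GWA σ P),
      (∀ n : ℤ, ∀ a ∈ GWA.component σ P n, j a = ctmul (SmoothCircle.zpow n) a) ∧
      Topology.IsEmbedding j ∧
      Set.range j = symbolTensor (GWA σ P) '' (toeplitzOf (GWA.component σ P) : Set _) ∧
      -- the restriction `pbar` of `p` to `𝒯_A`, and `Λ_A` as an ideal of `𝒯_A`
      ∃ (pbar : toeplitzOf (GWA.component σ P) →ₐ[ℂ] GWA σ P)
        (Λ : NonUnitalSubalgebra ℂ (toeplitzOf (GWA.component σ P))),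
        (∀ t : toeplitzOf (GWA.component σ P),
          j (pbar t) = symbolTensor (GWA σ P) (t : CompletedTensor Toeplitz (GWA σ P))) ∧
        Λ.toSubmodule.map (toeplitzOf (GWA.component σ P)).val.toLinearMap =
          lambdaOf (GWA.component σ P) ∧
        (∀ t : toeplitzOf (GWA.component σ P), ∀ u ∈ Λ, t * u ∈ Λ ∧ u * t ∈ Λ) ∧
        IsLinearlySplitExtension (NonUnitalSubalgebraClass.subtype Λ)
          (pbar : toeplitzOf (GWA.component σ P) →ₙₐ[ℂ] GWA σ P) :=
  ⟨GWA.iSupIndep_lambdaPiece, GWA.lambdaOf_eq_lambdaAlg, GWA.gradedEmbedding σ P,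
    fun _ _ ha => GWA.gradedEmbedding_of_mem ha, GWA.isEmbedding_gradedEmbedding σ P,
    GWA.range_gradedEmbedding σ P, GWA.toeplitzSymbol σ P, GWA.lambdaIdeal σ P,
    GWA.gradedEmbedding_toeplitzSymbol, GWA.map_lambdaIdeal σ P,
    fun t _ hu => GWA.mul_mem_lambdaOf t.2 hu, GWA.isLinearlySplitExtension_toeplitzSymbol σ P⟩
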